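/- Let $d\ge 1$, let $|\cdot|$ be the Euclidean norm, and let $\mathcal P$ be the set of probability vectors $p=(p_z)_{z\in\mathbb Z^d}$ on $\mathbb Z^d$. Let $\omega=(\omega_x)_{x\in\mathbb Z^d}\in\Omega=\mathcal P^{\mathbb Z^d}$ be an environment whose components $\omega_x=(\omega_{x,z})_{z}$ are i.i.d. under the product measure $\mathbb P$, and put $\pi_{x,y}(\omega)=\omega_{x,y-x}$. Let $P^\omega_x$ be the path law of the Markov chain $(X_n)_{n\ge0}$ on $\mathbb Z^d$ with transition probabilities $\pi_{x,y}(\omega)$ started at $x$, let $P_x=\int P_x^\omega\,\mathbb P(d\omega)$, and let $P_{x,y}=\int P^\omega_x\otimes P^\omega_y\,\mathbb P(d\omega)$ be the averaged law of two walks $(X,\widetilde X)$ that are independent in a common environment. Let $\hat u\in\mathbb Z^d\setminus\{0\}$ and assume: * (non-nestling) there is $\delta>0$ with $\sum_z (z\cdot\hat u)\,\pi_{0,z}\ge\delta$ $\mathbb P$-a.s.; * (exponential moments) there are $M,s_0>0$ with $\sum_z e^{s_0|z|}\pi_{0,z}\le e^{s_0M}$ $\mathbb P$-a.s.; * (unit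 level steps) there is $\kappa>0$ with $\sum_{z:\,z\cdot\hat u=1}\pi_{0,z}\ge\kappa$ $\mathbb P$-a.s. *Common regeneration times.* For a pair of paths $(X,\widetilde X)$ set $\gamma_\ell=\inf\{n\ge0:X_n\cdot\hat u\ge\ell\}$, $\gamma_\ell^+=\inf\{n\ge0:X_n\cdot\hat u>\ell\}$, $\beta=\inf\{n\ge1:X_n\cdot\hat u<X_0\cdot\hat u\}$, $M_n=\max_{i\le n}X_i\cdot\hat u$, and let $\tilde\gamma_\ell,\tilde\gamma^+_\ell,\tilde\beta,\widetilde M_n$ be the same quantities for $\widetilde X$. Let $L=\inf\{\ell>(X_0\cdot\hat u)\wedge(\widetilde X_0\cdot\hat u): X_{\gamma_\ell}\cdot\hat u=\widetilde X_{\tilde\gamma_\ell}\cdot\hat u=\ell\}$. Let $\theta^{m,n}$ shift the first path by $m$ and the second by $n$. With $r=\beta\wedge\tilde\beta$ put $(\rho,\tilde\rho)=(\gamma^+_{M_r\vee\widetilde M_r},\tilde\gamma^+_{M_r\vee\widetilde M_r})$ if $r<\infty$ and $(\rho,\tilde\rho)=(\infty,\infty)$ otherwise; let $(\nu_1,\tilde\nu_1)=(\rho,\tilde\rho)+(\gamma_L,\tilde\gamma_L)\circ\theta^{\rho,\tilde\rho}$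 (infinite if $\rho\vee\tilde\rho=\infty$), $(\nu_0,\tilde\nu_0)=(0,0)$, $(\nu_{k+1},\tilde\nu_{k+1})=(\nu_k,\tilde\nu_k)+(\nu_1,\tilde\nu_1)\circ\theta^{\nu_k,\tilde\nu_k}$, $K=\sup\{k\ge0:\nu_k\vee\tilde\nu_k<\infty\}$, and $$(\mu_1,\tilde\mu_1)=(\gamma_L,\tilde\gamma_L)+(\nu_K,\tilde\nu_K)\circ\theta^{\gamma_L,\tilde\gamma_L}.$$ *Transitions.* On $\mathbb V_d=\{z\in\mathbb Z^d:z\cdot\hat u=0\}$ define $$q(x,y)=P_{0,x}\bigl[\widetilde X_{\tilde\mu_1}-X_{\mu_1}=y\,\big|\,\beta=\tilde\beta=\infty\bigr],\qquad \bar q(x,y)=(P_0\otimes P_x)\bigl[\bar X_{\bar\rho_1}-X_{\rho_1}=y\,\big|\,\beta=\bar\beta=\infty\bigr],$$ where in the second formula $(X,\bar X)$ are independent walks in independent environments and $(\rho_1,\bar\rho_1)$ is the same functional of $(X,\bar X)$ as $(\mu_1,\tilde\mu_1)$ is of $(X,\widetilde X)$. **Proposition.** There are constants $0<C,\alpha_1<\infty$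 and a Markov transition kernel on $\mathbb V_d\times\mathbb V_d$, with one-step laws $P_{x,\bar x}$ for $(Y_1,\bar Y_1)$ given $(Y_0,\bar Y_0)=(x,\bar x)$, such that for all $x,\bar x\in\mathbb V_d$ the marginal laws of $Y_1$ and $\bar Y_1$ under $P_{x,\bar x}$ are $q(x,\cdot)$ and $\bar q(\bar x,\cdot)$, and $$P_{x,x}[Y_1\ne\bar Y_1]\le Ce^{-\alpha_1|x|}\qquad\text{for all }x\in\mathbb V_d.$$ -/

import Mathlib

open MeasureTheory ProbabilityTheory
open scoped ENNReal

namespace RWRE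

/-- The integer lattice `ℤ^d`. -/
abbrev Lattice (d : ℕ) := Fin d → ℤ

/-- The Euclidean norm `|x|` of a lattice point. -/
noncomputable def eNorm {d : ℕ} (x : Lattice d) : ℝ :=
  ‖(WithLp.toLp 2 (fun i => (x i : ℝ)) : EuclideanSpace ℝ (Fin d))‖

/-- The simplex of probability vectors on `ℤ^d` (here `PMF (Lattice d)`) carries the σ-algebra
generated by the coordinates `p ↦ p z`. -/
instance instMeasurableSpaceSimplex (d : ℕ) : MeasurableSpace (PMF (Lattice d)) :=
  MeasurableSpace.comap (fun p z => p z) inferInstance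

/-- Environments: one probability vector for each site.  `ω x z` is the probability of making
the step `z` from the site `x`, so that `π_{x,y}(ω) = ω x (y - x)`.  The σ-algebra is the product
σ-algebra. -/
abbrev Env (d : ℕ) := Lattice d → PMF (Lattice d)

/-- The law of an i.i.d. environment whose single-site distribution is `m`. -/
noncomputable def envLaw {d : ℕ} (m : Measure (PMF (Lattice d))) : Measure (Env d) :=
  Measure.infinitePi (fun _ : Lattice d => m)

/-- Infinite paths in the lattice. -/
abbrev Path (d : ℕ) := ℕ → Lattice d

/-! ### Hypotheses on the environment -/

/-- Non-nestling in direction `u`: the drift at the origin has `u`-component at least `δ > 0`,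
almost surely.  (A divergent series has the value `0 < δ`, hence does not satisfy this.) -/
def NonNestling {d : ℕ} (m : Measure (PMF (Lattice d))) (u : Lattice d) : Prop :=
  ∃ δ : ℝ, 0 < δ ∧ ∀ᵐ ω ∂(envLaw m), δ ≤ ∑' z : Lattice d, ((z ⬝ᵥ u : ℤ) : ℝ) * (ω 0 z).toReal

/-- A uniform exponential moment for the steps. -/
def ExpMoment {d : ℕ} (m : Measure (PMF (Lattice d))) : Prop :=
  ∃ M s₀ : ℝ, 0 < M ∧ 0 < s₀ ∧ ∀ᵐ ω ∂(envLaw m),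
    ∑' z : Lattice d, ENNReal.ofReal (Real.exp (s₀ * eNorm z)) * ω 0 z
      ≤ ENNReal.ofReal (Real.exp (s₀ * M))

/-- Steps that raise the level by exactly one have probability at least `κ > 0`, almost surely. -/
def UnitLevelSteps {d : ℕ} (m : Measure (PMF (Lattice d))) (u : Lattice d) : Prop :=
  ∃ κ : ℝ, 0 < κ ∧ ∀ᵐ ω ∂(envLaw m),
    ENNReal.ofReal κ ≤ ∑' z : {z : Lattice d // z ⬝ᵥ u = 1}, ω 0 z

/-! ### Quenched and averaged laws -/

/-- The Markov kernel on the lattice given by `ω`: from `x` the walk moves to `x + z` with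
probability `ω x z`. -/
noncomputable def stepKernel {d : ℕ} (ω : Env d) : Kernel (Lattice d) (Lattice d) :=
  Kernel.ofFunOfCountable (fun x => ((ω x).map (fun z => x + z)).toMeasure)

instance instIsMarkovKernelStepKernel {d : ℕ} (ω : Env d) : IsMarkovKernel (stepKernel ω) :=
  ⟨fun x => inferInstanceAs (IsProbabilityMeasure ((ω x).map (fun z => x + z)).toMeasure)⟩

/-- `stepKernel ω` as a transition from the history up to time `n`, depending on the last
position only. -/
noncomputable def historyKernel {d : ℕ} (ω : Env d) (n : ℕ) :
    Kernel (Finset.Iic n → Lattice d) (Lattice d) :=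
  (stepKernel ω).comap (fun h => h ⟨n, Finset.mem_Iic.2 le_rfl⟩) (measurable_pi_apply _)

instance instIsMarkovKernelHistoryKernel {d : ℕ} (ω : Env d) (n : ℕ) :
    IsMarkovKernel (historyKernel ω n) := by
  unfold historyKernel; infer_instance

/-- The quenched path law `P_x^ω`: the Markov chain with transition `stepKernel ω` started
at `x`. -/
noncomputable def quenched {d : ℕ} (ω : Env d) (x : Lattice d) : Measure (Path d) :=
  Kernel.trajMeasure (X := fun _ => Lattice d) (Measure.dirac x) (historyKernel ω)

instance instIsProbabilityMeasureQuenched {d : ℕ} (ω : Env d) (x : Lattice d) :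
    IsProbabilityMeasure (quenched ω x) := by
  unfold quenched; infer_instance

section

open Finset

/-- Under `P_x^ω` the path starts at `x` and has the transition probabilities of `ω`. -/
theorem quenched_cylinder {d : ℕ} (ω : Env d) (x : Lattice d) (p : Path d) (n : ℕ) :
    quenched ω x {w | ∀ i ≤ n, w i = p i} =
      (if p 0 = x then 1 else 0) * ∏ i ∈ range n, ω (p i) (p (i+1) - p i) := by
  induction n with
  | zero =>
    have h := Kernel.traj_map_frestrictLe (X := fun _ => Lattice d) (κ := historyKernel ω) 0 0
    rw [Kernel.partialTraj_self] at h
    have e : {w : Path d | ∀ i ≤ 0, w i = p i} = (Preorder.frestrictLe (π := fun _ => Lattice d) 0) ⁻¹' {f | f ⟨0, by simp⟩ = p 0} := by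
      ext w; simp
    have hm : MeasurableSet {f : (i : Iic 0) → Lattice d | f ⟨0, by simp⟩ = p 0} :=
      (measurableSet_singleton (p 0)).preimage (measurable_pi_apply _)
    rw [e, ← Measure.map_apply (Preorder.measurable_frestrictLe 0) hm, quenched, Kernel.trajMeasure,
      ← Measure.deterministic_comp_eq_map (Preorder.measurable_frestrictLe 0), Measure.comp_assoc,
      Kernel.deterministic_comp_eq_map, h, Measure.id_comp]
    erw [Measure.map_apply (MeasurableEquiv.measurable _) hm]
    erw [Measure.dirac_apply' _ (MeasurableEquiv.measurable _ hm)]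
    simp [Set.indicator, eq_comm, MeasurableEquiv.piUnique]
  | succ n ih =>
    have h := Kernel.map_frestrictLe_trajMeasure_compProd_eq_map_trajMeasure (X := fun _ => Lattice d) (μ₀ := Measure.dirac x) (κ := historyKernel ω) (a := n)
    set A : Set (Iic n → Lattice d) := {f | ∀ i : Iic n, f i = p i} with hA
    have hAm : MeasurableSet A := by
      have : A = ({fun i : Iic n => p i} : Set (Iic n → Lattice d)) := by
        ext f; simp only [hA, Set.mem_ofPred_eq, Set.mem_singleton_iff, funext_iff]
      rw [this]; exact measurableSet_singleton _
    have e : {w : Path d | ∀ i ≤ n+1, w i = p i} = (fun w : Path d => (Preorder.frestrictLe (π := fun _ => Lattice d) n w, w (n+1))) ⁻¹' (A ×ˢ {p (n+1)}) := by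
      ext w
      simp only [Set.mem_ofPred_eq, Set.mem_preimage, Set.mem_prod, hA, Set.mem_singleton_iff, Subtype.forall, mem_Iic, Preorder.frestrictLe_apply]
      constructor
      · intro h; exact ⟨fun i hi => h i (by omega), h _ le_rfl⟩
      · rintro ⟨h1, h2⟩ i hi
        rcases Nat.lt_or_ge i (n+1) with h | h
        · exact h1 i (by omega)
        · have : i = n+1 := by omega
          subst this; exact h2
    have e2 : {w : Path d | ∀ i ≤ n, w i = p i} = (Preorder.frestrictLe (π := fun _ => Lattice d) n) ⁻¹' A := by
      ext w; simp [hA]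
    have hq : quenched ω x = Kernel.trajMeasure (X := fun _ => Lattice d) (Measure.dirac x) (historyKernel ω) := rfl
    have hs : ∀ y z : Lattice d, stepKernel ω y {z} = ω y (z - y) := by
      intro y z
      show ((ω y).map (fun z => y + z)).toMeasure {z} = _
      rw [PMF.toMeasure_apply_singleton _ _ (measurableSet_singleton _), PMF.map_apply, tsum_eq_single (z - y)]
      · simp
      · intro b hb; rw [if_neg]; rintro rfl; simp at hb
    rw [e, hq, ← Measure.map_apply (by fun_prop) (hAm.prod (measurableSet_singleton _)), ← h,
      Measure.compProd_apply_prod hAm (measurableSet_singleton _)]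
    rw [prod_range_succ, ← mul_assoc, ← ih, e2, hq, ← Measure.map_apply (Preorder.measurable_frestrictLe n) hAm]
    rw [setLIntegral_congr_fun (g := fun _ => ω (p n) (p (n+1) - p n)) hAm, setLIntegral_const, mul_comm]
    intro f hf
    simp only [historyKernel, Kernel.comap_apply, hs]
    rw [hf]

/-- `ω ↦ P_x^ω` is measurable, so that the averaged laws below are meaningful. -/
theorem measurable_quenched {d : ℕ} (x : Lattice d) : Measurable (fun ω : Env d => quenched ω x) := by
  have gen : (inferInstance : MeasurableSpace (Path d)) = MeasurableSpace.generateFrom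
      (insert ∅ {s | ∃ (p : Path d) (n : ℕ), s = {w | ∀ i ≤ n, w i = p i}}) := by
    apply le_antisymm
    · show MeasurableSpace.pi ≤ _
      refine iSup_le fun n => ?_
      rw [← measurable_iff_comap_le]
      refine @measurable_to_countable' _ _ _ _ (_) _ fun z => ?_
      have : (fun w : Path d => w n) ⁻¹' {z} = ⋃ f : {f : Iic n → Lattice d // f ⟨n, by simp⟩ = z},
          {w : Path d | ∀ i ≤ n, w i = if h : i ≤ n then f.1 ⟨i, by simpa using h⟩ else 0} := by
        ext w
        simp only [Set.mem_preimage, Set.mem_singleton_iff, Set.mem_iUnion, Set.mem_ofPred_eq]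
        constructor
        · intro h; refine ⟨⟨fun i => w i, h⟩, fun i hi => by simp [hi]⟩
        · rintro ⟨f, hf⟩; rw [hf n le_rfl]; simp [f.2]
      rw [this]
      refine MeasurableSet.iUnion fun f => MeasurableSpace.measurableSet_generateFrom (Or.inr ⟨_, n, rfl⟩)
    · refine MeasurableSpace.generateFrom_le ?_
      rintro s (rfl | ⟨p, n, rfl⟩)
      · exact MeasurableSet.empty
      · simp only [Set.ofPred_forall]
        exact MeasurableSet.iInter fun i => MeasurableSet.iInter fun _ => (measurableSet_singleton (p i)).preimage (measurable_pi_apply i)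
  refine Measurable.measure_of_isPiSystem_of_isProbabilityMeasure gen ?_ ?_
  · rintro s (rfl | ⟨p, n, rfl⟩) t (rfl | ⟨p', n', rfl⟩) hne
    · simp
    · simp
    · simp
    · obtain ⟨w, hw, hw'⟩ := hne
      refine Or.inr ⟨w, max n n', ?_⟩
      ext v
      simp only [Set.mem_inter_iff, Set.mem_ofPred_eq] at hw hw' ⊢
      constructor
      · rintro ⟨h1, h2⟩ i hi
        rcases le_max_iff.1 hi with h | h
        · rw [h1 i h, hw i h]
        · rw [h2 i h, hw' i h]
      · intro h; exact ⟨fun i hi => by rw [h i (le_max_of_le_left hi), hw i hi], fun i hi => by rw [h i (le_max_of_le_right hi), hw' i hi]⟩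
  · rintro s (rfl | ⟨p, n, rfl⟩)
    · simp
    · simp_rw [quenched_cylinder]
      refine Measurable.const_mul (Finset.measurable_prod _ fun i _ => ?_) _
      have h1 : Measurable (fun q : PMF (Lattice d) => (fun z => q z)) := comap_measurable _
      exact (measurable_pi_apply _).comp (h1.comp (measurable_pi_apply (p i)))

end

/-- The averaged law `P_x = ∫ P_x^ω ℙ(dω)` of one walk. -/
noncomputable def averaged {d : ℕ} (m : Measure (PMF (Lattice d))) (x : Lattice d) :
    Measure (Path d) :=
  (envLaw m).bind (fun ω => quenched ω x)

/-- The averaged law `P_{x,y} = ∫ P_x^ω ⊗ P_y^ω ℙ(dω)` of two walks that are independent given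
a common environment. -/
noncomputable def averagedPair {d : ℕ} (m : Measure (PMF (Lattice d))) (x y : Lattice d) :
    Measure (Path d × Path d) :=
  (envLaw m).bind (fun ω => (quenched ω x).prod (quenched ω y))

/-! ### Functionals of one path -/

/-- The path after time `k`. -/
def shift {d : ℕ} (k : ℕ) (w : Path d) : Path d := fun n => w (k + n)

/-- `γ_ℓ = inf {n ≥ 0 : X_n · u ≥ ℓ}`. -/
noncomputable def hitTime {d : ℕ} (u : Lattice d) (ℓ : ℤ) (w : Path d) : ℕ∞ :=
  ⨅ (n : ℕ) (_ : ℓ ≤ w n ⬝ᵥ u), (n : ℕ∞)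

/-- `γ⁺_ℓ = inf {n ≥ 0 : X_n · u > ℓ}`. -/
noncomputable def hitTimeAbove {d : ℕ} (u : Lattice d) (ℓ : ℤ) (w : Path d) : ℕ∞ :=
  ⨅ (n : ℕ) (_ : ℓ < w n ⬝ᵥ u), (n : ℕ∞)

/-- The first backtracking time `β = inf {n ≥ 1 : X_n · u < X_0 · u}`. -/
noncomputable def backtrackTime {d : ℕ} (u : Lattice d) (w : Path d) : ℕ∞ :=
  ⨅ (n : ℕ) (_ : 1 ≤ n ∧ w n ⬝ᵥ u < w 0 ⬝ᵥ u), (n : ℕ∞)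

/-- The running maximum `M_n = sup {X_i · u : i ≤ n}`. -/
def runMax {d : ℕ} (u : Lattice d) (n : ℕ) (w : Path d) : ℤ :=
  (Finset.range (n + 1)).sup' Finset.nonempty_range_add_one (fun i => w i ⬝ᵥ u)

/-! ### Common regeneration times of two paths

A pair of times, one for each path, is an element of `Option (ℕ × ℕ)`; the value `none` means
that the times are not both finite. -/

open Classical in
/-- Two extended times as a joint time. -/
noncomputable def jointTime (s t : ℕ∞) : Option (ℕ × ℕ) :=
  if s = ⊤ ∨ t = ⊤ then none else some (s.toNat, t.toNat)

/-- `S + T ∘ θ^S`: first wait for the joint time `S`, then for the joint time `T` of the shifted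
pair of paths. -/
def andThen {d : ℕ} (S T : Path d → Path d → Option (ℕ × ℕ)) (w w' : Path d) :
    Option (ℕ × ℕ) :=
  (S w w').bind fun s => (T (shift s.1 w) (shift s.2 w')).map fun t => (s.1 + t.1, s.2 + t.2)

/-- The levels `ℓ > (X_0 · u) ∧ (X̃_0 · u)` with
`X_{γ_ℓ} · u = X̃_{γ̃_ℓ} · u = ℓ` (both hitting times being finite). -/
def freshLevels {d : ℕ} (u : Lattice d) (w w' : Path d) : Set ℤ :=
  {ℓ | min (w 0 ⬝ᵥ u) (w' 0 ⬝ᵥ u) < ℓ ∧ hitTime u ℓ w ≠ ⊤ ∧ hitTime u ℓ w' ≠ ⊤ ∧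
    w (hitTime u ℓ w).toNat ⬝ᵥ u = ℓ ∧ w' (hitTime u ℓ w').toNat ⬝ᵥ u = ℓ}

open Classical in
/-- `(γ_L, γ̃_L)`, where `L` is the smallest fresh common level.  (The set of fresh levels is
bounded below, so that its infimum is a minimum when it is nonempty.) -/
noncomputable def freshTime {d : ℕ} (u : Lattice d) (w w' : Path d) : Option (ℕ × ℕ) :=
  if (freshLevels u w w').Nonempty then
    jointTime (hitTime u (sInf (freshLevels u w w')) w) (hitTime u (sInf (freshLevels u w w')) w')
  else none

open Classical in
/-- `(ρ, ρ̃)`: with `r = β ∧ β̃` the first time at which one of the walks backtracks, the first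
times at which the walks exceed the level `M_r ∨ M̃_r`; infinite when neither walk backtracks. -/
noncomputable def exceedTime {d : ℕ} (u : Lattice d) (w w' : Path d) : Option (ℕ × ℕ) :=
  if min (backtrackTime u w) (backtrackTime u w') = ⊤ then none
  else
    let r := (min (backtrackTime u w) (backtrackTime u w')).toNat
    let ℓ := max (runMax u r w) (runMax u r w')
    jointTime (hitTimeAbove u ℓ w) (hitTimeAbove u ℓ w')

/-- `(ν_1, ν̃_1) = (ρ, ρ̃) + (γ_L, γ̃_L) ∘ θ^{ρ, ρ̃}`. -/
noncomputable def retryTime {d : ℕ} (u : Lattice d) : Path d → Path d → Option (ℕ × ℕ) :=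
  andThen (exceedTime u) (freshTime u)

/-- `(ν_0, ν̃_0) = (0, 0)` and
`(ν_{k+1}, ν̃_{k+1}) = (ν_k, ν̃_k) + (ν_1, ν̃_1) ∘ θ^{ν_k, ν̃_k}`. -/
noncomputable def retryTimeIter {d : ℕ} (u : Lattice d) :
    ℕ → Path d → Path d → Option (ℕ × ℕ)
  | 0 => fun _ _ => some (0, 0)
  | k + 1 => andThen (retryTimeIter u k) (retryTime u)

open Classical in
/-- `(ν_K, ν̃_K)` with `K = sup {k : ν_k ∨ ν̃_k < ∞}`.  As soon as one `ν_k` is infinite so are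
all the later ones, hence `K` is the smallest `k` with `ν_{k+1}` infinite; the value is infinite
when there is no such `k`. -/
noncomputable def lastRetryTime {d : ℕ} (u : Lattice d) (w w' : Path d) : Option (ℕ × ℕ) :=
  if h : ∃ k, retryTimeIter u (k + 1) w w' = none then retryTimeIter u (Nat.find h) w w' else none

/-- The first common regeneration times
`(μ_1, μ̃_1) = (γ_L, γ̃_L) + (ν_K, ν̃_K) ∘ θ^{γ_L, γ̃_L}`. -/
noncomputable def regenTime {d : ℕ} (u : Lattice d) : Path d → Path d → Option (ℕ × ℕ) :=
  andThen (freshTime u) (lastRetryTime u)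

/-- The event `X̃_{μ̃_1} - X_{μ_1} = y` (which includes the finiteness of the times). -/
def regenDiffEvent {d : ℕ} (u y : Lattice d) : Set (Path d × Path d) :=
  {p | ∃ s t : ℕ, regenTime u p.1 p.2 = some (s, t) ∧ p.2 t - p.1 s = y}

/-- The event `β = β̃ = ∞` that neither walk backtracks. -/
def noBacktrack {d : ℕ} (u : Lattice d) : Set (Path d × Path d) :=
  {p | backtrackTime u p.1 = ⊤ ∧ backtrackTime u p.2 = ⊤}

/-! ### The two transition probabilities -/

/-- `𝕍_d = {z ∈ ℤ^d : z · u = 0}`. -/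
abbrev LevelZero {d : ℕ} (u : Lattice d) := {z : Lattice d // z ⬝ᵥ u = 0}

/-- `q(x, y) = P_{0,x}[X̃_{μ̃_1} - X_{μ_1} = y | β = β̃ = ∞]` for two walks in a common
environment. -/
noncomputable def q {d : ℕ} (m : Measure (PMF (Lattice d))) (u : Lattice d)
    (x y : LevelZero u) : ℝ≥0∞ :=
  ProbabilityTheory.cond (averagedPair m 0 x) (noBacktrack u) (regenDiffEvent u y)

/-- `q̄(x, y) = P_0 ⊗ P_x[X̄_{ρ̄_1} - X_{ρ_1} = y | β = β̄ = ∞]` for two independent walks in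
independent environments. -/
noncomputable def qBar {d : ℕ} (m : Measure (PMF (Lattice d))) (u : Lattice d)
    (x y : LevelZero u) : ℝ≥0∞ :=
  ProbabilityTheory.cond ((averaged m 0).prod (averaged m x)) (noBacktrack u) (regenDiffEvent u y)

end RWRE

/-! The kernel uses, for each pair of starting points, the maximal coupling of `q x` and `qBar x'`.
On the diagonal the two coordinates then differ with probability at most `1 - ∑ min (q x y) (qBar x
y)`, so the task is to show that two explicit laws are exponentially close in `|x|`. The couplings
themselves come from `exists_coupling`; since the state space is countable, they need no measurable
selection.

The two laws differ only through the environment, which is shared in one case and independent in the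
other. The quenched probability of an initial path segment involves only the sites from which the
walk steps, and distinct sites are independent. Hence the averaged laws agree on every event that is
determined by the paths up to time `n` and forces the two ranges up to time `n` to be disjoint
(`averagedPair_eq_of_determinedBy`).

The events in `q` and `qBar` look at the whole future, but at a common regeneration both walks stop
backtracking for good. Once the regeneration has occurred by time `n`, both the absence of
backtracking and the difference at the regeneration can be read off the paths frozen at time `n`
(`freeze_mem_regenEvent_iff`). The errors are the probability that the regeneration is late and the
probability that the ranges meet; `one_sub_tsum_min_le` turns them into a bound on the conditional
laws, because the probability of no backtracking is bounded from below. Taking `n` to be a small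
multiple of `|x|` makes both errors exponentially small (`exists_time_scale`).

The main work is the exponential tail of the regeneration time (`exists_lintegral_regenTime_le`). A
Lyapunov function for the distance of the walks to a moving target level gives exponential moments
of the first common fresh level. Linear growth gives exponential moments of the exceedance time
after a backtracking. The two combine to a moment of one retry, which is brought below one because a
retry fails to occur with positive probability; the successive retries then sum to a geometric
series.

All estimates are quenched, and are proved for two walks in two possibly different environments that
satisfy `StepBounds` with the same constants. They pass to both averaged laws at once
(`InheritsBounds`). -/

namespace RWRE

variable {d : ℕ}

/-! ### The Markov property of the quenched walk -/

/-- The paths that agree with `p` up to time `k`. -/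
def cyl (p : Path d) (k : ℕ) : Set (Path d) := {w | ∀ i ≤ k, w i = p i}

theorem measurableSet_cyl (p : Path d) (k : ℕ) : MeasurableSet (cyl p k) := by
  simp only [cyl, Set.ofPred_forall]
  exact MeasurableSet.iInter fun i => MeasurableSet.iInter fun _ =>
    (measurableSet_singleton (p i)).preimage (measurable_pi_apply i)

theorem measurable_shift (k : ℕ) : Measurable (shift (d := d) k) :=
  measurable_pi_lambda _ fun n => measurable_pi_apply (k + n)

theorem generateFrom_cyl : (inferInstance : MeasurableSpace (Path d)) =
    MeasurableSpace.generateFrom (insert ∅ {s | ∃ (p : Path d) (n : ℕ), s = cyl p n}) := by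
  apply le_antisymm
  · show MeasurableSpace.pi ≤ _
    refine iSup_le fun n => ?_
    rw [← measurable_iff_comap_le]
    refine @measurable_to_countable' _ _ _ _ (_) _ fun z => ?_
    have : (fun w : Path d => w n) ⁻¹' {z} =
        ⋃ f : {f : Finset.Iic n → Lattice d // f ⟨n, by simp⟩ = z},
          cyl (fun i => if h : i ≤ n then f.1 ⟨i, by simpa using h⟩ else 0) n := by
      ext w
      simp only [Set.mem_preimage, Set.mem_singleton_iff, Set.mem_iUnion, cyl, Set.mem_ofPred_eq]
      constructor
      · intro h; refine ⟨⟨fun i => w i, h⟩, fun i hi => by simp [hi]⟩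
      · rintro ⟨f, hf⟩; rw [hf n le_rfl]; simp [f.2]
    rw [this]
    exact MeasurableSet.iUnion fun f =>
      MeasurableSpace.measurableSet_generateFrom (Or.inr ⟨_, n, rfl⟩)
  · refine MeasurableSpace.generateFrom_le ?_
    rintro s (rfl | ⟨p, n, rfl⟩)
    · exact MeasurableSet.empty
    · exact measurableSet_cyl p n

theorem isPiSystem_cyl : IsPiSystem (insert ∅ {s | ∃ (p : Path d) (n : ℕ), s = cyl p n}) := by
  rintro s (rfl | ⟨p, n, rfl⟩) t (rfl | ⟨p', n', rfl⟩) hne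
  · simp
  · simp
  · simp
  · obtain ⟨w, hw, hw'⟩ := hne
    refine Or.inr ⟨w, max n n', ?_⟩
    ext v
    simp only [cyl, Set.mem_inter_iff, Set.mem_ofPred_eq] at hw hw' ⊢
    constructor
    · rintro ⟨h1, h2⟩ i hi
      rcases le_max_iff.1 hi with h | h
      · rw [h1 i h, hw i h]
      · rw [h2 i h, hw' i h]
    · intro h
      exact ⟨fun i hi => by rw [h i (le_max_of_le_left hi), hw i hi],
        fun i hi => by rw [h i (le_max_of_le_right hi), hw' i hi]⟩

theorem cyl_inter_shift_eq_empty {p p' : Path d} {k n : ℕ} (h : p' 0 ≠ p k) :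
    shift k ⁻¹' cyl p' n ∩ cyl p k = ∅ := by
  ext w
  simp only [cyl, shift, Set.mem_inter_iff, Set.mem_preimage, Set.mem_ofPred_eq,
    Set.mem_empty_iff_false, iff_false, not_and]
  intro h1 h2
  have a := h1 0 (Nat.zero_le _)
  have b := h2 k le_rfl
  simp only [add_zero] at a
  exact h (a.symm.trans b)

theorem quenched_cyl (ω : Env d) (x : Lattice d) (p : Path d) (n : ℕ) :
    quenched ω x (cyl p n) =
      (if p 0 = x then 1 else 0) * ∏ i ∈ Finset.range n, ω (p i) (p (i + 1) - p i) :=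
  quenched_cylinder ω x p n

theorem quenched_cyl_inter_shift (ω : Env d) (x : Lattice d) (p p' : Path d) (k n : ℕ) :
    quenched ω x (shift k ⁻¹' cyl p' n ∩ cyl p k) =
      quenched ω x (cyl p k) * quenched ω (p k) (cyl p' n) := by
  by_cases h : p' 0 = p k
  · set c : Path d := fun i => if i ≤ k then p i else p' (i - k) with hc
    have c1 : ∀ i ≤ k, c i = p i := fun i hi => by simp [hc, hi]
    have c2 : ∀ i, c (k + i) = p' i := by
      intro i
      rcases Nat.eq_zero_or_pos i with rfl | hi
      · simp [hc, h]
      · have : ¬ k + i ≤ k := by omega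
        simp [hc, this]
    have e : shift k ⁻¹' cyl p' n ∩ cyl p k = cyl c (k + n) := by
      ext w
      simp only [cyl, shift, Set.mem_inter_iff, Set.mem_preimage, Set.mem_ofPred_eq]
      constructor
      · rintro ⟨h1, h2⟩ i hi
        rcases le_total i k with h' | h'
        · rw [h2 i h', c1 i h']
        · obtain ⟨j, rfl⟩ := Nat.exists_eq_add_of_le h'
          rw [h1 j (by omega), c2]
      · intro h'
        exact ⟨fun i hi => by rw [h' _ (by omega), c2], fun i hi => by rw [h' i (by omega), c1 i hi]⟩
    rw [e, quenched_cyl, quenched_cyl, quenched_cyl, Finset.prod_range_add, c1 0 (Nat.zero_le _),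
      if_pos h, one_mul, mul_assoc]
    congr 2
    · exact Finset.prod_congr rfl fun i hi => by
        have := Finset.mem_range.1 hi
        rw [c1 i (by omega), c1 (i + 1) (by omega)]
    · exact Finset.prod_congr rfl fun i hi => by rw [add_assoc, c2, c2]
  · rw [cyl_inter_shift_eq_empty h, quenched_cyl ω (p k), if_neg h]
    simp

/-- The Markov property at time `k`. -/
theorem map_shift_restrict_quenched (ω : Env d) (x : Lattice d) (p : Path d) (k : ℕ) :
    ((quenched ω x).restrict (cyl p k)).map (shift k) =
      quenched ω x (cyl p k) • quenched ω (p k) := by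
  refine ext_of_generate_finite _ generateFrom_cyl isPiSystem_cyl ?_ ?_
  · rintro s (rfl | ⟨p', n, rfl⟩)
    · simp
    · rw [Measure.map_apply (measurable_shift k) (measurableSet_cyl _ _),
        Measure.restrict_apply ((measurableSet_cyl _ _).preimage (measurable_shift k)),
        quenched_cyl_inter_shift, Measure.smul_apply, smul_eq_mul]
  · rw [Measure.map_apply (measurable_shift k) MeasurableSet.univ]
    simp

theorem quenched_start (ω : Env d) (x : Lattice d) : ∀ᵐ w ∂(quenched ω x), w 0 = x := by
  have h : quenched ω x (cyl (fun _ => x) 0) = 1 := by rw [quenched_cyl]; simp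
  have := (prob_compl_eq_zero_iff (measurableSet_cyl (fun _ : ℕ => x) 0)).2 h
  rw [ae_iff]
  refine measure_mono_null ?_ this
  intro w hw
  simpa [cyl] using hw

/-! ### Pairs of independent walks and events determined by initial segments. -/

/-- The law of two independent walks, in the environments `ω` and `ω'`. -/
noncomputable def quenchedPair (ω ω' : Env d) (x y : Lattice d) : Measure (Path d × Path d) :=
  (quenched ω x).prod (quenched ω' y)

instance (ω ω' : Env d) (x y : Lattice d) : IsProbabilityMeasure (quenchedPair ω ω' x y) := by
  unfold quenchedPair; infer_instance

/-- Shifting both paths, by possibly different amounts. -/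
def shiftPair (s t : ℕ) : Path d × Path d → Path d × Path d := Prod.map (shift s) (shift t)

theorem measurable_shiftPair (s t : ℕ) : Measurable (shiftPair (d := d) s t) :=
  (measurable_shift s).prodMap (measurable_shift t)

theorem map_shiftPair_restrict (ω ω' : Env d) (x y : Lattice d) (p p' : Path d) (s t : ℕ) :
    ((quenchedPair ω ω' x y).restrict (cyl p s ×ˢ cyl p' t)).map (shiftPair s t) =
      quenchedPair ω ω' x y (cyl p s ×ˢ cyl p' t) • quenchedPair ω ω' (p s) (p' t) := by
  unfold quenchedPair shiftPair
  rw [← Measure.prod_restrict, ← Measure.map_prod_map _ _ (measurable_shift s) (measurable_shift t),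
    map_shift_restrict_quenched, map_shift_restrict_quenched, Measure.prod_smul_left,
    Measure.prod_smul_right, Measure.prod_prod, smul_smul]

theorem quenchedPair_start (ω ω' : Env d) (x y : Lattice d) :
    ∀ᵐ p ∂(quenchedPair ω ω' x y), p.1 0 = x ∧ p.2 0 = y := by
  have h1 : ∀ᵐ p ∂(quenchedPair ω ω' x y), p.1 0 = x :=
    Measure.quasiMeasurePreserving_fst.ae (quenched_start ω x)
  have h2 : ∀ᵐ p ∂(quenchedPair ω ω' x y), p.2 0 = y :=
    Measure.quasiMeasurePreserving_snd.ae (quenched_start ω' y)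
  exact h1.and h2

/-- `A` only depends on the first path up to time `s` and on the second path up to time `t`. -/
def DeterminedBy (s t : ℕ) (A : Set (Path d × Path d)) : Prop :=
  ∀ p q : Path d × Path d, (∀ i ≤ s, p.1 i = q.1 i) → (∀ i ≤ t, p.2 i = q.2 i) → p ∈ A → q ∈ A

/-- A path that agrees with the given initial segment. -/
noncomputable def extend {s : ℕ} (a : Finset.Iic s → Lattice d) : Path d :=
  fun i => if h : i ≤ s then a ⟨i, Finset.mem_Iic.2 h⟩ else 0

/-- The set of path pairs with given initial segments. -/
def box (s t : ℕ) (a : (Finset.Iic s → Lattice d) × (Finset.Iic t → Lattice d)) :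
    Set (Path d × Path d) := cyl (extend a.1) s ×ˢ cyl (extend a.2) t

theorem mem_box {s t : ℕ} {a : (Finset.Iic s → Lattice d) × (Finset.Iic t → Lattice d)}
    {p : Path d × Path d} : p ∈ box s t a ↔
      (fun i : Finset.Iic s => p.1 i) = a.1 ∧ (fun i : Finset.Iic t => p.2 i) = a.2 := by
  simp only [box, cyl, extend, Set.mem_prod, Set.mem_ofPred_eq, funext_iff, Subtype.forall,
    Finset.mem_Iic]
  constructor
  · rintro ⟨h1, h2⟩
    exact ⟨fun i hi => by simpa [hi] using h1 i hi, fun i hi => by simpa [hi] using h2 i hi⟩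
  · rintro ⟨h1, h2⟩
    exact ⟨fun i hi => by simpa [hi] using h1 i hi, fun i hi => by simpa [hi] using h2 i hi⟩

theorem measurableSet_box (s t : ℕ) (a) : MeasurableSet (box (d := d) s t a) :=
  (measurableSet_cyl _ _).prod (measurableSet_cyl _ _)

theorem iUnion_box (s t : ℕ) : ⋃ a, box (d := d) s t a = Set.univ := by
  ext p
  simp only [Set.mem_iUnion, Set.mem_univ, iff_true]
  exact ⟨(_, _), mem_box.2 ⟨rfl, rfl⟩⟩

theorem pairwise_disjoint_box (s t : ℕ) : Pairwise (Function.onFun Disjoint (box (d := d) s t)) := by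
  intro a b hab
  refine Set.disjoint_left.2 fun p hp hq => hab ?_
  rw [mem_box] at hp hq
  exact Prod.ext (hp.1.symm.trans hq.1) (hp.2.symm.trans hq.2)

/-- Boxes are the atoms of the information available at the times `s` and `t`, so an event
determined by that information contains a box or misses it. There are countably many boxes, which
reduces measurability and the Markov property to a single box. -/
theorem DeterminedBy.inter_box {s t : ℕ} {A : Set (Path d × Path d)} (hA : DeterminedBy s t A) (a) :
    (extend a.1, extend a.2) ∈ A ∧ A ∩ box s t a = box s t a ∨
    (extend a.1, extend a.2) ∉ A ∧ A ∩ box s t a = ∅ := by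
  by_cases h : (extend a.1, extend a.2) ∈ A
  · refine Or.inl ⟨h, Set.inter_eq_right.2 fun p hp => ?_⟩
    exact hA _ p (fun i hi => (hp.1 i hi).symm) (fun i hi => (hp.2 i hi).symm) h
  · refine Or.inr ⟨h, Set.eq_empty_of_forall_notMem fun p hp => h ?_⟩
    exact hA p _ (fun i hi => hp.2.1 i hi) (fun i hi => hp.2.2 i hi) hp.1

theorem eq_iUnion_inter_box (s t : ℕ) (A : Set (Path d × Path d)) : A = ⋃ a, A ∩ box s t a := by
  rw [← Set.inter_iUnion, iUnion_box, Set.inter_univ]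

theorem DeterminedBy.measurableSet {s t : ℕ} {A : Set (Path d × Path d)}
    (hA : DeterminedBy s t A) : MeasurableSet A := by
  rw [eq_iUnion_inter_box s t A]
  refine MeasurableSet.iUnion fun a => ?_
  rcases hA.inter_box a with h | h
  · rw [h.2]; exact measurableSet_box s t a
  · rw [h.2]; exact MeasurableSet.empty

theorem DeterminedBy.setLIntegral_eq_tsum {s t : ℕ} {A : Set (Path d × Path d)}
    (hA : DeterminedBy s t A) (μ : Measure (Path d × Path d)) (F : Path d × Path d → ℝ≥0∞) :
    ∫⁻ p in A, F p ∂μ = ∑' a, ∫⁻ p in A ∩ box s t a, F p ∂μ := by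
  conv_lhs => rw [eq_iUnion_inter_box s t A]
  refine lintegral_iUnion (fun a => hA.measurableSet.inter (measurableSet_box s t a)) ?_ F
  intro a b hab
  exact (pairwise_disjoint_box s t hab).mono Set.inter_subset_right Set.inter_subset_right

/-- The Markov property of the pair at the times `s` and `t`. -/
theorem setLIntegral_shiftPair (ω ω' : Env d) (x y : Lattice d) {s t : ℕ}
    {A : Set (Path d × Path d)} (hA : DeterminedBy s t A) {F : Path d × Path d → ℝ≥0∞}
    (hF : Measurable F) :
    ∫⁻ p in A, F (shiftPair s t p) ∂(quenchedPair ω ω' x y) =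
      ∫⁻ p in A, (∫⁻ r, F r ∂(quenchedPair ω ω' (p.1 s) (p.2 t))) ∂(quenchedPair ω ω' x y) := by
  rw [hA.setLIntegral_eq_tsum, hA.setLIntegral_eq_tsum]
  refine tsum_congr fun a => ?_
  rcases hA.inter_box a with h | h
  · rw [h.2]
    have e : ∫⁻ p in box s t a, (∫⁻ r, F r ∂(quenchedPair ω ω' (p.1 s) (p.2 t)))
        ∂(quenchedPair ω ω' x y) = ∫⁻ p in box s t a,
          (∫⁻ r, F r ∂(quenchedPair ω ω' (extend a.1 s) (extend a.2 t)))
        ∂(quenchedPair ω ω' x y) := by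
      refine setLIntegral_congr_fun (measurableSet_box s t a) fun p hp => ?_
      rw [hp.1 s le_rfl, hp.2 t le_rfl]
    rw [e, setLIntegral_const, ← lintegral_map hF (measurable_shiftPair s t), box,
      map_shiftPair_restrict, lintegral_smul_measure, smul_eq_mul, mul_comm]
  · simp [h.2]

/-! ### Joint stopping times -/

/-- A joint time that only depends on the two paths up to that time. -/
def IsJointStop (S : Path d → Path d → Option (ℕ × ℕ)) : Prop :=
  ∀ s t, DeterminedBy s t {p | S p.1 p.2 = some (s, t)}

theorem isJointStop_const (s t : ℕ) : IsJointStop (d := d) fun _ _ => some (s, t) := by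
  intro _ _ _ _ _ _ h
  exact h

theorem IsJointStop.measurableSet_some {S : Path d → Path d → Option (ℕ × ℕ)} (hS : IsJointStop S)
    (st : ℕ × ℕ) : MeasurableSet {p : Path d × Path d | S p.1 p.2 = some st} :=
  (hS st.1 st.2).measurableSet

theorem measurable_of_measurableSet_some {S : Path d → Path d → Option (ℕ × ℕ)}
    (hS : ∀ st, MeasurableSet {p : Path d × Path d | S p.1 p.2 = some st}) :
    Measurable[_, ⊤] fun p : Path d × Path d => S p.1 p.2 := by
  have key : ∀ o, MeasurableSet {p : Path d × Path d | S p.1 p.2 = o} := by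
    rintro (_ | st)
    · have : {p : Path d × Path d | S p.1 p.2 = none} =
          (⋃ st, {p : Path d × Path d | S p.1 p.2 = some st})ᶜ := by
        ext p
        simp only [Set.mem_ofPred_eq, Set.mem_compl_iff, Set.mem_iUnion, not_exists]
        rw [Option.eq_none_iff_forall_ne_some]
      rw [this]
      exact (MeasurableSet.iUnion fun st => hS st).compl
    · exact hS st
  intro A _
  have : (fun p : Path d × Path d => S p.1 p.2) ⁻¹' A = ⋃ o ∈ A, {p | S p.1 p.2 = o} := by
    ext p; simp
  rw [this]
  exact MeasurableSet.biUnion A.to_countable fun o _ => key o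

theorem IsJointStop.measurableSet {S : Path d → Path d → Option (ℕ × ℕ)} (hS : IsJointStop S)
    (A : Set (Option (ℕ × ℕ))) : MeasurableSet {p : Path d × Path d | S p.1 p.2 ∈ A} :=
  measurable_of_measurableSet_some hS.measurableSet_some (t := A) trivial

theorem IsJointStop.measurable_comp {S : Path d → Path d → Option (ℕ × ℕ)} (hS : IsJointStop S)
    (f : Option (ℕ × ℕ) → ℝ≥0∞) : Measurable fun p : Path d × Path d => f (S p.1 p.2) :=
  fun B _ => hS.measurableSet (f ⁻¹' B)

/-- The value of `f` at a finite joint time and `0` at infinity. -/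
def onFinite (f : ℕ × ℕ → ℝ≥0∞) (o : Option (ℕ × ℕ)) : ℝ≥0∞ := o.elim 0 f

@[simp] theorem onFinite_none (f : ℕ × ℕ → ℝ≥0∞) : onFinite f none = 0 := rfl
@[simp] theorem onFinite_some (f : ℕ × ℕ → ℝ≥0∞) (st : ℕ × ℕ) : onFinite f (some st) = f st := rfl

theorem lintegral_onFinite {S : Path d → Path d → Option (ℕ × ℕ)} (hS : IsJointStop S)
    (μ : Measure (Path d × Path d)) (f : ℕ × ℕ → Path d × Path d → ℝ≥0∞)
    (hf : ∀ st, Measurable (f st)) :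
    ∫⁻ p, onFinite (fun st => f st p) (S p.1 p.2) ∂μ =
      ∑' st, ∫⁻ p in {p | S p.1 p.2 = some st}, f st p ∂μ := by
  have e : ∀ p : Path d × Path d, onFinite (fun st => f st p) (S p.1 p.2) =
      ∑' st, ({p : Path d × Path d | S p.1 p.2 = some st}.indicator (f st)) p := by
    intro p
    rcases h : S p.1 p.2 with _ | st
    · simp [Set.indicator, h]
    · rw [tsum_eq_single st]
      · simp [Set.indicator, h]
      · intro st' hst'
        simp [Set.indicator, h, hst'.symm]
  simp_rw [e]
  rw [lintegral_tsum fun st => ((hf st).indicator (hS.measurableSet_some st)).aemeasurable]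
  exact tsum_congr fun st => lintegral_indicator (hS.measurableSet_some st) _

theorem measurable_of_endpoints (G : Lattice d → Lattice d → ℝ≥0∞) (s t : ℕ) :
    Measurable fun p : Path d × Path d => G (p.1 s) (p.2 t) := by
  have h : Measurable fun p : Path d × Path d => (p.1 s, p.2 t) :=
    ((measurable_pi_apply s).comp measurable_fst).prodMk
      ((measurable_pi_apply t).comp measurable_snd)
  exact (measurable_of_countable (fun z : Lattice d × Lattice d => G z.1 z.2)).comp h

/-- The strong Markov property of the pair at a joint stopping time. -/
theorem lintegral_stop (ω ω' : Env d) (x y : Lattice d) {S : Path d → Path d → Option (ℕ × ℕ)}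
    (hS : IsJointStop S) (g : ℕ × ℕ → ℝ≥0∞) {F : Path d × Path d → ℝ≥0∞} (hF : Measurable F) :
    ∫⁻ p, onFinite (fun st => g st * F (shiftPair st.1 st.2 p)) (S p.1 p.2)
        ∂(quenchedPair ω ω' x y) =
      ∫⁻ p, onFinite (fun st => g st * ∫⁻ r, F r ∂(quenchedPair ω ω' (p.1 st.1) (p.2 st.2)))
        (S p.1 p.2) ∂(quenchedPair ω ω' x y) := by
  have m1 : ∀ st : ℕ × ℕ, Measurable fun p : Path d × Path d => F (shiftPair st.1 st.2 p) :=
    fun st => hF.comp (measurable_shiftPair st.1 st.2)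
  have m2 : ∀ st : ℕ × ℕ, Measurable fun p : Path d × Path d =>
      ∫⁻ r, F r ∂(quenchedPair ω ω' (p.1 st.1) (p.2 st.2)) :=
    fun st => measurable_of_endpoints (fun a b => ∫⁻ r, F r ∂(quenchedPair ω ω' a b)) st.1 st.2
  rw [lintegral_onFinite hS _ (fun st p => g st * F (shiftPair st.1 st.2 p))
      fun st => (m1 st).const_mul _,
    lintegral_onFinite hS _
      (fun st p => g st * ∫⁻ r, F r ∂(quenchedPair ω ω' (p.1 st.1) (p.2 st.2)))
      fun st => (m2 st).const_mul _]
  refine tsum_congr fun st => ?_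
  rw [lintegral_const_mul _ (m1 st), lintegral_const_mul _ (m2 st),
    setLIntegral_shiftPair ω ω' x y (hS st.1 st.2) hF]

/-! ### First-step decompositions. -/

/-- Summation over the first step of the walk. -/
theorem lintegral_step (ω : Env d) (x : Lattice d) (H : Lattice d → ℝ≥0∞) :
    ∫⁻ w, H (w 1) ∂(quenched ω x) = ∑' z, ω x z * H (x + z) := by
  have hmap : ∀ y, ((quenched ω x).map (fun w : Path d => w 1)) {y} = ω x (y - x) := by
    intro y
    rw [Measure.map_apply (measurable_pi_apply 1) (measurableSet_singleton y)]
    have e : quenched ω x ((fun w : Path d => w 1) ⁻¹' {y}) =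
        quenched ω x (cyl (fun n => if n = 0 then x else y) 1) := by
      refine measure_congr ?_
      filter_upwards [quenched_start ω x] with w hw
      refine propext ?_
      show w 1 = y ↔ ∀ i ≤ 1, _
      constructor
      · intro h i hi
        interval_cases i <;> simp [h, hw]
      · intro h; simpa using h 1 le_rfl
    rw [e, quenched_cyl]
    simp
  rw [← lintegral_map (f := H) (measurable_of_countable _) (measurable_pi_apply 1),
    lintegral_countable', ← (Equiv.addLeft x).tsum_eq]
  refine tsum_congr fun z => ?_
  rw [hmap, mul_comm]
  simp

theorem lintegral_shift_one (ω : Env d) (x : Lattice d) {F : Path d → ℝ≥0∞} (hF : Measurable F) :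
    ∫⁻ w, F (shift 1 w) ∂(quenched ω x) = ∑' z, ω x z * ∫⁻ w, F w ∂(quenched ω (x + z)) := by
  -- The walk is regarded as the first component of a pair, and the joint time `(1, 0)` moves that
  -- component only.
  have h := lintegral_stop ω ω x x (isJointStop_const 1 0) (fun _ => 1)
    (F := fun p => F p.1) (hF.comp measurable_fst)
  simp only [onFinite_some, one_mul, shiftPair, Prod.map] at h
  have fst_int : ∀ (y z : Lattice d) (f : Path d → ℝ≥0∞), Measurable f →
      ∫⁻ p, f p.1 ∂(quenchedPair ω ω y z) = ∫⁻ w, f w ∂(quenched ω y) := by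
    intro y z f hf
    rw [← lintegral_map hf measurable_fst, quenchedPair]
    change ∫⁻ a, f a ∂(Measure.fst _) = _
    rw [Measure.fst_prod]
  rw [fst_int x x (fun w => F (shift 1 w)) (hF.comp (measurable_shift 1))] at h
  rw [h]
  simp_rw [fun p q : Lattice d => fst_int p q F hF]
  rw [fst_int x x (fun w => ∫⁻ v, F v ∂(quenched ω (w 1)))
    ((measurable_of_countable fun z : Lattice d => ∫⁻ v, F v ∂(quenched ω z)).comp
      (measurable_pi_apply 1))]
  exact lintegral_step ω x (fun z => ∫⁻ v, F v ∂(quenched ω z))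

/-- One step of the first walk. -/
theorem lintegral_shiftPair_one_zero (ω ω' : Env d) (x y : Lattice d) {F : Path d × Path d → ℝ≥0∞}
    (hF : Measurable F) : ∫⁻ p, F (shift 1 p.1, p.2) ∂(quenchedPair ω ω' x y) =
      ∑' z, ω x z * ∫⁻ p, F p ∂(quenchedPair ω ω' (x + z) y) := by
  unfold quenchedPair
  rw [lintegral_prod_symm' (fun p : Path d × Path d => F (shift 1 p.1, p.2))
    (hF.comp ((measurable_shift 1).prodMap measurable_id))]
  have : ∀ v, ∫⁻ w, F (shift 1 w, v) ∂(quenched ω x) =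
      ∑' z, ω x z * ∫⁻ w, F (w, v) ∂(quenched ω (x + z)) := fun v =>
    lintegral_shift_one ω x (F := fun w => F (w, v)) (hF.comp (measurable_id.prodMk measurable_const))
  simp only [this]
  rw [lintegral_tsum fun z => (((hF.lintegral_prod_left').const_mul _)).aemeasurable]
  refine tsum_congr fun z => ?_
  rw [lintegral_const_mul _ hF.lintegral_prod_left', lintegral_prod_symm' _ hF]

/-- One step of the second walk. -/
theorem lintegral_shiftPair_zero_one (ω ω' : Env d) (x y : Lattice d) {F : Path d × Path d → ℝ≥0∞}
    (hF : Measurable F) : ∫⁻ p, F (p.1, shift 1 p.2) ∂(quenchedPair ω ω' x y) =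
      ∑' z, ω' y z * ∫⁻ p, F p ∂(quenchedPair ω ω' x (y + z)) := by
  unfold quenchedPair
  rw [lintegral_prod (fun p : Path d × Path d => F (p.1, shift 1 p.2))
    (hF.comp (measurable_id.prodMap (measurable_shift 1))).aemeasurable]
  have : ∀ v, ∫⁻ w, F (v, shift 1 w) ∂(quenched ω' y) =
      ∑' z, ω' y z * ∫⁻ w, F (v, w) ∂(quenched ω' (y + z)) := fun v =>
    lintegral_shift_one ω' y (F := fun w => F (v, w)) (hF.comp (measurable_const.prodMk measurable_id))
  simp only [this]
  rw [lintegral_tsum fun z => (((hF.lintegral_prod_right').const_mul _)).aemeasurable]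
  refine tsum_congr fun z => ?_
  rw [lintegral_const_mul _ hF.lintegral_prod_right', lintegral_prod _ hF.aemeasurable]

/-! ### Pathwise description of the common regeneration times -/

theorem iInf_time_eq_top {P : ℕ → Prop} : (⨅ (n : ℕ) (_ : P n), (n : ℕ∞)) = ⊤ ↔ ∀ n, ¬ P n := by
  simp [iInf_eq_top]

theorem iInf_time_eq_coe {P : ℕ → Prop} {s : ℕ} :
    (⨅ (n : ℕ) (_ : P n), (n : ℕ∞)) = s ↔ P s ∧ ∀ i < s, ¬ P i := by
  constructor
  · intro h
    have hlow : ∀ i < s, ¬ P i := by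
      intro i hi hP
      have : (⨅ (n : ℕ) (_ : P n), (n : ℕ∞)) ≤ i := iInf₂_le i hP
      rw [h] at this
      exact absurd (Nat.cast_le.1 this) (by omega)
    refine ⟨?_, hlow⟩
    by_contra hs
    have : ((s + 1 : ℕ) : ℕ∞) ≤ ⨅ (n : ℕ) (_ : P n), (n : ℕ∞) := by
      refine le_iInf₂ fun n hn => Nat.cast_le.2 ?_
      by_contra hlt
      rcases Nat.lt_or_ge n s with h' | h'
      · exact hlow n h' hn
      · have : n = s := by omega
        exact hs (this ▸ hn)
    rw [h] at this
    exact absurd (Nat.cast_le.1 this) (by omega)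
  · rintro ⟨h1, h2⟩
    refine le_antisymm (iInf₂_le s h1) (le_iInf₂ fun n hn => Nat.cast_le.2 ?_)
    by_contra h
    exact h2 n (by omega) hn

theorem jointTime_eq_some {a b : ℕ∞} {s t : ℕ} : jointTime a b = some (s, t) ↔ a = s ∧ b = t := by
  unfold jointTime
  split_ifs with h
  · rcases h with rfl | rfl <;> simp
  · push Not at h
    obtain ⟨h1, h2⟩ := h
    lift a to ℕ using h1
    lift b to ℕ using h2
    simp

/-- The path is at level `ℓ` at time `s`, and below that level before. -/
def FirstHit (u : Lattice d) (ℓ : ℤ) (s : ℕ) (w : Path d) : Prop :=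
  w s ⬝ᵥ u = ℓ ∧ ∀ i < s, w i ⬝ᵥ u < ℓ

theorem FirstHit.congr {u : Lattice d} {ℓ : ℤ} {s : ℕ} {v w : Path d} (h : FirstHit u ℓ s v)
    (hvw : ∀ i ≤ s, v i = w i) : FirstHit u ℓ s w :=
  ⟨by rw [← hvw s le_rfl]; exact h.1, fun i hi => by rw [← hvw i hi.le]; exact h.2 i hi⟩

theorem FirstHit.lt_of_lt {u : Lattice d} {ℓ ℓ' : ℤ} {s s' : ℕ} {w : Path d}
    (h : FirstHit u ℓ s w) (h' : FirstHit u ℓ' s' w) (hl : ℓ' < ℓ) : s' < s := by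
  by_contra hs
  rcases (not_lt.1 hs).eq_or_lt with rfl | hlt
  · exact absurd (h.1.symm.trans h'.1) hl.ne'
  · have := h'.2 s hlt
    rw [h.1] at this
    omega

theorem FirstHit.time_eq {u : Lattice d} {ℓ : ℤ} {s s' : ℕ} {w : Path d}
    (h : FirstHit u ℓ s w) (h' : FirstHit u ℓ s' w) : s = s' := by
  rcases lt_trichotomy s s' with hlt | rfl | hlt
  · exact absurd (h'.2 s hlt) (by rw [h.1]; exact lt_irrefl _)
  · rfl
  · exact absurd (h.2 s' hlt) (by rw [h'.1]; exact lt_irrefl _)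

theorem hitTime_eq_coe {u : Lattice d} {ℓ : ℤ} {w : Path d} {s : ℕ} :
    hitTime u ℓ w = s ↔ ℓ ≤ w s ⬝ᵥ u ∧ ∀ i < s, w i ⬝ᵥ u < ℓ := by
  unfold hitTime
  rw [iInf_time_eq_coe]
  simp

/-- The first passage across `ℓ` lands exactly on `ℓ` precisely when the path is at `ℓ` for the
first time with everything before strictly below. This removes extended times from all later
arguments. -/
theorem exists_firstHit_iff {u : Lattice d} {ℓ : ℤ} {w : Path d} :
    (hitTime u ℓ w ≠ ⊤ ∧ w (hitTime u ℓ w).toNat ⬝ᵥ u = ℓ) ↔ ∃ s, FirstHit u ℓ s w := by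
  constructor
  · rintro ⟨h1, h2⟩
    refine ⟨(hitTime u ℓ w).toNat, h2, ?_⟩
    exact (hitTime_eq_coe.1 (ENat.natCast_toNat h1).symm).2
  · rintro ⟨s, h1, h2⟩
    have : hitTime u ℓ w = s := hitTime_eq_coe.2 ⟨h1.ge, h2⟩
    rw [this]
    exact ⟨ENat.natCast_ne_top s, h1⟩

theorem mem_freshLevels {u : Lattice d} {ℓ : ℤ} {w w' : Path d} :
    ℓ ∈ freshLevels u w w' ↔
      min (w 0 ⬝ᵥ u) (w' 0 ⬝ᵥ u) < ℓ ∧ ∃ s t, FirstHit u ℓ s w ∧ FirstHit u ℓ t w' := by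
  have h1 := exists_firstHit_iff (u := u) (ℓ := ℓ) (w := w)
  have h2 := exists_firstHit_iff (u := u) (ℓ := ℓ) (w := w')
  unfold freshLevels
  rw [Set.mem_ofPred_eq, ← exists_and_exists_comm, ← h1, ← h2]
  tauto

theorem freshLevels_bddBelow (u : Lattice d) (w w' : Path d) : BddBelow (freshLevels u w w') :=
  ⟨_, fun _ h => (mem_freshLevels.1 h).1.le⟩

theorem freshTime_eq_some {u : Lattice d} {w w' : Path d} {s t : ℕ} :
    freshTime u w w' = some (s, t) ↔
      ∃ ℓ, IsLeast (freshLevels u w w') ℓ ∧ FirstHit u ℓ s w ∧ FirstHit u ℓ t w' := by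
  unfold freshTime
  constructor
  · intro h
    split_ifs at h with hne
    have hmem := Int.csInf_mem hne (freshLevels_bddBelow u w w')
    rw [jointTime_eq_some] at h
    refine ⟨_, ⟨hmem, fun ℓ hℓ => csInf_le (freshLevels_bddBelow u w w') hℓ⟩, ?_⟩
    obtain ⟨-, h2, h3, h4, h5⟩ := hmem
    rw [h.1, ENat.toNat_natCast] at h4
    rw [h.2, ENat.toNat_natCast] at h5
    exact ⟨⟨h4, (hitTime_eq_coe.1 h.1).2⟩, ⟨h5, (hitTime_eq_coe.1 h.2).2⟩⟩
  · rintro ⟨ℓ, hℓ, h1, h2⟩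
    rw [if_pos ⟨ℓ, hℓ.1⟩, hℓ.csInf_eq, jointTime_eq_some]
    exact ⟨hitTime_eq_coe.2 ⟨h1.1.ge, h1.2⟩, hitTime_eq_coe.2 ⟨h2.1.ge, h2.2⟩⟩

/-- Any fresh level bounds the joint time at which the first one is reached. -/
theorem freshTime_le {u : Lattice d} {ℓ : ℤ} {w w' : Path d} {s t : ℕ}
    (h : min (w 0 ⬝ᵥ u) (w' 0 ⬝ᵥ u) < ℓ) (h1 : FirstHit u ℓ s w) (h2 : FirstHit u ℓ t w') :
    ∃ a b, freshTime u w w' = some (a, b) ∧ a ≤ s ∧ b ≤ t := by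
  have hmem : ℓ ∈ freshLevels u w w' := mem_freshLevels.2 ⟨h, s, t, h1, h2⟩
  have hL := Int.csInf_mem ⟨ℓ, hmem⟩ (freshLevels_bddBelow u w w')
  have hle : sInf (freshLevels u w w') ≤ ℓ := csInf_le (freshLevels_bddBelow u w w') hmem
  obtain ⟨-, a, b, ha, hb⟩ := mem_freshLevels.1 hL
  refine ⟨a, b, freshTime_eq_some.2
    ⟨_, ⟨hL, fun ℓ hℓ => csInf_le (freshLevels_bddBelow u w w') hℓ⟩, ha, hb⟩, ?_, ?_⟩
  · rcases hle.eq_or_lt with e | e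
    · rw [e] at ha; exact (ha.time_eq h1).le
    · exact (h1.lt_of_lt ha e).le
  · rcases hle.eq_or_lt with e | e
    · rw [e] at hb; exact (hb.time_eq h2).le
    · exact (h2.lt_of_lt hb e).le

theorem freshTime_level {u : Lattice d} {w w' : Path d} {s t : ℕ}
    (h : freshTime u w w' = some (s, t)) : w s ⬝ᵥ u = w' t ⬝ᵥ u := by
  obtain ⟨ℓ, -, h1, h2⟩ := freshTime_eq_some.1 h
  rw [h1.1, h2.1]

theorem freshTime_start_le {u : Lattice d} {w w' : Path d} {s t : ℕ}
    (h : freshTime u w w' = some (s, t)) : w 0 ⬝ᵥ u ≤ w s ⬝ᵥ u ∧ w' 0 ⬝ᵥ u ≤ w' t ⬝ᵥ u := by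
  have aux : ∀ {ℓ : ℤ} {s : ℕ} {w : Path d}, FirstHit u ℓ s w → w 0 ⬝ᵥ u ≤ w s ⬝ᵥ u := by
    intro ℓ s w h
    rcases Nat.eq_zero_or_pos s with rfl | hs
    · exact le_rfl
    · rw [h.1]; exact (h.2 0 hs).le
  obtain ⟨ℓ, -, h1, h2⟩ := freshTime_eq_some.1 h
  exact ⟨aux h1, aux h2⟩

/-- A smaller fresh level would be hit strictly before the times `s` and `t` by both walks, so the
minimality of the level is visible in the initial segments. -/
theorem isJointStop_freshTime (u : Lattice d) : IsJointStop (freshTime u) := by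
  rintro s t ⟨v, v'⟩ ⟨w, w'⟩ h h' hv
  simp only [Set.mem_ofPred_eq] at hv h h' ⊢
  obtain ⟨ℓ, ⟨hmem, hleast⟩, h1, h2⟩ := freshTime_eq_some.1 hv
  refine freshTime_eq_some.2 ⟨ℓ, ⟨?_, ?_⟩, h1.congr h, h2.congr h'⟩
  · refine mem_freshLevels.2 ⟨?_, s, t, h1.congr h, h2.congr h'⟩
    rw [← h 0 (Nat.zero_le _), ← h' 0 (Nat.zero_le _)]
    exact (mem_freshLevels.1 hmem).1
  · intro ℓ' hℓ'
    by_contra hlt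
    rw [not_le] at hlt
    obtain ⟨g, s', t', g1, g2⟩ := mem_freshLevels.1 hℓ'
    have hs := (h1.congr h).lt_of_lt g1 hlt
    have ht := (h2.congr h').lt_of_lt g2 hlt
    have : ℓ' ∈ freshLevels u v v' := by
      refine mem_freshLevels.2 ⟨?_, s', t', g1.congr fun i hi => (h i (by omega)).symm,
        g2.congr fun i hi => (h' i (by omega)).symm⟩
      rwa [h 0 (Nat.zero_le _), h' 0 (Nat.zero_le _)]
    exact absurd (hleast this) (by omega)

/-! ### Backtracking and exceedance. -/

theorem backtrackTime_eq_top {u : Lattice d} {w : Path d} :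
    backtrackTime u w = ⊤ ↔ ∀ n, w 0 ⬝ᵥ u ≤ w n ⬝ᵥ u := by
  unfold backtrackTime
  rw [iInf_time_eq_top]
  constructor
  · intro h n
    rcases Nat.eq_zero_or_pos n with rfl | hn
    · exact le_rfl
    · by_contra hlt
      exact h n ⟨hn, not_le.1 hlt⟩
  · rintro h n ⟨-, hn⟩
    exact absurd (h n) (not_le.2 hn)

theorem min_backtrackTime_eq_coe {u : Lattice d} {w w' : Path d} {r : ℕ} :
    min (backtrackTime u w) (backtrackTime u w') = r ↔
      (w r ⬝ᵥ u < w 0 ⬝ᵥ u ∨ w' r ⬝ᵥ u < w' 0 ⬝ᵥ u) ∧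
        ∀ i < r, w 0 ⬝ᵥ u ≤ w i ⬝ᵥ u ∧ w' 0 ⬝ᵥ u ≤ w' i ⬝ᵥ u := by
  have e : min (backtrackTime u w) (backtrackTime u w') =
      ⨅ (n : ℕ) (_ : w n ⬝ᵥ u < w 0 ⬝ᵥ u ∨ w' n ⬝ᵥ u < w' 0 ⬝ᵥ u), (n : ℕ∞) := by
    have drop : ∀ v : Path d, backtrackTime u v =
        ⨅ (n : ℕ) (_ : v n ⬝ᵥ u < v 0 ⬝ᵥ u), (n : ℕ∞) := by
      intro v
      refine iInf_congr fun n => iInf_congr_Prop ⟨And.right, fun h => ⟨?_, h⟩⟩ fun _ => rfl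
      rcases Nat.eq_zero_or_pos n with rfl | hn
      · exact absurd h (lt_irrefl _)
      · exact hn
    rw [drop, drop, ← iInf_inf_eq]
    exact iInf_congr fun n => (iInf_or (s := fun _ => (n : ℕ∞))).symm
  rw [e, iInf_time_eq_coe]
  simp only [not_or, not_lt]

theorem le_runMax {u : Lattice d} {w : Path d} {i n : ℕ} (h : i ≤ n) :
    w i ⬝ᵥ u ≤ runMax u n w :=
  Finset.le_sup' (fun i => w i ⬝ᵥ u) (Finset.mem_range.2 (by omega))

theorem runMax_congr {u : Lattice d} {v w : Path d} {n : ℕ} (h : ∀ i ≤ n, v i = w i) :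
    runMax u n v = runMax u n w :=
  Finset.sup'_congr _ rfl fun i hi => by
    have := Finset.mem_range.1 hi
    rw [h i (by omega)]

theorem exceedTime_eq_some {u : Lattice d} {w w' : Path d} {s t : ℕ} :
    exceedTime u w w' = some (s, t) ↔ ∃ r : ℕ,
      min (backtrackTime u w) (backtrackTime u w') = r ∧
      (max (runMax u r w) (runMax u r w') < w s ⬝ᵥ u ∧
        ∀ i < s, w i ⬝ᵥ u ≤ max (runMax u r w) (runMax u r w')) ∧
      (max (runMax u r w) (runMax u r w') < w' t ⬝ᵥ u ∧
        ∀ i < t, w' i ⬝ᵥ u ≤ max (runMax u r w) (runMax u r w')) := by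
  have key : ∀ (ℓ : ℤ) (v : Path d) (n : ℕ), hitTimeAbove u ℓ v = n ↔
      ℓ < v n ⬝ᵥ u ∧ ∀ i < n, v i ⬝ᵥ u ≤ ℓ := by
    intro ℓ v n
    unfold hitTimeAbove
    rw [iInf_time_eq_coe]
    simp
  unfold exceedTime
  constructor
  · intro h
    split_ifs at h with htop
    simp only [jointTime_eq_some, key] at h
    exact ⟨_, (ENat.natCast_toNat htop).symm, h⟩
  · rintro ⟨r, hr, h⟩
    rw [if_neg (by rw [hr]; exact ENat.natCast_ne_top r)]
    simp only [hr, ENat.toNat_natCast, jointTime_eq_some, key]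
    exact h

/-- The walks exceed their maximum over the times up to `r` only after time `r`. Hence `r < s` and
`r < t`, and the initial segments reveal both the backtracking and the level to be exceeded. -/
theorem isJointStop_exceedTime (u : Lattice d) : IsJointStop (exceedTime u) := by
  rintro s t ⟨v, v'⟩ ⟨w, w'⟩ h h' hv
  simp only [Set.mem_ofPred_eq] at hv h h' ⊢
  obtain ⟨r, hr, ⟨h1, h2⟩, ⟨h3, h4⟩⟩ := exceedTime_eq_some.1 hv
  have hs : r < s := by
    by_contra hs
    exact absurd ((le_runMax (u := u) (w := v) (not_lt.1 hs)).trans (le_max_left _ (runMax u r v')))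
      (not_le.2 h1)
  have ht : r < t := by
    by_contra ht
    exact absurd ((le_runMax (u := u) (w := v') (not_lt.1 ht)).trans (le_max_right (runMax u r v) _))
      (not_le.2 h3)
  have e1 : runMax u r v = runMax u r w := runMax_congr fun i hi => h i (by omega)
  have e2 : runMax u r v' = runMax u r w' := runMax_congr fun i hi => h' i (by omega)
  rw [e1, e2] at h1 h2 h3 h4
  refine exceedTime_eq_some.2 ⟨r, ?_, ⟨?_, ?_⟩, ⟨?_, ?_⟩⟩
  · rw [min_backtrackTime_eq_coe] at hr ⊢
    rw [← h r (by omega), ← h' r (by omega), ← h 0 (by omega), ← h' 0 (by omega)]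
    refine ⟨hr.1, fun i hi => ?_⟩
    rw [← h i (by omega), ← h' i (by omega)]
    exact hr.2 i hi
  · rwa [← h s le_rfl]
  · intro i hi; rw [← h i hi.le]; exact h2 i hi
  · rwa [← h' t le_rfl]
  · intro i hi; rw [← h' i hi.le]; exact h4 i hi

theorem exceedTime_eq_none {u : Lattice d} {w w' : Path d} (h : backtrackTime u w = ⊤)
    (h' : backtrackTime u w' = ⊤) : exceedTime u w w' = none := by
  unfold exceedTime
  rw [if_pos (by rw [h, h']; exact min_self _)]

/-! ### Composition of joint times and iterated retries. -/

theorem andThen_eq_some {S T : Path d → Path d → Option (ℕ × ℕ)} {w w' : Path d} {s t : ℕ} :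
    andThen S T w w' = some (s, t) ↔ ∃ s₁ t₁ s₂ t₂, S w w' = some (s₁, t₁) ∧
      T (shift s₁ w) (shift t₁ w') = some (s₂, t₂) ∧ s₁ + s₂ = s ∧ t₁ + t₂ = t := by
  unfold andThen
  simp only [Option.bind_eq_some_iff, Option.map_eq_some_iff, Prod.exists, Prod.mk.injEq]
  constructor
  · rintro ⟨s₁, t₁, h1, s₂, t₂, h2, h3, h4⟩
    exact ⟨s₁, t₁, s₂, t₂, h1, h2, h3, h4⟩
  · rintro ⟨s₁, t₁, s₂, t₂, h1, h2, h3, h4⟩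
    exact ⟨s₁, t₁, h1, s₂, t₂, h2, h3, h4⟩

theorem andThen_of_some {S T : Path d → Path d → Option (ℕ × ℕ)} {w w' : Path d} {st : ℕ × ℕ}
    (h : S w w' = some st) : andThen S T w w' =
      (T (shift st.1 w) (shift st.2 w')).map fun ab => (st.1 + ab.1, st.2 + ab.2) := by
  simp [andThen, h]

theorem andThen_of_none {S T : Path d → Path d → Option (ℕ × ℕ)} {w w' : Path d}
    (h : S w w' = none) : andThen S T w w' = none := by
  simp [andThen, h]

theorem IsJointStop.andThen {S T : Path d → Path d → Option (ℕ × ℕ)} (hS : IsJointStop S)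
    (hT : IsJointStop T) : IsJointStop (andThen S T) := by
  rintro s t ⟨v, v'⟩ ⟨w, w'⟩ h h' hv
  simp only [Set.mem_ofPred_eq] at hv h h' ⊢
  obtain ⟨s₁, t₁, s₂, t₂, h1, h2, h3, h4⟩ := andThen_eq_some.1 hv
  refine andThen_eq_some.2 ⟨s₁, t₁, s₂, t₂, ?_, ?_, h3, h4⟩
  · exact hS s₁ t₁ (v, v') (w, w') (fun i hi => h i (by omega)) (fun i hi => h' i (by omega)) h1
  · exact hT s₂ t₂ (shift s₁ v, shift t₁ v') (shift s₁ w, shift t₁ w')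
      (fun i hi => h _ (by omega)) (fun i hi => h' _ (by omega)) h2

theorem isJointStop_retryTime (u : Lattice d) : IsJointStop (retryTime u) :=
  (isJointStop_exceedTime u).andThen (isJointStop_freshTime u)

theorem isJointStop_retryTimeIter (u : Lattice d) : ∀ k, IsJointStop (retryTimeIter u k)
  | 0 => isJointStop_const 0 0
  | k + 1 => (isJointStop_retryTimeIter u k).andThen (isJointStop_retryTime u)

theorem retryTime_level {u : Lattice d} {w w' : Path d} {s t : ℕ}
    (h : retryTime u w w' = some (s, t)) : w s ⬝ᵥ u = w' t ⬝ᵥ u := by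
  obtain ⟨s₁, t₁, s₂, t₂, -, h2, rfl, rfl⟩ := andThen_eq_some.1 h
  have := freshTime_level h2
  exact this

theorem retryTimeIter_level {u : Lattice d} {w w' : Path d} (h0 : w 0 ⬝ᵥ u = w' 0 ⬝ᵥ u) :
    ∀ {k s t : ℕ}, retryTimeIter u k w w' = some (s, t) → w s ⬝ᵥ u = w' t ⬝ᵥ u
  | 0, s, t, h => by
    obtain ⟨rfl, rfl⟩ : 0 = s ∧ 0 = t := by simpa [retryTimeIter] using h
    exact h0
  | k + 1, s, t, h => by
    obtain ⟨s₁, t₁, s₂, t₂, -, h2, rfl, rfl⟩ := andThen_eq_some.1 h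
    have := retryTime_level h2
    exact this

theorem retryTime_start_le {u : Lattice d} {w w' : Path d} {s t : ℕ}
    (h : retryTime u w w' = some (s, t)) : w 0 ⬝ᵥ u ≤ w s ⬝ᵥ u ∧ w' 0 ⬝ᵥ u ≤ w' t ⬝ᵥ u := by
  obtain ⟨s₁, t₁, s₂, t₂, h1, h2, rfl, rfl⟩ := andThen_eq_some.1 h
  obtain ⟨g1, g2⟩ := freshTime_start_le h2
  obtain ⟨r, -, ⟨g3, -⟩, ⟨g4, -⟩⟩ := exceedTime_eq_some.1 h1
  simp only [shift, add_zero] at g1 g2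
  have a1 := le_runMax (u := u) (w := w) (Nat.zero_le r)
  have a2 := le_runMax (u := u) (w := w') (Nat.zero_le r)
  exact ⟨((a1.trans (le_max_left _ _)).trans g3.le).trans g1,
    ((a2.trans (le_max_right _ _)).trans g4.le).trans g2⟩

theorem retryTimeIter_start_le {u : Lattice d} {w w' : Path d} :
    ∀ {k s t : ℕ}, retryTimeIter u k w w' = some (s, t) →
      w 0 ⬝ᵥ u ≤ w s ⬝ᵥ u ∧ w' 0 ⬝ᵥ u ≤ w' t ⬝ᵥ u
  | 0, s, t, h => by
    obtain ⟨rfl, rfl⟩ : 0 = s ∧ 0 = t := by simpa [retryTimeIter] using h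
    exact ⟨le_rfl, le_rfl⟩
  | k + 1, s, t, h => by
    obtain ⟨s₁, t₁, s₂, t₂, h1, h2, rfl, rfl⟩ := andThen_eq_some.1 h
    have h3 := retryTimeIter_start_le h1
    have h4 := retryTime_start_le h2
    exact ⟨h3.1.trans h4.1, h3.2.trans h4.2⟩

theorem retryTimeIter_succ_eq_none {u : Lattice d} {w w' : Path d} {k : ℕ}
    (h : retryTimeIter u k w w' = none) : retryTimeIter u (k + 1) w w' = none :=
  andThen_of_none h

theorem retryTimeIter_eq_none_of_le {u : Lattice d} {w w' : Path d} {k l : ℕ} (hkl : k ≤ l)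
    (h : retryTimeIter u k w w' = none) : retryTimeIter u l w w' = none := by
  induction hkl with
  | refl => exact h
  | step _ ih => exact retryTimeIter_succ_eq_none ih

theorem lastRetryTime_eq_some {u : Lattice d} {w w' : Path d} {st : ℕ × ℕ} :
    lastRetryTime u w w' = some st ↔
      ∃ k, retryTimeIter u k w w' = some st ∧ retryTimeIter u (k + 1) w w' = none := by
  classical
  unfold lastRetryTime
  constructor
  · intro h
    split_ifs at h with hk
    exact ⟨_, h, by convert Nat.find_spec hk⟩
  · rintro ⟨k, h1, h2⟩
    have hk : ∃ k, retryTimeIter u (k + 1) w w' = none := ⟨k, h2⟩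
    rw [dif_pos hk]
    have : Nat.find hk = k := by
      refine (Nat.find_eq_iff hk).2 ⟨h2, fun n hn hnone => ?_⟩
      rw [retryTimeIter_eq_none_of_le (Nat.succ_le_of_lt hn) hnone] at h1
      exact absurd h1 (by simp)
    convert h1

/-- Since `ν_0` is finite, a first infinite `ν_k` would have a finite predecessor, and that
predecessor would be the last retry time. So the last retry time can be infinite only through
infinitely many retries. -/
theorem exists_retryTimeIter_of_lastRetryTime_none {u : Lattice d} {w w' : Path d}
    (h : lastRetryTime u w w' = none) (k : ℕ) : ∃ st, retryTimeIter u k w w' = some st := by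
  classical
  by_contra hne
  have hk : retryTimeIter u k w w' = none := by
    rcases hr : retryTimeIter u k w w' with _ | st
    · rfl
    · exact absurd ⟨st, hr⟩ hne
  have hex : ∃ j, retryTimeIter u j w w' = none := ⟨k, hk⟩
  obtain ⟨j, hj⟩ : ∃ j, Nat.find hex = j + 1 := by
    refine Nat.exists_eq_succ_of_ne_zero fun h0 => ?_
    have := Nat.find_spec hex
    rw [h0] at this
    simp [retryTimeIter] at this
  have h1 : retryTimeIter u (j + 1) w w' = none := hj ▸ Nat.find_spec hex
  have h2 : retryTimeIter u j w w' ≠ none := Nat.find_min hex (by omega)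
  obtain ⟨st, hst⟩ := Option.ne_none_iff_exists'.1 h2
  have := lastRetryTime_eq_some.2 ⟨j, hst, h1⟩
  rw [h] at this
  exact absurd this (by simp)

theorem shift_shift (a b : ℕ) (w : Path d) : shift b (shift a w) = shift (a + b) w := by
  funext n
  simp [shift, add_assoc]

theorem regenTime_eq_some {u : Lattice d} {w w' : Path d} {s t : ℕ} :
    regenTime u w w' = some (s, t) ↔ ∃ a b s₂ t₂ k, freshTime u w w' = some (a, b) ∧
      retryTimeIter u k (shift a w) (shift b w') = some (s₂, t₂) ∧
      retryTimeIter u (k + 1) (shift a w) (shift b w') = none ∧ a + s₂ = s ∧ b + t₂ = t := by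
  unfold regenTime
  rw [andThen_eq_some]
  constructor
  · rintro ⟨a, b, s₂, t₂, h1, h2, h3, h4⟩
    obtain ⟨k, h5, h6⟩ := lastRetryTime_eq_some.1 h2
    exact ⟨a, b, s₂, t₂, k, h1, h5, h6, h3, h4⟩
  · rintro ⟨a, b, s₂, t₂, k, h1, h5, h6, h3, h4⟩
    exact ⟨a, b, s₂, t₂, h1, lastRetryTime_eq_some.2 ⟨k, h5, h6⟩, h3, h4⟩

/-- The regeneration time is not a joint stopping time, since it requires that no further retry
takes place. Measurability comes from splitting over the fresh time and the number of retries. -/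
theorem measurableSet_regenTime_eq_some (u : Lattice d) (s t : ℕ) :
    MeasurableSet {p : Path d × Path d | regenTime u p.1 p.2 = some (s, t)} := by
  simp only [regenTime_eq_some, Set.ofPred_exists, Set.ofPred_and]
  refine MeasurableSet.iUnion fun a => MeasurableSet.iUnion fun b => MeasurableSet.iUnion fun s₂ =>
    MeasurableSet.iUnion fun t₂ => MeasurableSet.iUnion fun k => ?_
  refine ((isJointStop_freshTime u).measurableSet_some _).inter ?_
  refine MeasurableSet.inter ?_ (MeasurableSet.inter ?_ (MeasurableSet.inter ?_ ?_))
  · exact ((isJointStop_retryTimeIter u k).measurableSet_some (s₂, t₂)).preimage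
      (measurable_shiftPair a b)
  · exact ((isJointStop_retryTimeIter u (k + 1)).measurableSet {none}).preimage
      (measurable_shiftPair a b)
  · exact MeasurableSet.const _
  · exact MeasurableSet.const _

theorem measurableSet_regenDiffEvent (u y : Lattice d) : MeasurableSet (regenDiffEvent u y) := by
  simp only [regenDiffEvent, Set.ofPred_exists, Set.ofPred_and]
  refine MeasurableSet.iUnion fun s => MeasurableSet.iUnion fun t => ?_
  refine (measurableSet_regenTime_eq_some u s t).inter ?_
  have h : Measurable fun p : Path d × Path d => p.2 t - p.1 s := by fun_prop
  exact h (measurableSet_singleton y)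

theorem measurableSet_backtrackTime_eq_top (u : Lattice d) :
    MeasurableSet {w : Path d | backtrackTime u w = ⊤} := by
  simp only [backtrackTime_eq_top, Set.ofPred_forall]
  refine MeasurableSet.iInter fun n => ?_
  have h : Measurable fun w : Path d => (w 0, w n) := by fun_prop
  exact h (Set.to_countable {z : Lattice d × Lattice d | z.1 ⬝ᵥ u ≤ z.2 ⬝ᵥ u}).measurableSet

theorem measurableSet_noBacktrack (u : Lattice d) : MeasurableSet (noBacktrack u) :=
  ((measurableSet_backtrackTime_eq_top u).preimage measurable_fst).inter
    ((measurableSet_backtrackTime_eq_top u).preimage measurable_snd)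

theorem regenTime_level {u : Lattice d} {w w' : Path d} {s t : ℕ}
    (h : regenTime u w w' = some (s, t)) : w s ⬝ᵥ u = w' t ⬝ᵥ u := by
  obtain ⟨a, b, s₂, t₂, k, h1, h2, h3, rfl, rfl⟩ := regenTime_eq_some.1 h
  exact retryTimeIter_level (w := shift a w) (w' := shift b w')
    (by simpa [shift] using freshTime_level h1) h2

theorem regenTime_start_le {u : Lattice d} {w w' : Path d} {s t : ℕ}
    (h : regenTime u w w' = some (s, t)) : w 0 ⬝ᵥ u ≤ w s ⬝ᵥ u ∧ w' 0 ⬝ᵥ u ≤ w' t ⬝ᵥ u := by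
  obtain ⟨a, b, s₂, t₂, k, h1, h2, h3, rfl, rfl⟩ := regenTime_eq_some.1 h
  have g1 := freshTime_start_le h1
  have g2 := retryTimeIter_start_le h2
  simp only [shift, add_zero] at g2
  exact ⟨g1.1.trans g2.1, g1.2.trans g2.2⟩

/-! ### Truncated paths -/

/-- The path that stops moving at time `n`. -/
def freeze (n : ℕ) (w : Path d) : Path d := fun i => w (min i n)

theorem freeze_of_le {n i : ℕ} (w : Path d) (h : i ≤ n) : freeze n w i = w i := by
  simp [freeze, h]

/-- One of the walks backtracks, yet the next common fresh level is never reached. -/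
def stuckRetry (u : Lattice d) : Set (Path d × Path d) := {p | p ∉ noBacktrack u ∧ retryTime u p.1 p.2 = none}

theorem measurableSet_stuckRetry (u : Lattice d) : MeasurableSet (stuckRetry u) :=
  (measurableSet_noBacktrack u).compl.inter ((isJointStop_retryTime u).measurableSet {none})

/-- At the regeneration time the next retry is infinite by construction. Unless the retry is stuck,
the only possible reason is that neither walk backtracks any more. -/
theorem noBacktrack_of_regenTime {u : Lattice d} {p : Path d × Path d} {s t : ℕ}
    (h : regenTime u p.1 p.2 = some (s, t)) (hp : shiftPair s t p ∉ stuckRetry u) :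
    shiftPair s t p ∈ noBacktrack u := by
  obtain ⟨a, b, s₂, t₂, k, h1, h2, h3, rfl, rfl⟩ := regenTime_eq_some.1 h
  by_contra hn
  refine hp ⟨hn, ?_⟩
  have h4 := andThen_of_some (T := retryTime u) h2
  rw [show andThen (retryTimeIter u k) (retryTime u) (shift a p.1) (shift b p.2) = none from h3,
    shift_shift, shift_shift] at h4
  exact Option.map_eq_none_iff.1 h4.symm

/-- The fresh time and the finite retries are stopping times, so freezing later does not change
them. The frozen paths still do not fall below their levels at `s` and `t`, so no new retry is
created. -/
theorem regenTime_freeze {u : Lattice d} {w w' : Path d} {s t n : ℕ} (hs : s ≤ n) (ht : t ≤ n)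
    (h : regenTime u w w' = some (s, t)) (hb : ∀ i ≥ s, w s ⬝ᵥ u ≤ w i ⬝ᵥ u)
    (hb' : ∀ i ≥ t, w' t ⬝ᵥ u ≤ w' i ⬝ᵥ u) :
    regenTime u (freeze n w) (freeze n w') = some (s, t) := by
  obtain ⟨a, b, s₂, t₂, k, h1, h2, h3, rfl, rfl⟩ := regenTime_eq_some.1 h
  have h1' : freshTime u (freeze n w) (freeze n w') = some (a, b) :=
    isJointStop_freshTime u a b (w, w') (freeze n w, freeze n w')
      (fun i hi => (freeze_of_le w (by omega)).symm) (fun i hi => (freeze_of_le w' (by omega)).symm) h1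
  have h2' : retryTimeIter u k (shift a (freeze n w)) (shift b (freeze n w')) = some (s₂, t₂) :=
    isJointStop_retryTimeIter u k s₂ t₂ (shift a w, shift b w')
      (shift a (freeze n w), shift b (freeze n w'))
      (fun i hi => (freeze_of_le w (by omega)).symm) (fun i hi => (freeze_of_le w' (by omega)).symm) h2
  refine regenTime_eq_some.2 ⟨a, b, s₂, t₂, k, h1', h2', ?_, rfl, rfl⟩
  refine (andThen_of_some (T := retryTime u) h2').trans ?_
  rw [shift_shift, shift_shift]
  have aux : ∀ (v : Path d) (s : ℕ), s ≤ n → (∀ i ≥ s, v s ⬝ᵥ u ≤ v i ⬝ᵥ u) →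
      backtrackTime u (shift s (freeze n v)) = ⊤ := by
    intro v s hs hv
    rw [backtrackTime_eq_top]
    intro i
    simp only [shift, freeze, add_zero, min_eq_left hs]
    exact hv _ (by omega)
  have : exceedTime u (shift (a + s₂) (freeze n w)) (shift (b + t₂) (freeze n w')) = none :=
    exceedTime_eq_none (aux w _ hs hb) (aux w' _ ht hb')
  rw [show retryTime u (shift (a + s₂) (freeze n w)) (shift (b + t₂) (freeze n w')) = none from
    andThen_of_none this]
  rfl

/-- Freezing both paths after the regeneration time does not affect the regeneration. -/
theorem freeze_regeneration {u : Lattice d} {p : Path d × Path d} {s t n : ℕ}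
    (h : regenTime u p.1 p.2 = some (s, t)) (hs : s ≤ n) (ht : t ≤ n)
    (hp : shiftPair s t p ∉ stuckRetry u) :
    regenTime u (freeze n p.1) (freeze n p.2) = some (s, t) ∧
      ((freeze n p.1, freeze n p.2) ∈ noBacktrack u ↔ p ∈ noBacktrack u) := by
  obtain ⟨g1, g2⟩ := noBacktrack_of_regenTime h hp
  rw [backtrackTime_eq_top] at g1 g2
  have aux : ∀ {v : Path d} {s : ℕ}, (∀ m, shift s v 0 ⬝ᵥ u ≤ shift s v m ⬝ᵥ u) →
      ∀ i ≥ s, v s ⬝ᵥ u ≤ v i ⬝ᵥ u := by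
    intro v s hv i hi
    have := hv (i - s)
    simp only [shift, add_zero] at this
    rwa [Nat.add_sub_cancel' hi] at this
  have k1 : ∀ i ≥ s, p.1 s ⬝ᵥ u ≤ p.1 i ⬝ᵥ u := aux g1
  have k2 : ∀ i ≥ t, p.2 t ⬝ᵥ u ≤ p.2 i ⬝ᵥ u := aux g2
  refine ⟨regenTime_freeze hs ht h k1 k2, ?_⟩
  obtain ⟨l1, l2⟩ := regenTime_start_le h
  -- After time `n` the path stays above its level at the regeneration, hence above its starting
  -- level; a backtracking can only occur by time `n`.
  have iff : ∀ {v : Path d} {s : ℕ}, s ≤ n → v 0 ⬝ᵥ u ≤ v s ⬝ᵥ u →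
      (∀ i ≥ s, v s ⬝ᵥ u ≤ v i ⬝ᵥ u) →
      (backtrackTime u (freeze n v) = ⊤ ↔ backtrackTime u v = ⊤) := by
    intro v s hs h0 hv
    rw [backtrackTime_eq_top, backtrackTime_eq_top]
    simp only [freeze, Nat.zero_min]
    constructor
    · intro h i
      rcases le_total i n with hi | hi
      · simpa [hi] using h i
      · exact h0.trans (hv i (by omega))
    · exact fun h i => h _
  exact and_congr (iff hs l1 k1) (iff ht l2 k2)

/-! ### Uniform one-step bounds -/

theorem eNorm_nonneg (x : Lattice d) : 0 ≤ eNorm x := norm_nonneg _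

theorem eNorm_add_le (x y : Lattice d) : eNorm (x + y) ≤ eNorm x + eNorm y := by
  unfold eNorm
  refine le_trans (le_of_eq ?_) (norm_add_le _ _)
  congr 1
  ext i
  simp

theorem eNorm_zero : eNorm (0 : Lattice d) = 0 := by
  unfold eNorm
  rw [norm_eq_zero]
  ext i
  simp

theorem eNorm_neg (x : Lattice d) : eNorm (-x) = eNorm x := by
  unfold eNorm
  rw [← norm_neg]
  congr 1
  ext i
  simp

theorem abs_dotProduct_le (x y : Lattice d) : |((x ⬝ᵥ y : ℤ) : ℝ)| ≤ eNorm x * eNorm y := by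
  unfold eNorm
  refine le_trans (le_of_eq ?_) (abs_real_inner_le_norm _ _)
  congr 1
  simp [PiLp.inner_apply, dotProduct, mul_comm]

theorem summable_of_tsum_ofReal_le {ι : Type*} {f : ι → ℝ} {B : ℝ} (hf : ∀ i, 0 ≤ f i) (hB : 0 ≤ B)
    (h : ∑' i, ENNReal.ofReal (f i) ≤ ENNReal.ofReal B) : Summable f ∧ ∑' i, f i ≤ B := by
  have hne : ∑' i, ENNReal.ofReal (f i) ≠ ⊤ := (h.trans_lt ENNReal.ofReal_lt_top).ne
  have hs : Summable f := by
    have := ENNReal.summable_toReal hne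
    simpa [ENNReal.toReal_ofReal (hf _)] using this
  refine ⟨hs, ?_⟩
  rw [← ENNReal.ofReal_tsum_of_nonneg hf hs] at h
  exact (ENNReal.ofReal_le_ofReal_iff hB).1 h

/-! ### From drift and moments to exponential one-step bounds. -/

theorem exp_le_quadratic (x : ℝ) : Real.exp x ≤ 1 + x + x ^ 2 * Real.exp |x| := by
  have h := Complex.norm_exp_sub_sum_le_norm_mul_exp (x : ℂ) 2
  have e : Complex.exp (x : ℂ) - ∑ m ∈ Finset.range 2, (x : ℂ) ^ m / (m.factorial : ℂ) =
      ((Real.exp x - (1 + x) : ℝ) : ℂ) := by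
    simp [Finset.sum_range_succ]
  rw [e, Complex.norm_real, Complex.norm_real, Real.norm_eq_abs, Real.norm_eq_abs, sq_abs] at h
  linarith [le_abs_self (Real.exp x - (1 + x))]

/-- Taylor expansion to second order. Because `b ≤ t / 2`, one factor `exp (t * |D| / 2)` absorbs
the exponential in the remainder and a second one absorbs `D ^ 2`. -/
theorem exp_neg_le_of_moment {t b D : ℝ} (ht : 0 < t) (hb : 0 < b) (hbt : b ≤ t / 2) :
    Real.exp (-b * D) ≤ 1 - b * D + b ^ 2 * (8 / t ^ 2) * Real.exp (t * |D|) := by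
  have h1 := exp_le_quadratic (-b * D)
  have h2 : |-b * D| ≤ t * |D| / 2 := by
    rw [abs_mul, abs_neg, abs_of_pos hb]
    nlinarith [abs_nonneg D]
  have h3 : D ^ 2 ≤ 8 / t ^ 2 * Real.exp (t * |D| / 2) := by
    have h4 := Real.quadratic_le_exp_of_nonneg (x := t * |D| / 2) (by positivity)
    have h5 : (t * |D| / 2) ^ 2 / 2 ≤ Real.exp (t * |D| / 2) := by
      have : 0 ≤ t * |D| / 2 := by positivity
      linarith
    have h6 : D ^ 2 = 8 / t ^ 2 * ((t * |D| / 2) ^ 2 / 2) := by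
      rw [div_pow, mul_pow, sq_abs]; field_simp; norm_num
    rw [h6]
    exact mul_le_mul_of_nonneg_left h5 (by positivity)
  have h7 : (-b * D) ^ 2 * Real.exp |-b * D| ≤ b ^ 2 * (8 / t ^ 2) * Real.exp (t * |D|) := by
    have h8 : Real.exp (t * |D|) = Real.exp (t * |D| / 2) * Real.exp (t * |D| / 2) := by
      rw [← Real.exp_add]; ring_nf
    calc (-b * D) ^ 2 * Real.exp |-b * D| ≤ (-b * D) ^ 2 * Real.exp (t * |D| / 2) := by gcongr
      _ = b ^ 2 * D ^ 2 * Real.exp (t * |D| / 2) := by ring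
      _ ≤ b ^ 2 * (8 / t ^ 2 * Real.exp (t * |D| / 2)) * Real.exp (t * |D| / 2) := by gcongr
      _ = _ := by rw [h8]; ring
  linarith

/-- Constants in the one-step bounds. -/
structure StepConstants where
  b₀ : ℝ
  c : ℝ
  C : ℝ
  κ : ℝ
  s : ℝ
  M : ℝ
  b₀_pos : 0 < b₀
  c_pos : 0 < c
  b₀c_le : b₀ * c ≤ 1 / 2
  one_le_C : 1 ≤ C
  κ_pos : 0 < κ
  κ_le_one : κ ≤ 1
  s_pos : 0 < s
  M_pos : 0 < M

/-- Bounds on the steps of a walk in the environment `ω`, uniform in the site. -/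
structure StepBounds (u : Lattice d) (P : StepConstants) (ω : Env d) : Prop where
  drift : ∀ x b, 0 < b → b ≤ P.b₀ →
    ∑' z, ω x z * ENNReal.ofReal (Real.exp (-b * (z ⬝ᵥ u : ℤ))) ≤ ENNReal.ofReal (1 - b * P.c)
  up : ∀ x, ∑' z, ω x z * ENNReal.ofReal (Real.exp (P.b₀ * (z ⬝ᵥ u : ℤ))) ≤ ENNReal.ofReal P.C
  unit : ∀ x, ENNReal.ofReal P.κ ≤ ∑' z : {z : Lattice d // z ⬝ᵥ u = 1}, ω x z
  range : ∀ x, ∑' z, ω x z * ENNReal.ofReal (Real.exp (P.s * eNorm z)) ≤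
    ENNReal.ofReal (Real.exp (P.s * P.M))

theorem drift_of_moment {u : Lattice d} {δ E t b : ℝ} (ht : 0 < t) (hE : 0 < E)
    (p : PMF (Lattice d)) (hδ : δ ≤ ∑' z : Lattice d, ((z ⬝ᵥ u : ℤ) : ℝ) * (p z).toReal)
    (hmom : ∑' z, p z * ENNReal.ofReal (Real.exp (t * |((z ⬝ᵥ u : ℤ) : ℝ)|)) ≤ ENNReal.ofReal E)
    (hb : 0 < b) (hbt : b ≤ t / 2) :
    ∑' z, p z * ENNReal.ofReal (Real.exp (-b * (z ⬝ᵥ u : ℤ))) ≤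
      ENNReal.ofReal (1 - b * δ + b ^ 2 * (8 / t ^ 2) * E) := by
  have conv : ∀ (z : Lattice d) (r : ℝ), 0 ≤ r →
      p z * ENNReal.ofReal r = ENNReal.ofReal ((p z).toReal * r) := by
    intro z r hr
    rw [ENNReal.ofReal_mul ENNReal.toReal_nonneg, ENNReal.ofReal_toReal (p.apply_ne_top z)]
  have hp1 : Summable fun z => (p z).toReal := ENNReal.summable_toReal p.tsum_coe_ne_top
  have hp2 : ∑' z, (p z).toReal = 1 := by
    rw [← ENNReal.tsum_toReal_eq fun z => p.apply_ne_top z, p.tsum_coe, ENNReal.toReal_one]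
  simp_rw [conv _ _ (Real.exp_pos _).le] at hmom ⊢
  obtain ⟨s1, l1⟩ := summable_of_tsum_ofReal_le
    (fun z => mul_nonneg ENNReal.toReal_nonneg (Real.exp_pos _).le) hE.le hmom
  -- The exponential moment makes the drift series converge, so that its sum may be split off from
  -- the other terms.
  have s2 : Summable fun z : Lattice d => ((z ⬝ᵥ u : ℤ) : ℝ) * (p z).toReal := by
    refine Summable.of_norm_bounded (s1.mul_left (1 / t)) fun z => ?_
    rw [norm_mul, Real.norm_eq_abs, Real.norm_eq_abs, abs_of_nonneg (a := (p z).toReal)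
      ENNReal.toReal_nonneg]
    have : t * |((z ⬝ᵥ u : ℤ) : ℝ)| ≤ Real.exp (t * |((z ⬝ᵥ u : ℤ) : ℝ)|) :=
      (by linarith [Real.add_one_le_exp (t * |((z ⬝ᵥ u : ℤ) : ℝ)|)])
    have h' : |((z ⬝ᵥ u : ℤ) : ℝ)| ≤ 1 / t * Real.exp (t * |((z ⬝ᵥ u : ℤ) : ℝ)|) := by
      rw [one_div, inv_mul_eq_div, le_div_iff₀ ht]; linarith
    nlinarith [ENNReal.toReal_nonneg (a := p z)]
  have pw : ∀ z, (p z).toReal * Real.exp (-b * (z ⬝ᵥ u : ℤ)) ≤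
      (p z).toReal - b * (((z ⬝ᵥ u : ℤ) : ℝ) * (p z).toReal) +
        b ^ 2 * (8 / t ^ 2) * ((p z).toReal * Real.exp (t * |((z ⬝ᵥ u : ℤ) : ℝ)|)) := by
    intro z
    have := mul_le_mul_of_nonneg_left (exp_neg_le_of_moment (D := (z ⬝ᵥ u : ℤ)) ht hb hbt)
      (ENNReal.toReal_nonneg (a := p z))
    linarith
  have s3 := (hp1.sub (s2.mul_left b)).add (s1.mul_left (b ^ 2 * (8 / t ^ 2)))
  have s4 : Summable fun z => (p z).toReal * Real.exp (-b * (z ⬝ᵥ u : ℤ)) :=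
    Summable.of_nonneg_of_le (fun z => mul_nonneg ENNReal.toReal_nonneg (Real.exp_pos _).le) pw s3
  rw [← ENNReal.ofReal_tsum_of_nonneg
    (fun z => mul_nonneg ENNReal.toReal_nonneg (Real.exp_pos _).le) s4]
  refine ENNReal.ofReal_le_ofReal ((s4.tsum_le_tsum pw s3).trans ?_)
  rw [(hp1.sub (s2.mul_left b)).tsum_add (s1.mul_left _), hp1.tsum_sub (s2.mul_left b),
    tsum_mul_left, tsum_mul_left, hp2]
  have : 0 < b ^ 2 * (8 / t ^ 2) := by positivity
  nlinarith

/-- The product law is invariant under translations of the lattice, and there are countably many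
sites. -/
theorem ae_envLaw_forall_site {m : Measure (PMF (Lattice d))} [IsProbabilityMeasure m]
    {p : PMF (Lattice d) → Prop} (h : ∀ᵐ ω ∂(envLaw m), p (ω 0)) :
    ∀ᵐ ω ∂(envLaw m), ∀ x, p (ω x) := by
  rw [ae_all_iff]
  intro x
  have hmap := Measure.infinitePi_map_piCongrLeft (X := fun _ : Lattice d => PMF (Lattice d))
    (fun _ => m) (Equiv.addLeft (-x))
  have hq : Measure.QuasiMeasurePreserving (MeasurableEquiv.piCongrLeft
      (fun _ : Lattice d => PMF (Lattice d)) (Equiv.addLeft (-x))) (envLaw m) (envLaw m) :=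
    ⟨MeasurableEquiv.measurable _, hmap.le.absolutelyContinuous⟩
  filter_upwards [hq.ae h] with ω hω
  have := MeasurableEquiv.piCongrLeft_apply_apply (β := fun _ : Lattice d => PMF (Lattice d))
    (Equiv.addLeft (-x)) ω x
  simp only [Equiv.coe_addLeft, neg_add_cancel] at this
  rwa [this] at hω

theorem exists_stepBounds {m : Measure (PMF (Lattice d))} [IsProbabilityMeasure m] {u : Lattice d}
    (hN : NonNestling m u) (hM : ExpMoment m) (hR : UnitLevelSteps m u) :
    ∃ P : StepConstants, ∀ᵐ ω ∂(envLaw m), StepBounds u P ω := by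
  obtain ⟨δ, hδ, hN⟩ := hN
  obtain ⟨M, s, hM0, hs, hM⟩ := hM
  obtain ⟨κ, hκ, hR⟩ := hR
  have hN' := ae_envLaw_forall_site (p := fun p =>
    δ ≤ ∑' z : Lattice d, ((z ⬝ᵥ u : ℤ) : ℝ) * (p z).toReal) hN
  have hM' := ae_envLaw_forall_site (p := fun p =>
    ∑' z : Lattice d, ENNReal.ofReal (Real.exp (s * eNorm z)) * p z
      ≤ ENNReal.ofReal (Real.exp (s * M))) hM
  have hR' := ae_envLaw_forall_site (p := fun p =>
    ENNReal.ofReal κ ≤ ∑' z : {z : Lattice d // z ⬝ᵥ u = 1}, p (z : Lattice d)) hR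
  set E : ℝ := Real.exp (s * M) with hE
  have hE1 : 1 ≤ E := Real.one_le_exp (by positivity)
  -- By Cauchy–Schwarz, `t * |z ⬝ᵥ u| ≤ s * eNorm z`, so the moment of the norm controls the moment
  -- of the level.
  set t : ℝ := s / (eNorm u + 1) with ht
  have hu := eNorm_nonneg u
  have ht0 : 0 < t := by positivity
  have htD : ∀ z : Lattice d, t * |((z ⬝ᵥ u : ℤ) : ℝ)| ≤ s * eNorm z := by
    intro z
    have h1 := abs_dotProduct_le z u
    have h2 := eNorm_nonneg z
    rw [ht, div_mul_eq_mul_div, div_le_iff₀ (by positivity)]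
    nlinarith [mul_nonneg hs.le h2]
  -- The three bounds serve, in order, the Taylor estimate, the requirement that the quadratic error
  -- use up at most half of the drift, and `b₀ * (δ / 2) ≤ 1 / 2`, which keeps `1 - b * c` positive
  -- for `b ≤ b₀`.
  set b₀ : ℝ := min (t / 2) (min (δ * t ^ 2 / (16 * E)) (1 / δ)) with hb₀
  have hb0 : 0 < b₀ := by positivity
  have hb1 : b₀ ≤ t / 2 := min_le_left _ _
  have hb2 : b₀ ≤ δ * t ^ 2 / (16 * E) := (min_le_right _ _).trans (min_le_left _ _)
  have hb3 : b₀ ≤ 1 / δ := (min_le_right _ _).trans (min_le_right _ _)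
  refine ⟨⟨b₀, δ / 2, E, min κ 1, s, M, hb0, by positivity, ?_, hE1, by positivity,
    min_le_right _ _, hs, hM0⟩, ?_⟩
  · rw [le_div_iff₀ hδ] at hb3
    linarith
  filter_upwards [hN', hM', hR'] with ω h1 h2 h3
  have mom : ∀ x, ∑' z, ω x z * ENNReal.ofReal (Real.exp (t * |((z ⬝ᵥ u : ℤ) : ℝ)|)) ≤
      ENNReal.ofReal E := by
    intro x
    refine le_trans (ENNReal.tsum_le_tsum fun z => ?_) (h2 x)
    rw [mul_comm]
    exact mul_le_mul_left (ENNReal.ofReal_le_ofReal (Real.exp_le_exp.2 (htD z))) _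
  refine ⟨fun x b hb hbb => ?_, fun x => ?_, fun x => ?_, fun x => ?_⟩
  · refine (drift_of_moment ht0 (by positivity) (ω x) (h1 x) (mom x) hb (hbb.trans hb1)).trans
      (ENNReal.ofReal_le_ofReal ?_)
    have h4 : b * (8 / t ^ 2) * E ≤ δ / 2 := by
      have h5 : b ≤ δ * t ^ 2 / (16 * E) := hbb.trans hb2
      rw [le_div_iff₀ (by positivity)] at h5
      rw [mul_div_assoc', div_mul_eq_mul_div, div_le_iff₀ (by positivity)]
      linarith
    show _ ≤ 1 - b * (δ / 2)
    nlinarith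
  · refine le_trans (ENNReal.tsum_le_tsum fun z => ?_) (mom x)
    refine mul_le_mul_right (ENNReal.ofReal_le_ofReal (Real.exp_le_exp.2 ?_)) _
    refine (le_abs_self _).trans ?_
    rw [abs_mul, abs_of_pos hb0]
    exact mul_le_mul_of_nonneg_right (by linarith) (abs_nonneg _)
  · exact (ENNReal.ofReal_le_ofReal (min_le_left _ _)).trans (h3 x)
  · simp_rw [mul_comm (ω x _)]
    exact h2 x

/-! ### Estimates for one walk -/

theorem lintegral_walk_le (ω : Env d) {h : Lattice d → ℝ≥0∞} {r : ℝ≥0∞}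
    (hh : ∀ x, ∑' z, ω x z * h (x + z) ≤ r * h x) (n : ℕ) :
    ∀ x, ∫⁻ w, h (w n) ∂(quenched ω x) ≤ r ^ n * h x := by
  induction n with
  | zero =>
    intro x
    refine le_of_eq ?_
    rw [pow_zero, one_mul, lintegral_congr_ae (g := fun _ => h x)]
    · simp
    · filter_upwards [quenched_start ω x] with w hw
      rw [hw]
  | succ n ih =>
    intro x
    have e : ∀ w : Path d, h (w (n + 1)) = (fun v : Path d => h (v n)) (shift 1 w) := by
      intro w
      simp [shift, add_comm]
    simp_rw [e]
    rw [lintegral_shift_one ω x (F := fun v => h (v n))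
      ((measurable_of_countable h).comp (measurable_pi_apply n))]
    calc ∑' z, ω x z * ∫⁻ w, h (w n) ∂(quenched ω (x + z))
        ≤ ∑' z, r ^ n * (ω x z * h (x + z)) := by
          refine ENNReal.tsum_le_tsum fun z => ?_
          rw [mul_left_comm]
          gcongr
          exact ih _
      _ = r ^ n * ∑' z, ω x z * h (x + z) := ENNReal.tsum_mul_left
      _ ≤ r ^ n * (r * h x) := by gcongr; exact hh x
      _ = r ^ (n + 1) * h x := by rw [pow_succ, mul_assoc]

/-- The maximal inequality for the nonnegative supermartingale `h (w n)`, by induction on the time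
horizon: if `1 ≤ h x` the bound is trivial, and otherwise the hit takes place after the first step.
-/
theorem measure_hit_le (ω : Env d) {h : Lattice d → ℝ≥0∞}
    (hh : ∀ x, ∑' z, ω x z * h (x + z) ≤ h x) (x : Lattice d) :
    quenched ω x {w | ∃ n, 1 ≤ h (w n)} ≤ h x := by
  have meas : ∀ n, MeasurableSet {w : Path d | ∃ i ≤ n, 1 ≤ h (w i)} := by
    intro n
    simp only [Set.ofPred_exists, Set.ofPred_and]
    refine MeasurableSet.iUnion fun i => (MeasurableSet.const _).inter ?_
    exact (Set.to_countable {z : Lattice d | 1 ≤ h z}).measurableSet.preimage (measurable_pi_apply i)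
  have key : ∀ n x, quenched ω x {w | ∃ i ≤ n, 1 ≤ h (w i)} ≤ h x := by
    intro n
    induction n with
    | zero =>
      intro x
      by_cases hx : 1 ≤ h x
      · exact prob_le_one.trans hx
      · refine le_of_eq_of_le (measure_mono_null ?_ (ae_iff.1 (quenched_start ω x))) (zero_le)
        rintro w ⟨i, hi, hw⟩ h0
        obtain rfl : i = 0 := by omega
        rw [h0] at hw
        exact hx hw
    | succ n ih =>
      intro x
      by_cases hx : 1 ≤ h x
      · exact prob_le_one.trans hx
      · have h1 : quenched ω x {w | ∃ i ≤ n + 1, 1 ≤ h (w i)} ≤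
            quenched ω x (shift 1 ⁻¹' {w | ∃ i ≤ n, 1 ≤ h (w i)}) := by
          refine measure_mono_ae ?_
          filter_upwards [quenched_start ω x] with w h0
          rintro ⟨i, hi, hw⟩
          rcases Nat.eq_zero_or_pos i with rfl | hi0
          · rw [h0] at hw; exact absurd hw hx
          · refine ⟨i - 1, by omega, ?_⟩
            simp only [shift]
            rwa [Nat.add_sub_cancel' hi0]
        refine h1.trans ?_
        have h2 := lintegral_shift_one ω x (measurable_one.indicator (meas n))
        have e : ∀ w : Path d, ({w : Path d | ∃ i ≤ n, 1 ≤ h (w i)}.indicator (1 : Path d → ℝ≥0∞))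
            (shift 1 w) = (shift 1 ⁻¹' {w : Path d | ∃ i ≤ n, 1 ≤ h (w i)}).indicator 1 w :=
          fun w => rfl
        simp_rw [e] at h2
        rw [lintegral_indicator_one ((meas n).preimage (measurable_shift 1))] at h2
        rw [h2]
        refine le_trans (ENNReal.tsum_le_tsum fun z => ?_) (hh x)
        rw [lintegral_indicator_one (meas n)]
        gcongr
        exact ih _
  have hU : {w : Path d | ∃ n, 1 ≤ h (w n)} = ⋃ n, {w : Path d | ∃ i ≤ n, 1 ≤ h (w i)} := by
    ext w
    simp only [Set.mem_ofPred_eq, Set.mem_iUnion]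
    exact ⟨fun ⟨n, hn⟩ => ⟨n, n, le_rfl, hn⟩, fun ⟨_, n, _, hn⟩ => ⟨n, hn⟩⟩
  rw [hU, Monotone.measure_iUnion]
  · exact iSup_le fun n => key n x
  · rintro a b hab w ⟨i, hi, hw⟩
    exact ⟨i, hi.trans hab, hw⟩

theorem StepBounds.tsum_exp_neg_le {u : Lattice d} {P : StepConstants} {ω : Env d}
    (hω : StepBounds u P ω) {b : ℝ} (hb : 0 < b) (hb' : b ≤ P.b₀) (a : ℝ) (x : Lattice d) :
    ∑' z, ω x z * ENNReal.ofReal (Real.exp (-b * (((x + z) ⬝ᵥ u : ℤ) - a))) ≤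
      ENNReal.ofReal (1 - b * P.c) * ENNReal.ofReal (Real.exp (-b * ((x ⬝ᵥ u : ℤ) - a))) := by
  have e : ∀ z : Lattice d, ω x z * ENNReal.ofReal (Real.exp (-b * (((x + z) ⬝ᵥ u : ℤ) - a))) =
      (ω x z * ENNReal.ofReal (Real.exp (-b * (z ⬝ᵥ u : ℤ)))) *
        ENNReal.ofReal (Real.exp (-b * ((x ⬝ᵥ u : ℤ) - a))) := by
    intro z
    rw [mul_assoc, ← ENNReal.ofReal_mul (Real.exp_pos _).le, ← Real.exp_add, add_dotProduct]
    push_cast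
    ring_nf
  simp_rw [e]
  rw [ENNReal.tsum_mul_right]
  gcongr
  exact hω.drift x b hb hb'

/-- The walk never backtracks with a probability that is bounded from below. -/
theorem StepBounds.le_measure_noBacktrack {u : Lattice d} {P : StepConstants} {ω : Env d}
    (hω : StepBounds u P ω) (x : Lattice d) :
    ENNReal.ofReal (1 - Real.exp (-P.b₀)) ≤ quenched ω x {w | backtrackTime u w = ⊤} := by
  -- This supermartingale is at least one on the levels up to `x ⬝ᵥ u - 1`, which are the
  -- backtracking levels because levels are integers. Its value at `x` is `exp (-b₀)`.
  have hsup : ∀ y, ∑' z, ω y z *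
      ENNReal.ofReal (Real.exp (-P.b₀ * (((y + z) ⬝ᵥ u : ℤ) - ((x ⬝ᵥ u : ℤ) - 1 : ℝ)))) ≤
      ENNReal.ofReal (Real.exp (-P.b₀ * ((y ⬝ᵥ u : ℤ) - ((x ⬝ᵥ u : ℤ) - 1 : ℝ)))) := by
    intro y
    refine (hω.tsum_exp_neg_le P.b₀_pos le_rfl _ y).trans ?_
    refine mul_le_of_le_one_left zero_le ?_
    rw [ENNReal.ofReal_le_one]
    nlinarith [P.b₀_pos, P.c_pos]
  have h1 := measure_hit_le ω (h := fun y =>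
    ENNReal.ofReal (Real.exp (-P.b₀ * ((y ⬝ᵥ u : ℤ) - ((x ⬝ᵥ u : ℤ) - 1 : ℝ))))) hsup x
  have h2 : quenched ω x {w | backtrackTime u w = ⊤}ᶜ ≤ ENNReal.ofReal (Real.exp (-P.b₀)) := by
    refine (measure_mono_ae ?_).trans (h1.trans (le_of_eq ?_))
    · filter_upwards [quenched_start ω x] with w hw hn
      have hn' : ¬ backtrackTime u w = ⊤ := hn
      rw [backtrackTime_eq_top] at hn'
      push Not at hn'
      obtain ⟨n, hn'⟩ := hn'
      refine ⟨n, ?_⟩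
      rw [hw] at hn'
      rw [ENNReal.one_le_ofReal]
      refine Real.one_le_exp ?_
      have : ((w n ⬝ᵥ u : ℤ) : ℝ) + 1 ≤ (x ⬝ᵥ u : ℤ) := by exact_mod_cast hn'
      nlinarith [P.b₀_pos]
    · ring_nf
  rw [prob_compl_eq_one_sub (measurableSet_backtrackTime_eq_top u)] at h2
  rw [ENNReal.ofReal_sub _ (Real.exp_pos _).le, ENNReal.ofReal_one]
  rw [tsub_le_iff_right] at h2 ⊢
  rwa [add_comm]

theorem StepBounds.le_measure_noBacktrack_pair {u : Lattice d} {P : StepConstants} {ω ω' : Env d}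
    (hω : StepBounds u P ω) (hω' : StepBounds u P ω') (x y : Lattice d) :
    ENNReal.ofReal ((1 - Real.exp (-P.b₀)) ^ 2) ≤ quenchedPair ω ω' x y (noBacktrack u) := by
  have e : noBacktrack u = {w : Path d | backtrackTime u w = ⊤} ×ˢ {w | backtrackTime u w = ⊤} := rfl
  rw [e, quenchedPair, Measure.prod_prod, sq, ENNReal.ofReal_mul]
  · exact mul_le_mul' (hω.le_measure_noBacktrack x) (hω'.le_measure_noBacktrack y)
  · have := P.b₀_pos
    rw [sub_nonneg, Real.exp_le_one_iff]
    linarith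

/-! ### Exponential moments of the first common fresh time -/

/-- The exponential weight of a finite joint time. -/
noncomputable def weight (l : ℝ) (st : ℕ × ℕ) : ℝ≥0∞ :=
  ENNReal.ofReal (Real.exp (l * ((st.1 + st.2 : ℕ) : ℝ)))

/-- The exponential weight of a joint time, infinite at infinity. -/
noncomputable def cost (l : ℝ) (o : Option (ℕ × ℕ)) : ℝ≥0∞ := o.elim ⊤ (weight l)

@[simp] theorem cost_none (l : ℝ) : cost l none = ⊤ := rfl
@[simp] theorem cost_some (l : ℝ) (st : ℕ × ℕ) : cost l (some st) = weight l st := rfl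

theorem weight_mono_left {l l' : ℝ} (h : l ≤ l') (st : ℕ × ℕ) : weight l st ≤ weight l' st := by
  unfold weight
  gcongr

theorem cost_mono_left {l l' : ℝ} (h : l ≤ l') (o : Option (ℕ × ℕ)) : cost l o ≤ cost l' o := by
  rcases o with _ | st
  · exact le_rfl
  · exact weight_mono_left h st

theorem weight_mono {l : ℝ} (hl : 0 ≤ l) {st st' : ℕ × ℕ} (h1 : st.1 ≤ st'.1) (h2 : st.2 ≤ st'.2) :
    weight l st ≤ weight l st' := by
  unfold weight
  gcongr

theorem weight_add (l : ℝ) (st st' : ℕ × ℕ) :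
    weight l (st.1 + st'.1, st.2 + st'.2) = weight l st * weight l st' := by
  unfold weight
  rw [← ENNReal.ofReal_mul (Real.exp_pos _).le, ← Real.exp_add]
  congr 2
  push_cast
  ring

theorem one_le_weight {l : ℝ} (hl : 0 ≤ l) (st : ℕ × ℕ) : 1 ≤ weight l st := by
  unfold weight
  rw [ENNReal.one_le_ofReal]
  exact Real.one_le_exp (by positivity)

theorem onFinite_weight_le_cost (l : ℝ) (o : Option (ℕ × ℕ)) : onFinite (weight l) o ≤ cost l o := by
  rcases o with _ | st
  · simp
  · exact le_rfl

theorem FirstHit.determinedBy (u : Lattice d) (ℓ : ℤ) (s t : ℕ) :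
    DeterminedBy s t {p | FirstHit u ℓ s p.1 ∧ FirstHit u ℓ t p.2} :=
  fun _ _ h h' hp => ⟨hp.1.congr h, hp.2.congr h'⟩

open Classical in
/-- The least weight of the hitting times of a level `ℓ ≥ c` that is fresh for both paths. -/
noncomputable def freshCost (u : Lattice d) (l : ℝ) (c : ℤ) (p : Path d × Path d) : ℝ≥0∞ :=
  ⨅ i : ℤ × ℕ × ℕ, if c ≤ i.1 ∧ FirstHit u i.1 i.2.1 p.1 ∧ FirstHit u i.1 i.2.2 p.2 then
    weight l i.2 else ⊤

theorem measurable_freshCost (u : Lattice d) (l : ℝ) (c : ℤ) : Measurable (freshCost u l c) := by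
  refine Measurable.iInf fun i => Measurable.ite ?_ measurable_const measurable_const
  exact (MeasurableSet.const (c ≤ i.1)).inter (FirstHit.determinedBy u i.1 i.2.1 i.2.2).measurableSet

theorem freshCost_le {u : Lattice d} {l : ℝ} {c ℓ : ℤ} {p : Path d × Path d} {s t : ℕ} (hc : c ≤ ℓ)
    (h1 : FirstHit u ℓ s p.1) (h2 : FirstHit u ℓ t p.2) : freshCost u l c p ≤ weight l (s, t) := by
  refine (iInf_le _ (ℓ, s, t)).trans ?_
  rw [if_pos ⟨hc, h1, h2⟩]

theorem le_freshCost {u : Lattice d} {l : ℝ} {c : ℤ} {p : Path d × Path d} {a : ℝ≥0∞}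
    (h : ∀ ℓ s t, c ≤ ℓ → FirstHit u ℓ s p.1 → FirstHit u ℓ t p.2 → a ≤ weight l (s, t)) :
    a ≤ freshCost u l c p := by
  refine le_iInf fun i => ?_
  split_ifs with hi
  · exact h i.1 i.2.1 i.2.2 hi.1 hi.2.1 hi.2.2
  · exact le_top

theorem cost_freshTime_le {u : Lattice d} {l : ℝ} (hl : 0 ≤ l) (p : Path d × Path d) :
    cost l (freshTime u p.1 p.2) ≤ freshCost u l (min (p.1 0 ⬝ᵥ u) (p.2 0 ⬝ᵥ u) + 1) p := by
  refine le_freshCost fun ℓ s t hc h1 h2 => ?_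
  obtain ⟨a, b, hab, ha, hb⟩ := freshTime_le (by omega) h1 h2
  rw [hab]
  exact weight_mono hl ha hb

theorem FirstHit.of_shift {u : Lattice d} {ℓ : ℤ} {s : ℕ} {w : Path d} (h0 : w 0 ⬝ᵥ u < ℓ)
    (h : FirstHit u ℓ s (shift 1 w)) : FirstHit u ℓ (1 + s) w := by
  refine ⟨h.1, fun i hi => ?_⟩
  rcases Nat.eq_zero_or_pos i with rfl | hi0
  · exact h0
  · have := h.2 (i - 1) (by omega)
    simp only [shift] at this
    rwa [Nat.add_sub_cancel' hi0] at this

/-- The first walk starts below `t`, so a level `ℓ ≥ t` that is fresh after its first step is fresh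
for the whole path. The step costs a factor `exp l`. Raising the lower bound on the levels from `c`
to `t` only increases the cost, and lets the target level move upwards. -/
theorem freshCost_le_shift_left {u : Lattice d} {l : ℝ} {c t : ℤ} {p : Path d × Path d}
    (hct : c ≤ t) (h : p.1 0 ⬝ᵥ u < t) :
    freshCost u l c p ≤ ENNReal.ofReal (Real.exp l) * freshCost u l t (shift 1 p.1, p.2) := by
  rw [mul_comm, ← ENNReal.div_le_iff (by simpa using Real.exp_pos l) ENNReal.ofReal_ne_top]
  refine le_freshCost fun ℓ a b hℓ h1 h2 => ?_
  rw [ENNReal.div_le_iff (by simpa using Real.exp_pos l) ENNReal.ofReal_ne_top]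
  refine (freshCost_le (hct.trans hℓ) (h1.of_shift (h.trans_le hℓ)) h2).trans (le_of_eq ?_)
  have := weight_add l (1, 0) (a, b)
  rw [mul_comm, ← show weight l (1, 0) = ENNReal.ofReal (Real.exp l) by simp [weight], ← this,
    zero_add]

theorem freshCost_le_shift_right {u : Lattice d} {l : ℝ} {c t : ℤ} {p : Path d × Path d}
    (hct : c ≤ t) (h : p.2 0 ⬝ᵥ u < t) :
    freshCost u l c p ≤ ENNReal.ofReal (Real.exp l) * freshCost u l t (p.1, shift 1 p.2) := by
  rw [mul_comm, ← ENNReal.div_le_iff (by simpa using Real.exp_pos l) ENNReal.ofReal_ne_top]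
  refine le_freshCost fun ℓ a b hℓ h1 h2 => ?_
  rw [ENNReal.div_le_iff (by simpa using Real.exp_pos l) ENNReal.ofReal_ne_top]
  refine (freshCost_le (p := p) (hct.trans hℓ) h1
    (FirstHit.of_shift (w := p.2) (h.trans_le hℓ) h2)).trans (le_of_eq ?_)
  have := weight_add l (0, 1) (a, b)
  rw [mul_comm, ← show weight l (0, 1) = ENNReal.ofReal (Real.exp l) by simp [weight], ← this,
    zero_add]

/-- The Lyapunov function for the sum `m` of the distances of the walks to the target level. -/
noncomputable def lyap (b K ε : ℝ) (m : ℕ) : ℝ := Real.exp (b * m) + K * (1 - ε ^ m)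

theorem one_le_lyap {b K ε : ℝ} (hb : 0 ≤ b) (hK : 0 ≤ K) (hε : 0 ≤ ε) (hε1 : ε ≤ 1) (m : ℕ) :
    1 ≤ lyap b K ε m := by
  have h1 : 1 ≤ Real.exp (b * m) := Real.one_le_exp (by positivity)
  have h2 : ε ^ m ≤ 1 := pow_le_one₀ hε hε1
  unfold lyap
  nlinarith

theorem lyap_le {b K ε : ℝ} (hb : 0 ≤ b) (hK : 0 ≤ K) (hε : 0 ≤ ε) (m : ℕ) :
    lyap b K ε m ≤ (1 + K) * Real.exp (b * m) := by
  have h1 : 1 ≤ Real.exp (b * m) := Real.one_le_exp (by positivity)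
  have h2 : 0 ≤ ε ^ m := by positivity
  unfold lyap
  nlinarith

/-- One walk is at distance `k` from the target level, the other at distance `l`, and the first one
moves by `ξ` levels. Overshooting makes its new level the target and adds the overshoot to the
distance of the other walk, so the new total is `l + |k - ξ|` in either case. The four terms
separate the contraction by the drift, the overshoot, a remainder, and the gain when `ξ = 1`. -/
theorem lyap_natAbs_le {b b₀ K ε : ℝ} (hb : 0 ≤ b) (hbb : b ≤ b₀) (hK : 0 ≤ K) (hε : 0 ≤ ε)
    (k l : ℕ) (hk : 1 ≤ k) (ξ : ℤ) :
    lyap b K ε (l + (k - ξ).natAbs) ≤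
      Real.exp (b * (l + k : ℕ)) * Real.exp (-b * ξ) + Real.exp (b * l) * Real.exp (b₀ * ξ) +
      (Real.exp (b * l) + K * (1 - ε ^ (l + k - 1))) +
      K * ε ^ (l + k - 1) * (if ξ = 1 then 0 else 1) := by
  have h1 : Real.exp (b * ((l + (k - ξ).natAbs : ℕ) : ℝ)) ≤
      Real.exp (b * (l + k : ℕ)) * Real.exp (-b * ξ) + Real.exp (b * l) * Real.exp (b₀ * ξ) +
      Real.exp (b * l) := by
    have e1 : Real.exp (b * ((l + (k - ξ).natAbs : ℕ) : ℝ)) =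
        Real.exp (b * l) * Real.exp (b * |(k : ℝ) - ξ|) := by
      rw [← Real.exp_add]
      congr 1
      push_cast [Nat.cast_natAbs]
      ring
    have e2 : Real.exp (b * (l + k : ℕ)) * Real.exp (-b * ξ) =
        Real.exp (b * l) * Real.exp (b * (k - ξ)) := by
      rw [← Real.exp_add, ← Real.exp_add]
      congr 1
      push_cast
      ring
    have e3 : Real.exp (b * |(k : ℝ) - ξ|) ≤
        Real.exp (b * (k - ξ)) + (Real.exp (b₀ * ξ) + 1) := by
      have p1 := Real.exp_pos (b * ((k : ℝ) - ξ))
      have p2 := Real.exp_pos (b₀ * (ξ : ℝ))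
      rcases abs_cases ((k : ℝ) - ξ) with ⟨h, -⟩ | ⟨h, hneg⟩
      · rw [h]; linarith
      · have : Real.exp (b * |(k : ℝ) - ξ|) ≤ Real.exp (b₀ * ξ) := by
          rw [h, Real.exp_le_exp]
          have hk0 : (0 : ℝ) ≤ k := Nat.cast_nonneg k
          nlinarith
        linarith
    rw [e1, e2]
    have := mul_le_mul_of_nonneg_left e3 (Real.exp_pos (b * l)).le
    linarith
  have h2 : K * (1 - ε ^ (l + (k - ξ).natAbs)) ≤
      K * (1 - ε ^ (l + k - 1)) + K * ε ^ (l + k - 1) * (if ξ = 1 then 0 else 1) := by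
    split_ifs with h
    · have : l + ((k : ℤ) - ξ).natAbs = l + k - 1 := by omega
      rw [this]; simp
    · have : 0 ≤ K * ε ^ (l + (k - ξ).natAbs) := by positivity
      linarith
  unfold lyap
  linarith

theorem StepBounds.tsum_ne_one_le {u : Lattice d} {P : StepConstants} {ω : Env d}
    (hω : StepBounds u P ω) (x : Lattice d) :
    ∑' z, ω x z * (if z ⬝ᵥ u = 1 then 0 else 1) ≤ ENNReal.ofReal (1 - P.κ) := by
  have h1 : ∑' z, ω x z * (if z ⬝ᵥ u = 1 then 1 else 0) +
      ∑' z, ω x z * (if z ⬝ᵥ u = 1 then 0 else 1) = 1 := by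
    rw [← ENNReal.tsum_add, ← (ω x).tsum_coe]
    refine tsum_congr fun z => ?_
    split_ifs <;> simp
  have h2 : ENNReal.ofReal P.κ ≤ ∑' z, ω x z * (if z ⬝ᵥ u = 1 then 1 else 0) := by
    refine (hω.unit x).trans (le_of_eq ?_)
    refine (tsum_subtype {z : Lattice d | z ⬝ᵥ u = 1} fun z => ω x z).trans ?_
    refine tsum_congr fun z => ?_
    simp [Set.indicator]
  rw [ENNReal.ofReal_sub _ P.κ_pos.le, ENNReal.ofReal_one]
  refine ENNReal.le_sub_of_add_le_left ENNReal.ofReal_ne_top (le_trans ?_ h1.le)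
  gcongr

/-- A strict contraction in every step that moves the walk lagging farther behind. For large `m = l
+ k` the drift contracts `exp (b * m)`, and the overshoot only contributes a multiple of `exp (b *
l)`, at most `exp (b * m / 2)` because `l ≤ k`. For small `m` this is not enough; there the bounded
term `K * (1 - ε ^ m)` takes over, since a unit step has probability at least `κ` and decreases `m`
by one. -/
theorem exists_lyap (P : StepConstants) {b : ℝ} (hb : 0 < b) (hbb : b ≤ P.b₀) :
    ∃ K ε η : ℝ, 0 ≤ K ∧ 0 ≤ ε ∧ ε ≤ 1 ∧ 0 < η ∧ η ≤ 1 ∧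
      ∀ (u : Lattice d) (ω : Env d), StepBounds u P ω → ∀ x (k l : ℕ), 1 ≤ k → l ≤ k →
        ∑' z : Lattice d, ω x z * ENNReal.ofReal (lyap b K ε (l + (k - z ⬝ᵥ u).natAbs)) ≤
          ENNReal.ofReal ((1 - η) * lyap b K ε (l + k)) := by
  set c := b * P.c with hc
  have hc0 : 0 < c := mul_pos hb P.c_pos
  have hc1 : c ≤ 1 / 2 := (mul_le_mul_of_nonneg_right hbb P.c_pos.le).trans P.b₀c_le
  set A := P.C + 1 with hA
  have hA0 : 0 < A := by have := P.one_le_C; linarith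
  -- The constant left over when Young's inequality absorbs `A * exp (b * m / 2)` into half of the
  -- contraction. For `m ≥ B` it is at most a quarter of the contraction.
  set A' := A ^ 2 / (2 * c) with hA'
  have hA'0 : 0 < A' := by positivity
  obtain ⟨B, hB⟩ : ∃ B : ℕ, A' ≤ c / 4 * Real.exp (b * B) := by
    obtain ⟨B, hB⟩ := exists_nat_ge (4 * A' / c / b)
    refine ⟨B, ?_⟩
    rw [div_le_iff₀ hb, div_le_iff₀ hc0] at hB
    have := Real.add_one_le_exp (b * B)
    nlinarith
  -- With this choice `ε ^ (m - 1) * κ = 2 * ε ^ m`, so one step lowers the mean of the bounded term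
  -- by at least `K * ε ^ m`. The constant `K` below makes this at least `A'` for all `m ≤ B`.
  set ε := P.κ / 2 with hε
  have hε0 : 0 < ε := half_pos P.κ_pos
  have hε1 : ε ≤ 1 := by have := P.κ_le_one; linarith
  set K := A' / ε ^ B with hK
  have hK0 : 0 < K := by positivity
  set η := c / 4 / (1 + K) with hη
  have hη0 : 0 < η := by positivity
  refine ⟨K, ε, η, hK0.le, hε0.le, hε1, hη0, ?_, ?_⟩
  · rw [hη, div_le_one (by positivity)]; linarith
  intro u ω hω x k l hk hl
  have hpow : ε ^ (l + k - 1) ≤ 1 := pow_le_one₀ hε0.le hε1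
  have step1 : ∑' z : Lattice d, ω x z * ENNReal.ofReal (lyap b K ε (l + (k - z ⬝ᵥ u).natAbs)) ≤
      ENNReal.ofReal (Real.exp (b * (l + k : ℕ)) * (1 - c) + Real.exp (b * l) * P.C +
      (Real.exp (b * l) + K * (1 - ε ^ (l + k - 1))) + K * ε ^ (l + k - 1) * (1 - P.κ)) := by
    have pw : ∀ z : Lattice d, ω x z * ENNReal.ofReal (lyap b K ε (l + (k - z ⬝ᵥ u).natAbs)) ≤
        ENNReal.ofReal (Real.exp (b * (l + k : ℕ))) *
            (ω x z * ENNReal.ofReal (Real.exp (-b * (z ⬝ᵥ u : ℤ)))) +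
          ENNReal.ofReal (Real.exp (b * l)) *
            (ω x z * ENNReal.ofReal (Real.exp (P.b₀ * (z ⬝ᵥ u : ℤ)))) +
          ENNReal.ofReal (Real.exp (b * l) + K * (1 - ε ^ (l + k - 1))) * ω x z +
          ENNReal.ofReal (K * ε ^ (l + k - 1)) * (ω x z * (if z ⬝ᵥ u = 1 then 0 else 1)) := by
      intro z
      have h := ENNReal.ofReal_le_ofReal
        (lyap_natAbs_le hb.le hbb hK0.le hε0.le k l hk (z ⬝ᵥ u))
      refine (mul_le_mul_right h (ω x z)).trans (le_of_eq ?_)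
      have n1 : 0 ≤ K * (1 - ε ^ (l + k - 1)) := mul_nonneg hK0.le (by linarith)
      rw [ENNReal.ofReal_add (by positivity) (by split_ifs <;> positivity),
        ENNReal.ofReal_add (by positivity) (by positivity),
        ENNReal.ofReal_add (by positivity) (by positivity),
        ENNReal.ofReal_mul (by positivity), ENNReal.ofReal_mul (by positivity),
        ENNReal.ofReal_mul (p := K * ε ^ (l + k - 1)) (by positivity)]
      split_ifs <;> simp <;> ring
    refine (ENNReal.tsum_le_tsum pw).trans ?_
    rw [ENNReal.tsum_add, ENNReal.tsum_add, ENNReal.tsum_add, ENNReal.tsum_mul_left,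
      ENNReal.tsum_mul_left, ENNReal.tsum_mul_left, ENNReal.tsum_mul_left, (ω x).tsum_coe, mul_one]
    have n1 : 0 ≤ K * (1 - ε ^ (l + k - 1)) := mul_nonneg hK0.le (by linarith)
    have n2 : 0 ≤ 1 - P.κ := by linarith [P.κ_le_one]
    have n3 : 0 ≤ 1 - c := by linarith
    have n4 : 0 ≤ P.C := by linarith [P.one_le_C]
    have n5 : 0 ≤ Real.exp (b * l) + K * (1 - ε ^ (l + k - 1)) := by positivity
    have n6 : 0 ≤ K * ε ^ (l + k - 1) := by positivity
    generalize Real.exp (b * l) + K * (1 - ε ^ (l + k - 1)) = R at n5 ⊢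
    generalize K * ε ^ (l + k - 1) = R' at n6 ⊢
    rw [ENNReal.ofReal_add (by positivity) (by positivity),
      ENNReal.ofReal_add (by positivity) (by positivity),
      ENNReal.ofReal_add (by positivity) (by positivity),
      ENNReal.ofReal_mul (p := Real.exp (b * (l + k : ℕ))) (by positivity),
      ENNReal.ofReal_mul (p := Real.exp (b * l)) (by positivity),
      ENNReal.ofReal_mul (p := R') (by positivity)]
    gcongr
    · exact hω.drift x b hb hbb
    · exact hω.up x
    · exact hω.tsum_ne_one_le x
  refine step1.trans (ENNReal.ofReal_le_ofReal ?_)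
  set m := l + k with hm
  set y := Real.exp (b * m / 2) with hy
  have hy1 : 1 ≤ y := Real.one_le_exp (by positivity)
  have hy2 : Real.exp (b * m) = y ^ 2 := by rw [hy, sq, ← Real.exp_add]; ring_nf
  have hyl : Real.exp (b * l) ≤ y := by
    rw [hy]
    gcongr
    have : (m : ℝ) = l + k := by rw [hm]; push_cast; ring
    have : (l : ℝ) ≤ k := by exact_mod_cast hl
    nlinarith
  have hεm : ε ^ (m - 1) * P.κ = 2 * ε ^ m := by
    have h1 : ε ^ m = ε ^ (m - 1) * ε := by rw [← pow_succ]; congr 1; omega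
    rw [h1, hε]; ring
  have young : A * y ≤ c / 2 * y ^ 2 + A' := by
    rw [hA']
    have : c / 2 * y ^ 2 + A ^ 2 / (2 * c) - A * y = (c * y - A) ^ 2 / (2 * c) := by
      field_simp; ring
    have h2 : 0 ≤ (c * y - A) ^ 2 / (2 * c) := by positivity
    linarith
  -- For `m ≥ B` the exponential dominates `A'`; for `m ≤ B` the gain of the bounded term does.
  have defect : c / 4 * y ^ 2 ≤ c / 2 * y ^ 2 - A' + K * ε ^ m := by
    rcases le_total B m with h | h
    · have h1 : Real.exp (b * B) ≤ y ^ 2 := by rw [← hy2]; gcongr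
      have h2 : 0 ≤ K * ε ^ m := by positivity
      have h3 : c / 4 * Real.exp (b * B) ≤ c / 4 * y ^ 2 := by gcongr
      linarith
    · have h1 : ε ^ B ≤ ε ^ m := pow_le_pow_of_le_one hε0.le hε1 h
      have h2 : A' ≤ K * ε ^ m := by
        calc A' = K * ε ^ B := by rw [hK]; field_simp
          _ ≤ K * ε ^ m := by gcongr
      have h3 : 0 ≤ c / 4 * y ^ 2 := by positivity
      linarith
  have hηy : η * (y ^ 2 + K) ≤ c / 4 * y ^ 2 := by
    rw [hη, div_mul_eq_mul_div, div_le_iff₀ (by positivity)]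
    have : 1 ≤ y ^ 2 := one_le_pow₀ hy1
    nlinarith [mul_pos hc0 hK0]
  have hεm0 : 0 ≤ η * (K * ε ^ m) := by positivity
  have hAl : Real.exp (b * l) * A ≤ A * y := by nlinarith
  unfold lyap
  rw [hy2]
  have e1 : K * ε ^ (m - 1) * (1 - P.κ) = K * ε ^ (m - 1) - K * (2 * ε ^ m) := by
    rw [← hεm]; ring
  rw [e1]
  have e2 : Real.exp (b * l) * A = Real.exp (b * l) * P.C + Real.exp (b * l) := by rw [hA]; ring
  nlinarith

/-- The sum of the distances of the levels of `x` and `y` to the target level. -/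
def gap (u : Lattice d) (c : ℤ) (x y : Lattice d) : ℕ :=
  (max c (max (x ⬝ᵥ u) (y ⬝ᵥ u)) - x ⬝ᵥ u).toNat + (max c (max (x ⬝ᵥ u) (y ⬝ᵥ u)) - y ⬝ᵥ u).toNat

theorem iSup_min_natCast (a : ℝ≥0∞) : ⨆ N : ℕ, min (N : ℝ≥0∞) a = a := by
  have := iSup_inf_eq (fun N : ℕ => (N : ℝ≥0∞)) a
  rw [ENNReal.iSup_natCast, top_inf_eq] at this
  exact this.symm

/-- Value iteration: always move the walk that lags farther behind the target. This is permitted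
because the walks are independent given the environments and each keeps its own clock. The cost `exp
l` of a step is paid for by the contraction of the Lyapunov function. Truncating the cost at `N`
gives the iteration a finite start; its error `N * r ^ n` vanishes as `n → ∞`, and then `N → ∞` by
monotone convergence. -/
theorem lintegral_freshCost_le {u : Lattice d} {P : StepConstants} {b K ε η l : ℝ} (hb : 0 ≤ b)
    (hK : 0 ≤ K) (hε : 0 ≤ ε) (hε1 : ε ≤ 1) (hη : 0 < η) (hη1 : η ≤ 1) (hl : 0 ≤ l)
    (hlη : Real.exp l * (1 - η) ≤ 1 - η / 2)
    (hlyap : ∀ ω : Env d, StepBounds u P ω → ∀ x (k l : ℕ), 1 ≤ k → l ≤ k →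
        ∑' z : Lattice d, ω x z * ENNReal.ofReal (lyap b K ε (l + (k - z ⬝ᵥ u).natAbs)) ≤
          ENNReal.ofReal ((1 - η) * lyap b K ε (l + k)))
    {ω ω' : Env d} (hω : StepBounds u P ω) (hω' : StepBounds u P ω') (c : ℤ) (x y : Lattice d) :
    ∫⁻ p, freshCost u l c p ∂(quenchedPair ω ω' x y) ≤
      ENNReal.ofReal (lyap b K ε (gap u c x y)) := by
  set U : ℕ → ℝ≥0∞ := fun m => ENNReal.ofReal (lyap b K ε m) with hU
  set r : ℝ≥0∞ := ENNReal.ofReal (1 - η / 2) with hr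
  have hr1 : r < 1 := by
    rw [hr, ← ENNReal.ofReal_one]
    exact (ENNReal.ofReal_lt_ofReal_iff one_pos).2 (by linarith)
  have hU1 : ∀ m, 1 ≤ U m := fun m => ENNReal.one_le_ofReal.2 (one_le_lyap hb hK hε hε1 m)
  have meas : ∀ (N : ℕ) (c : ℤ), Measurable fun p => min (N : ℝ≥0∞) (freshCost u l c p) :=
    fun N c => measurable_const.min (measurable_freshCost u l c)
  have hexp : ∀ {ω : Env d}, StepBounds u P ω → ∀ x (k j : ℕ), 1 ≤ k → j ≤ k →
      ENNReal.ofReal (Real.exp l) * ∑' z : Lattice d, ω x z * U (j + (k - z ⬝ᵥ u).natAbs) ≤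
        r * U (j + k) := by
    intro ω hω x k j hk hj
    refine (mul_le_mul_right (hlyap ω hω x k j hk hj) _).trans ?_
    rw [hU, hr, ← ENNReal.ofReal_mul (Real.exp_pos _).le, ← ENNReal.ofReal_mul (by linarith),
      ← mul_assoc]
    have := one_le_lyap hb hK hε hε1 (j + k)
    gcongr
  have minmul : ∀ (N : ℕ) (a : ℝ≥0∞), min (N : ℝ≥0∞) (ENNReal.ofReal (Real.exp l) * a) ≤
      ENNReal.ofReal (Real.exp l) * min (N : ℝ≥0∞) a := by
    intro N a
    have h1 : 1 ≤ ENNReal.ofReal (Real.exp l) := ENNReal.one_le_ofReal.2 (Real.one_le_exp hl)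
    rw [mul_min]
    exact min_le_min_right _ (le_mul_of_one_le_left zero_le h1)
  have key : ∀ (N n : ℕ) (c : ℤ) (x y : Lattice d),
      ∫⁻ p, min (N : ℝ≥0∞) (freshCost u l c p) ∂(quenchedPair ω ω' x y) ≤
        (1 + N * r ^ n) * U (gap u c x y) := by
    intro N n
    induction n with
    | zero =>
      intro c x y
      refine (lintegral_mono fun p => min_le_left _ _).trans ?_
      rw [lintegral_const, measure_univ, mul_one, pow_zero, mul_one]
      calc (N : ℝ≥0∞) ≤ 1 + N := le_add_self
        _ = (1 + N) * 1 := (mul_one _).symm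
        _ ≤ _ := by gcongr; exact hU1 _
    | succ n ih =>
      intro c x y
      have close : ∀ a : ℝ≥0∞, (1 + N * r ^ n) * (r * a) ≤ (1 + N * r ^ (n + 1)) * a := by
        intro a
        rw [← mul_assoc, add_mul, one_mul, mul_assoc (N : ℝ≥0∞), ← pow_succ]
        gcongr
      set t := max c (max (x ⬝ᵥ u) (y ⬝ᵥ u)) with ht
      set k := (t - x ⬝ᵥ u).toNat with hk
      set j := (t - y ⬝ᵥ u).toNat with hj
      have hgap : gap u c x y = k + j := rfl
      have hct : c ≤ t := le_max_left _ _
      -- Both walks start at the target level, which is therefore reached at the joint time `(0, 0)`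
      -- at cost one.
      by_cases h0 : k + j = 0
      · have h1 : ∫⁻ p, min (N : ℝ≥0∞) (freshCost u l c p) ∂(quenchedPair ω ω' x y) ≤
            ∫⁻ _, 1 ∂(quenchedPair ω ω' x y) := by
          refine lintegral_mono_ae ?_
          filter_upwards [quenchedPair_start ω ω' x y] with p hp
          refine (min_le_right _ _).trans ?_
          have a1 : p.1 0 ⬝ᵥ u = t := by rw [hp.1]; omega
          have a2 : p.2 0 ⬝ᵥ u = t := by rw [hp.2]; omega
          refine (freshCost_le (s := 0) (t := 0) hct ⟨a1, fun i hi => absurd hi (Nat.not_lt_zero i)⟩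
            ⟨a2, fun i hi => absurd hi (Nat.not_lt_zero i)⟩).trans ?_
          simp [weight]
        refine h1.trans ?_
        rw [lintegral_const, measure_univ, mul_one]
        calc (1 : ℝ≥0∞) = 1 * 1 := (mul_one _).symm
          _ ≤ _ := by gcongr; exacts [le_self_add, hU1 _]
      rcases le_total j k with hjk | hkj
      · have h1 : ∫⁻ p, min (N : ℝ≥0∞) (freshCost u l c p) ∂(quenchedPair ω ω' x y) ≤
            ∫⁻ p, ENNReal.ofReal (Real.exp l) *
              min (N : ℝ≥0∞) (freshCost u l t (shift 1 p.1, p.2)) ∂(quenchedPair ω ω' x y) := by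
          refine lintegral_mono_ae ?_
          filter_upwards [quenchedPair_start ω ω' x y] with p hp
          refine (min_le_min_left _ (freshCost_le_shift_left hct ?_)).trans (minmul N _)
          rw [hp.1]; omega
        refine h1.trans ?_
        rw [lintegral_const_mul (f := fun p : Path d × Path d =>
            min (N : ℝ≥0∞) (freshCost u l t (shift 1 p.1, p.2))) _
            ((meas N t).comp ((measurable_shift 1).prodMap measurable_id)),
          lintegral_shiftPair_one_zero ω ω' x y (meas N t)]
        calc ENNReal.ofReal (Real.exp l) * ∑' z, ω x z *
              ∫⁻ p, min (N : ℝ≥0∞) (freshCost u l t p) ∂(quenchedPair ω ω' (x + z) y)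
            ≤ ENNReal.ofReal (Real.exp l) * ∑' z, ω x z *
              ((1 + N * r ^ n) * U (j + (k - z ⬝ᵥ u).natAbs)) := by
              gcongr with z
              refine (ih t (x + z) y).trans (le_of_eq ?_)
              congr 2
              have := add_dotProduct x z u
              unfold gap
              omega
          _ = (1 + N * r ^ n) * (ENNReal.ofReal (Real.exp l) *
                ∑' z, ω x z * U (j + (k - z ⬝ᵥ u).natAbs)) := by
              simp_rw [mul_left_comm (ω x _)]
              rw [ENNReal.tsum_mul_left]
              ring
          _ ≤ (1 + N * r ^ n) * (r * U (j + k)) := by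
              exact mul_le_mul_right (hexp hω x k j (by omega) hjk) _
          _ ≤ (1 + N * r ^ (n + 1)) * U (gap u c x y) := by
              rw [hgap, add_comm k j]
              exact close _
      · have h1 : ∫⁻ p, min (N : ℝ≥0∞) (freshCost u l c p) ∂(quenchedPair ω ω' x y) ≤
            ∫⁻ p, ENNReal.ofReal (Real.exp l) *
              min (N : ℝ≥0∞) (freshCost u l t (p.1, shift 1 p.2)) ∂(quenchedPair ω ω' x y) := by
          refine lintegral_mono_ae ?_
          filter_upwards [quenchedPair_start ω ω' x y] with p hp
          refine (min_le_min_left _ (freshCost_le_shift_right hct ?_)).trans (minmul N _)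
          rw [hp.2]; omega
        refine h1.trans ?_
        rw [lintegral_const_mul (f := fun p : Path d × Path d =>
            min (N : ℝ≥0∞) (freshCost u l t (p.1, shift 1 p.2))) _
            ((meas N t).comp (measurable_id.prodMap (measurable_shift 1))),
          lintegral_shiftPair_zero_one ω ω' x y (meas N t)]
        calc ENNReal.ofReal (Real.exp l) * ∑' z, ω' y z *
              ∫⁻ p, min (N : ℝ≥0∞) (freshCost u l t p) ∂(quenchedPair ω ω' x (y + z))
            ≤ ENNReal.ofReal (Real.exp l) * ∑' z, ω' y z *
              ((1 + N * r ^ n) * U (k + (j - z ⬝ᵥ u).natAbs)) := by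
              gcongr with z
              refine (ih t x (y + z)).trans (le_of_eq ?_)
              congr 2
              have := add_dotProduct y z u
              unfold gap
              omega
          _ = (1 + N * r ^ n) * (ENNReal.ofReal (Real.exp l) *
                ∑' z, ω' y z * U (k + (j - z ⬝ᵥ u).natAbs)) := by
              simp_rw [mul_left_comm (ω' y _)]
              rw [ENNReal.tsum_mul_left]
              ring
          _ ≤ (1 + N * r ^ n) * (r * U (k + j)) := by
              exact mul_le_mul_right (hexp hω' y j k (by omega) hkj) _
          _ ≤ (1 + N * r ^ (n + 1)) * U (gap u c x y) := close _
  have lim : ∀ N : ℕ, ∫⁻ p, min (N : ℝ≥0∞) (freshCost u l c p) ∂(quenchedPair ω ω' x y) ≤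
      U (gap u c x y) := by
    intro N
    have h1 : Filter.Tendsto (fun n : ℕ => (1 + N * r ^ n) * U (gap u c x y)) Filter.atTop
        (nhds ((1 + N * 0) * U (gap u c x y))) := by
      refine ENNReal.Tendsto.mul_const (Filter.Tendsto.const_add _
        (ENNReal.Tendsto.const_mul (ENNReal.tendsto_pow_atTop_nhds_zero_of_lt_one hr1)
          (Or.inr (ENNReal.natCast_ne_top N)))) (Or.inr ENNReal.ofReal_ne_top)
    rw [mul_zero, add_zero, one_mul] at h1
    exact ge_of_tendsto' h1 fun n => key N n c x y
  have e : ∀ p, freshCost u l c p = ⨆ N : ℕ, min (N : ℝ≥0∞) (freshCost u l c p) :=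
    fun p => (iSup_min_natCast _).symm
  rw [lintegral_congr e]
  rw [lintegral_iSup (fun N => meas N c)]
  · exact iSup_le lim
  · intro N N' h p
    exact min_le_min_right _ (Nat.cast_le.2 h)

/-- Exponential moments of the first common fresh time. -/
theorem exists_lintegral_freshTime_le (P : StepConstants) {b : ℝ} (hb : 0 < b) (hbb : b ≤ P.b₀) :
    ∃ l A : ℝ, 0 < l ∧ 0 ≤ A ∧ ∀ (u : Lattice d) (ω ω' : Env d), StepBounds u P ω →
      StepBounds u P ω' → ∀ x y, ∫⁻ p, cost l (freshTime u p.1 p.2) ∂(quenchedPair ω ω' x y) ≤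
        ENNReal.ofReal (A * Real.exp (b * |((x ⬝ᵥ u : ℤ) : ℝ) - (y ⬝ᵥ u : ℤ)|)) := by
  obtain ⟨K, ε, η, hK, hε, hε1, hη, hη1, H⟩ := exists_lyap (d := d) P hb hbb
  -- The rate `η / 2` satisfies `exp (η / 2) * (1 - η) ≤ 1 - η / 2`. The factor `exp (2 * b)` covers
  -- walks that start at equal levels: the fresh level must lie strictly higher, and both then have
  -- distance one to the target.
  refine ⟨η / 2, (1 + K) * Real.exp (2 * b), by positivity, by positivity, ?_⟩
  intro u ω ω' hω hω' x y
  have hη2 : (0 : ℝ) ≤ η / 2 := by positivity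
  have hl : Real.exp (η / 2) * (1 - η) ≤ 1 - η / 2 := by
    have h1 : 1 - η / 2 ≤ Real.exp (-(η / 2)) := by
      have := Real.add_one_le_exp (-(η / 2)); linarith
    have h2 : Real.exp (η / 2) * (1 - η / 2) ≤ 1 := by
      calc _ ≤ Real.exp (η / 2) * Real.exp (-(η / 2)) := by gcongr
        _ = 1 := by rw [← Real.exp_add, add_neg_cancel, Real.exp_zero]
    nlinarith [Real.exp_pos (η / 2)]
  have h1 : ∫⁻ p, cost (η / 2) (freshTime u p.1 p.2) ∂(quenchedPair ω ω' x y) ≤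
      ∫⁻ p, freshCost u (η / 2) (min (x ⬝ᵥ u) (y ⬝ᵥ u) + 1) p ∂(quenchedPair ω ω' x y) := by
    refine lintegral_mono_ae ?_
    filter_upwards [quenchedPair_start ω ω' x y] with p hp
    refine (cost_freshTime_le hη2 p).trans (le_of_eq ?_)
    rw [hp.1, hp.2]
  refine h1.trans ((lintegral_freshCost_le hb.le hK hε hε1 hη hη1 hη2 hl
    (fun ω hω => H u ω hω) hω hω' _ x y).trans (ENNReal.ofReal_le_ofReal ?_))
  refine (lyap_le hb.le hK hε _).trans ?_
  rw [mul_assoc, ← Real.exp_add]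
  gcongr
  have h2 : (gap u (min (x ⬝ᵥ u) (y ⬝ᵥ u) + 1) x y : ℤ) ≤ 2 + |x ⬝ᵥ u - y ⬝ᵥ u| := by
    unfold gap
    rcases abs_cases (x ⬝ᵥ u - y ⬝ᵥ u) with ⟨h, _⟩ | ⟨h, _⟩ <;> rw [h] <;> omega
  have h3 : (gap u (min (x ⬝ᵥ u) (y ⬝ᵥ u) + 1) x y : ℝ) ≤
      2 + |((x ⬝ᵥ u : ℤ) : ℝ) - (y ⬝ᵥ u : ℤ)| := by exact_mod_cast h2
  nlinarith

/-! ### Linear growth of one walk -/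

/-- From time `N` on the walk advances at speed more than `v`, and it never exceeds the level
`B * max i N` by time `i`. -/
def LinearGrowth (u : Lattice d) (v B : ℝ) (N : ℕ) (w : Path d) : Prop :=
  (∀ n ≥ N, v * n < ((w n ⬝ᵥ u : ℤ) : ℝ) - (w 0 ⬝ᵥ u : ℤ)) ∧
    ∀ i : ℕ, ((w i ⬝ᵥ u : ℤ) : ℝ) - (w 0 ⬝ᵥ u : ℤ) ≤ B * (max i N : ℕ)

theorem measurableSet_linearGrowth (u : Lattice d) (v B : ℝ) (N : ℕ) :
    MeasurableSet {w : Path d | LinearGrowth u v B N w} := by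
  have h : ∀ n, Measurable fun w : Path d => (w 0, w n) := fun n => by fun_prop
  have aux : ∀ (n : ℕ) (q : Lattice d × Lattice d → Prop),
      MeasurableSet {w : Path d | q (w 0, w n)} :=
    fun n q => h n (Set.to_countable {z | q z}).measurableSet
  simp only [LinearGrowth, Set.ofPred_and, Set.ofPred_forall]
  refine (MeasurableSet.iInter fun n => MeasurableSet.iInter fun _ => ?_).inter
    (MeasurableSet.iInter fun n => ?_)
  · exact aux n fun z => v * n < ((z.2 ⬝ᵥ u : ℤ) : ℝ) - (z.1 ⬝ᵥ u : ℤ)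
  · exact aux n fun z => ((z.2 ⬝ᵥ u : ℤ) : ℝ) - (z.1 ⬝ᵥ u : ℤ) ≤ B * (max n N : ℕ)

theorem measure_walk_ge_le (ω : Env d) {h : Lattice d → ℝ≥0∞} {r : ℝ≥0∞}
    (hh : ∀ x, ∑' z, ω x z * h (x + z) ≤ r * h x) (n : ℕ) (x : Lattice d) :
    quenched ω x {w | 1 ≤ h (w n)} ≤ r ^ n * h x := by
  have h1 := mul_meas_ge_le_lintegral (μ := quenched ω x) (f := fun w : Path d => h (w n))
    ((measurable_of_countable h).comp (measurable_pi_apply n)) 1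
  rw [one_mul] at h1
  exact h1.trans (lintegral_walk_le ω hh n x)

theorem StepBounds.tsum_exp_le {u : Lattice d} {P : StepConstants} {ω : Env d}
    (hω : StepBounds u P ω) (a : ℝ) (x : Lattice d) :
    ∑' z, ω x z * ENNReal.ofReal (Real.exp (P.b₀ * (((x + z) ⬝ᵥ u : ℤ) - a))) ≤
      ENNReal.ofReal P.C * ENNReal.ofReal (Real.exp (P.b₀ * ((x ⬝ᵥ u : ℤ) - a))) := by
  have e : ∀ z : Lattice d, ω x z * ENNReal.ofReal (Real.exp (P.b₀ * (((x + z) ⬝ᵥ u : ℤ) - a))) =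
      (ω x z * ENNReal.ofReal (Real.exp (P.b₀ * (z ⬝ᵥ u : ℤ)))) *
        ENNReal.ofReal (Real.exp (P.b₀ * ((x ⬝ᵥ u : ℤ) - a))) := by
    intro z
    rw [mul_assoc, ← ENNReal.ofReal_mul (Real.exp_pos _).le, ← Real.exp_add, add_dotProduct]
    push_cast
    ring_nf
  simp_rw [e]
  rw [ENNReal.tsum_mul_right]
  gcongr
  exact hω.up x

theorem summable_exp_neg_mul {a : ℝ} (ha : 0 < a) : Summable fun n : ℕ => Real.exp (-a * n) := by
  have := Real.summable_exp_nat_mul_iff.2 (neg_lt_zero.2 ha)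
  simpa [mul_comm] using this

/-- Exponential Chebyshev bounds at each time, from the drift for slow walks and from the moment for
fast ones, followed by a union bound over all times. -/
theorem exists_measure_not_linearGrowth_le (P : StepConstants) :
    ∃ v B a A : ℝ, 0 < v ∧ 0 < B ∧ 0 < a ∧ 1 ≤ A ∧ ∀ (u : Lattice d) (ω : Env d),
      StepBounds u P ω → ∀ x N, quenched ω x {w | ¬ LinearGrowth u v B N w} ≤
        ENNReal.ofReal (A * Real.exp (-a * N)) := by
  have hb := P.b₀_pos
  have hc := P.c_pos
  have hC := Real.log_nonneg P.one_le_C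
  -- Slowness at time `n` has probability at most `exp (-b₀ * c * n / 2)`. For `n ≥ N` this splits
  -- into a factor decaying in `N` and one that is summable in `n`.
  set a := min (P.b₀ * P.c / 4) 1 with ha
  have ha0 : 0 < a := by positivity
  have ha1 : a ≤ P.b₀ * P.c / 4 := min_le_left _ _
  have ha2 : a ≤ 1 := min_le_right _ _
  -- The logarithm compensates the growth `C ^ n` of the moment, and the `2` leaves `exp (-2 * max n
  -- N)`, which again splits between `n` and `N`.
  set B := (Real.log P.C + 2) / P.b₀ with hB
  have hB0 : 0 < B := by positivity
  have hS := summable_exp_neg_mul ha0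
  set S := ∑' n : ℕ, Real.exp (-a * n) with hSdef
  have hS1 : 1 ≤ S := by
    have h : Real.exp (-a * (0 : ℕ)) ≤ S := hS.le_tsum 0 fun n _ => (Real.exp_pos _).le
    rwa [Nat.cast_zero, mul_zero, Real.exp_zero] at h
  refine ⟨P.c / 2, B, a, 2 * S, by positivity, hB0, ha0, by linarith, ?_⟩
  intro u ω hω x N
  have low : ∀ n, N ≤ n → quenched ω x {w | ((w n ⬝ᵥ u : ℤ) : ℝ) - (x ⬝ᵥ u : ℤ) ≤ P.c / 2 * n} ≤
      ENNReal.ofReal (Real.exp (-a * N) * Real.exp (-a * n)) := by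
    intro n hn
    have h := measure_walk_ge_le ω
      (hω.tsum_exp_neg_le hb le_rfl ((x ⬝ᵥ u : ℤ) + P.c / 2 * n)) n x
    refine (measure_mono fun w hw => ?_).trans (h.trans ?_)
    · rw [Set.mem_ofPred_eq] at hw ⊢
      rw [ENNReal.one_le_ofReal]
      refine Real.one_le_exp ?_
      nlinarith
    · rw [← ENNReal.ofReal_pow (by have := P.b₀c_le; linarith),
        ← ENNReal.ofReal_mul (by have := P.b₀c_le; apply pow_nonneg; linarith)]
      refine ENNReal.ofReal_le_ofReal ?_
      have h1 : (1 - P.b₀ * P.c) ^ n ≤ Real.exp (-(P.b₀ * P.c)) ^ n := by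
        refine pow_le_pow_left₀ (by have := P.b₀c_le; linarith) ?_ n
        have := Real.add_one_le_exp (-(P.b₀ * P.c)); linarith
      refine (mul_le_mul_of_nonneg_right h1 (Real.exp_pos _).le).trans ?_
      rw [← Real.exp_nat_mul, ← Real.exp_add, ← Real.exp_add]
      refine Real.exp_le_exp.2 ?_
      have hn' : (N : ℝ) ≤ n := by exact_mod_cast hn
      have hN' : (0 : ℝ) ≤ N := Nat.cast_nonneg N
      nlinarith
  have up : ∀ n : ℕ, quenched ω x
      {w | B * (max n N : ℕ) < ((w n ⬝ᵥ u : ℤ) : ℝ) - (x ⬝ᵥ u : ℤ)} ≤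
      ENNReal.ofReal (Real.exp (-a * N) * Real.exp (-a * n)) := by
    intro n
    have h := measure_walk_ge_le ω (hω.tsum_exp_le ((x ⬝ᵥ u : ℤ) + B * (max n N : ℕ))) n x
    refine (measure_mono fun w hw => ?_).trans (h.trans ?_)
    · rw [Set.mem_ofPred_eq] at hw ⊢
      rw [ENNReal.one_le_ofReal]
      refine Real.one_le_exp ?_
      exact mul_nonneg hb.le (by linarith)
    · have hC0 : 0 < P.C := by linarith [P.one_le_C]
      rw [← ENNReal.ofReal_pow hC0.le, ← ENNReal.ofReal_mul (pow_nonneg hC0.le n)]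
      refine ENNReal.ofReal_le_ofReal ?_
      have e1 : P.C ^ n = Real.exp (n * Real.log P.C) := by
        rw [Real.exp_nat_mul, Real.exp_log hC0]
      rw [e1, ← Real.exp_add, ← Real.exp_add]
      refine Real.exp_le_exp.2 ?_
      have e2 : P.b₀ * (B * (max n N : ℕ)) = (Real.log P.C + 2) * (max n N : ℕ) := by
        rw [hB]; field_simp
      have h1 : (n : ℝ) ≤ (max n N : ℕ) := by exact_mod_cast le_max_left n N
      have h2 : (N : ℝ) ≤ (max n N : ℕ) := by exact_mod_cast le_max_right n N
      have h3 : a * N ≤ (max n N : ℕ) :=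
        (mul_le_of_le_one_left (Nat.cast_nonneg N) ha2).trans h2
      have h4 : a * n ≤ (max n N : ℕ) :=
        (mul_le_of_le_one_left (Nat.cast_nonneg n) ha2).trans h1
      have h5 := mul_le_mul_of_nonneg_left h1 hC
      linarith
  have cover : quenched ω x {w | ¬ LinearGrowth u (P.c / 2) B N w} ≤
      quenched ω x (⋃ n : ℕ, ({w | N ≤ n ∧ ((w n ⬝ᵥ u : ℤ) : ℝ) - (x ⬝ᵥ u : ℤ) ≤ P.c / 2 * n} ∪
        {w | B * (max n N : ℕ) < ((w n ⬝ᵥ u : ℤ) : ℝ) - (x ⬝ᵥ u : ℤ)})) := by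
    refine measure_mono_ae ?_
    filter_upwards [quenched_start ω x] with w h0 hw
    by_contra hn
    refine hw ⟨fun n hn' => ?_, fun i => ?_⟩
    · by_contra h
      rw [h0, not_lt] at h
      exact hn (Set.mem_iUnion.2 ⟨n, Or.inl ⟨hn', h⟩⟩)
    · by_contra h
      rw [h0, not_le] at h
      exact hn (Set.mem_iUnion.2 ⟨i, Or.inr h⟩)
  have each : ∀ n : ℕ, quenched ω x
      ({w | N ≤ n ∧ ((w n ⬝ᵥ u : ℤ) : ℝ) - (x ⬝ᵥ u : ℤ) ≤ P.c / 2 * n} ∪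
        {w | B * (max n N : ℕ) < ((w n ⬝ᵥ u : ℤ) : ℝ) - (x ⬝ᵥ u : ℤ)}) ≤
      ENNReal.ofReal (2 * Real.exp (-a * N) * Real.exp (-a * n)) := by
    intro n
    refine (measure_union_le _ _).trans ?_
    have e : 2 * Real.exp (-a * N) * Real.exp (-a * n) =
      Real.exp (-a * N) * Real.exp (-a * n) + Real.exp (-a * N) * Real.exp (-a * n) := by ring
    rw [e, ENNReal.ofReal_add (by positivity) (by positivity)]
    refine add_le_add ?_ (up n)
    by_cases hn : N ≤ n
    · exact (measure_mono fun w hw => hw.2).trans (low n hn)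
    · have : {w : Path d | N ≤ n ∧ ((w n ⬝ᵥ u : ℤ) : ℝ) - (x ⬝ᵥ u : ℤ) ≤ P.c / 2 * n} = ∅ :=
        Set.eq_empty_of_forall_notMem fun w hw => hn hw.1
      rw [this, measure_empty]
      exact zero_le
  refine cover.trans ((measure_iUnion_le _).trans ((ENNReal.tsum_le_tsum each).trans ?_))
  rw [← ENNReal.ofReal_tsum_of_nonneg (fun n => by positivity) (hS.mul_left _), tsum_mul_left]
  refine ENNReal.ofReal_le_ofReal (le_of_eq ?_)
  ring

theorem measure_pair_not_linearGrowth_le {u : Lattice d} {ω ω' : Env d} {v B a A : ℝ} {N : ℕ}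
    {x y : Lattice d} (hA : 0 ≤ A)
    (h : quenched ω x {w | ¬ LinearGrowth u v B N w} ≤ ENNReal.ofReal (A * Real.exp (-a * N)))
    (h' : quenched ω' y {w | ¬ LinearGrowth u v B N w} ≤ ENNReal.ofReal (A * Real.exp (-a * N))) :
    quenchedPair ω ω' x y {p | ¬ (LinearGrowth u v B N p.1 ∧ LinearGrowth u v B N p.2)} ≤
      ENNReal.ofReal (2 * A * Real.exp (-a * N)) := by
  have e : {p : Path d × Path d | ¬ (LinearGrowth u v B N p.1 ∧ LinearGrowth u v B N p.2)} ⊆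
      ({w | ¬ LinearGrowth u v B N w} ×ˢ Set.univ) ∪ (Set.univ ×ˢ {w | ¬ LinearGrowth u v B N w}) := by
    intro p hp
    rw [Set.mem_ofPred_eq, not_and_or] at hp
    rcases hp with hp | hp
    · exact Or.inl ⟨hp, trivial⟩
    · exact Or.inr ⟨trivial, hp⟩
  refine (measure_mono e).trans ((measure_union_le _ _).trans ?_)
  rw [quenchedPair, Measure.prod_prod, Measure.prod_prod, measure_univ, measure_univ, mul_one,
    one_mul, show 2 * A * Real.exp (-a * N) = A * Real.exp (-a * N) + A * Real.exp (-a * N) by ring,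
    ENNReal.ofReal_add (by positivity) (by positivity)]
  exact add_le_add h h'

/-! ### The first exceedance after a backtracking -/

theorem exists_runMax_eq (u : Lattice d) (n : ℕ) (w : Path d) :
    ∃ i ≤ n, runMax u n w = w i ⬝ᵥ u := by
  obtain ⟨i, hi, h⟩ := Finset.exists_mem_eq_sup' (Finset.nonempty_range_add_one (n := n))
    fun i => w i ⬝ᵥ u
  exact ⟨i, by have := Finset.mem_range.1 hi; omega, h⟩

/-- Deterministic. From time `N` on both walks are above their start, so the backtracking occurs
before `N`, and the level to be exceeded is at most `B * N` above the start. At speed `v` it is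
exceeded by time `Q * N`, since `B ≤ v * Q`. -/
theorem exceedTime_bound {u : Lattice d} {v B : ℝ} {N Q : ℕ} {p : Path d × Path d} {s t : ℕ}
    (hv : 0 < v) (hB : 0 < B) (hN : 1 ≤ N) (hQ : 1 ≤ Q) (hQB : B ≤ v * Q)
    (h1 : LinearGrowth u v B N p.1) (h2 : LinearGrowth u v B N p.2)
    (h0 : p.1 0 ⬝ᵥ u = p.2 0 ⬝ᵥ u) (h : exceedTime u p.1 p.2 = some (s, t)) :
    s + t + |((p.1 s ⬝ᵥ u : ℤ) : ℝ) - (p.2 t ⬝ᵥ u : ℤ)| ≤ (2 + B) * Q * N := by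
  obtain ⟨r, hr, ⟨hs1, hs2⟩, ⟨ht1, ht2⟩⟩ := exceedTime_eq_some.1 h
  have hrN : r < N := by
    by_contra hrN
    rw [not_lt] at hrN
    have hvr : 0 ≤ v * r := by positivity
    rcases (min_backtrackTime_eq_coe.1 hr).1 with hb | hb
    · have := h1.1 r hrN
      have hb' : ((p.1 r ⬝ᵥ u : ℤ) : ℝ) < (p.1 0 ⬝ᵥ u : ℤ) := by exact_mod_cast hb
      linarith
    · have := h2.1 r hrN
      have hb' : ((p.2 r ⬝ᵥ u : ℤ) : ℝ) < (p.2 0 ⬝ᵥ u : ℤ) := by exact_mod_cast hb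
      linarith
  have hm : ∀ {w : Path d}, LinearGrowth u v B N w → w 0 ⬝ᵥ u = p.1 0 ⬝ᵥ u →
      ((runMax u r w : ℤ) : ℝ) ≤ (p.1 0 ⬝ᵥ u : ℤ) + B * N := by
    intro w hw hw0
    obtain ⟨i, hi, e⟩ := exists_runMax_eq u r w
    have := hw.2 i
    rw [max_eq_right (by omega : i ≤ N), hw0] at this
    rw [e]
    linarith
  have hmax : ((max (runMax u r p.1) (runMax u r p.2) : ℤ) : ℝ) ≤ (p.1 0 ⬝ᵥ u : ℤ) + B * N := by
    push_cast
    exact max_le (hm h1 rfl) (hm h2 h0.symm)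
  have hlow : (p.1 0 ⬝ᵥ u) ≤ max (runMax u r p.1) (runMax u r p.2) :=
    (le_runMax (Nat.zero_le r)).trans (le_max_left _ _)
  have hQN : N ≤ Q * N := Nat.le_mul_of_pos_left N hQ
  have htime : ∀ {w : Path d} {s : ℕ}, LinearGrowth u v B N w → w 0 ⬝ᵥ u = p.1 0 ⬝ᵥ u →
      (∀ i < s, w i ⬝ᵥ u ≤ max (runMax u r p.1) (runMax u r p.2)) → s ≤ Q * N := by
    intro w s hw hw0 hs
    by_contra hlt
    have h3 := hs (Q * N) (by omega)
    have h4 := hw.1 (Q * N) hQN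
    have h5 : ((w (Q * N) ⬝ᵥ u : ℤ) : ℝ) ≤ (max (runMax u r p.1) (runMax u r p.2) : ℤ) := by
      exact_mod_cast h3
    rw [hw0] at h4
    have h6 : B * N ≤ v * (Q * N : ℕ) := by
      push_cast
      rw [← mul_assoc]
      gcongr
    linarith
  have hlevel : ∀ {w : Path d} {s : ℕ}, LinearGrowth u v B N w → w 0 ⬝ᵥ u = p.1 0 ⬝ᵥ u →
      s ≤ Q * N → ((w s ⬝ᵥ u : ℤ) : ℝ) ≤ (p.1 0 ⬝ᵥ u : ℤ) + B * (Q * N : ℕ) := by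
    intro w s hw hw0 hs
    have h3 := hw.2 s
    rw [hw0] at h3
    have h4 : B * (max s N : ℕ) ≤ B * (Q * N : ℕ) := by
      gcongr
      exact max_le hs hQN
    linarith
  have s1 := htime h1 rfl hs2
  have t1 := htime h2 h0.symm ht2
  have s2 := hlevel h1 rfl s1
  have t2 := hlevel h2 h0.symm t1
  have s3 : ((p.1 0 ⬝ᵥ u : ℤ) : ℝ) ≤ (p.1 s ⬝ᵥ u : ℤ) := by exact_mod_cast hlow.trans hs1.le
  have t3 : ((p.1 0 ⬝ᵥ u : ℤ) : ℝ) ≤ (p.2 t ⬝ᵥ u : ℤ) := by exact_mod_cast hlow.trans ht1.le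
  have h5 : |((p.1 s ⬝ᵥ u : ℤ) : ℝ) - (p.2 t ⬝ᵥ u : ℤ)| ≤ B * (Q * N : ℕ) := by
    rw [abs_le]; constructor <;> linarith
  have s1' : (s : ℝ) ≤ (Q * N : ℕ) := by exact_mod_cast s1
  have t1' : (t : ℝ) ≤ (Q * N : ℕ) := by exact_mod_cast t1
  push_cast at *
  nlinarith

/-- Exponential moments of the exceedance time and of the difference of the levels there. -/
theorem exists_lintegral_exceedTime_le (P : StepConstants) :
    ∃ a A : ℝ, 0 < a ∧ 0 ≤ A ∧ ∀ (u : Lattice d) (ω ω' : Env d), StepBounds u P ω →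
      StepBounds u P ω' → ∀ x y, x ⬝ᵥ u = y ⬝ᵥ u →
      ∫⁻ p, onFinite (fun st => ENNReal.ofReal (Real.exp (a * (st.1 + st.2 +
        |((p.1 st.1 ⬝ᵥ u : ℤ) : ℝ) - (p.2 st.2 ⬝ᵥ u : ℤ)|)))) (exceedTime u p.1 p.2)
          ∂(quenchedPair ω ω' x y) ≤ ENNReal.ofReal A := by
  obtain ⟨v, B, a, A, hv, hB, ha, hA, H⟩ := exists_measure_not_linearGrowth_le (d := d) P
  obtain ⟨Q, hQ⟩ := exists_nat_ge (max 1 (B / v))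
  have hQ1 : 1 ≤ Q := by exact_mod_cast (le_max_left _ _).trans hQ
  have hQB : B ≤ v * Q := by
    have := (le_max_right _ _).trans hQ
    rw [div_le_iff₀ hv] at this
    linarith
  set R : ℝ := (2 + B) * Q with hR
  have hR0 : 0 < R := by positivity
  have hS := summable_exp_neg_mul (half_pos ha)
  set S := ∑' n : ℕ, Real.exp (-(a / 2) * n) with hSdef
  have hS0 : 0 ≤ S := tsum_nonneg fun n => (Real.exp_pos _).le
  refine ⟨a / 2 / R, 2 * A * Real.exp (a / 2) * S, by positivity, by positivity, ?_⟩
  intro u ω ω' hω hω' x y hxy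
  -- The scale `0` is declared bad for all paths, since the deterministic bound needs `1 ≤ N`.
  set bad : ℕ → Set (Path d × Path d) := fun N =>
    {p | N = 0 ∨ ¬ (LinearGrowth u v B N p.1 ∧ LinearGrowth u v B N p.2)} with hbad
  have mbad : ∀ N, MeasurableSet (bad N) := by
    intro N
    refine (MeasurableSet.const (N = 0)).union (MeasurableSet.compl ?_)
    exact ((measurableSet_linearGrowth u v B N).preimage measurable_fst).inter
      ((measurableSet_linearGrowth u v B N).preimage measurable_snd)
  have pw : ∀ᵐ p ∂(quenchedPair ω ω' x y),
      onFinite (fun st => ENNReal.ofReal (Real.exp (a / 2 / R * (st.1 + st.2 +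
        |((p.1 st.1 ⬝ᵥ u : ℤ) : ℝ) - (p.2 st.2 ⬝ᵥ u : ℤ)|)))) (exceedTime u p.1 p.2) ≤
      ∑' N : ℕ, (bad N).indicator (fun _ => ENNReal.ofReal (Real.exp (a / 2 * (N + 1)))) p := by
    filter_upwards [quenchedPair_start ω ω' x y] with p hp
    have h0 : p.1 0 ⬝ᵥ u = p.2 0 ⬝ᵥ u := by rw [hp.1, hp.2, hxy]
    rcases h : exceedTime u p.1 p.2 with _ | ⟨s, t⟩
    · simp
    · set Z : ℝ := s + t + |((p.1 s ⬝ᵥ u : ℤ) : ℝ) - (p.2 t ⬝ᵥ u : ℤ)| with hZ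
      have hZ0 : 0 ≤ Z := by positivity
      rw [onFinite_some]
      change ENNReal.ofReal (Real.exp (a / 2 / R * Z)) ≤ _
      -- If `N` is positive, then `Z > R * N`, so linear growth fails at scale `N`; always `Z ≤ R *
      -- (N + 1)`, so the summand of index `N` pays for the exponential of `Z`. Truncated
      -- subtraction yields `N = 0` when `Z = 0`.
      set N := ⌈Z / R⌉₊ - 1 with hN
      have hup : Z ≤ R * (N + 1) := by
        have h1 : Z / R ≤ ⌈Z / R⌉₊ := Nat.le_ceil _
        have h2 : (⌈Z / R⌉₊ : ℝ) ≤ N + 1 := by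
          have : ⌈Z / R⌉₊ ≤ N + 1 := by omega
          exact_mod_cast this
        rw [← div_le_iff₀' hR0]
        exact h1.trans h2
      have hmem : p ∈ bad N := by
        by_contra hn
        rw [hbad, Set.mem_ofPred_eq, not_or, not_not] at hn
        have hb := exceedTime_bound hv hB (Nat.one_le_iff_ne_zero.2 hn.1) hQ1 hQB hn.2.1 hn.2.2 h0 h
        have h1 : Z / R ≤ N := by rw [div_le_iff₀ hR0]; linarith
        have h2 : ⌈Z / R⌉₊ ≤ N := Nat.ceil_le.2 h1
        have := hn.1
        omega
      refine le_trans ?_ (ENNReal.le_tsum N)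
      rw [Set.indicator_of_mem hmem]
      refine ENNReal.ofReal_le_ofReal (Real.exp_le_exp.2 ?_)
      rw [div_mul_eq_mul_div, div_le_iff₀ hR0]
      nlinarith
  refine (lintegral_mono_ae pw).trans ?_
  rw [lintegral_tsum fun N => (measurable_const.indicator (mbad N)).aemeasurable]
  have each : ∀ N : ℕ, ∫⁻ p, (bad N).indicator
      (fun _ => ENNReal.ofReal (Real.exp (a / 2 * (N + 1)))) p ∂(quenchedPair ω ω' x y) ≤
      ENNReal.ofReal (2 * A * Real.exp (a / 2) * Real.exp (-(a / 2) * N)) := by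
    intro N
    rw [lintegral_indicator_const (mbad N)]
    have hm : quenchedPair ω ω' x y (bad N) ≤ ENNReal.ofReal (2 * A * Real.exp (-a * N)) := by
      rcases Nat.eq_zero_or_pos N with rfl | hN
      · refine prob_le_one.trans ?_
        rw [ENNReal.one_le_ofReal]
        simp only [Nat.cast_zero, mul_zero, Real.exp_zero]
        linarith
      · refine (measure_mono ?_).trans (measure_pair_not_linearGrowth_le (by linarith)
          (H u ω hω x N) (H u ω' hω' y N))
        rintro p (hp | hp)
        · omega
        · exact hp
    refine (mul_le_mul_right hm _).trans ?_
    rw [← ENNReal.ofReal_mul (Real.exp_pos _).le]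
    refine ENNReal.ofReal_le_ofReal (le_of_eq ?_)
    have e : Real.exp (a / 2 * (N + 1)) * Real.exp (-a * N) =
        Real.exp (a / 2) * Real.exp (-(a / 2) * N) := by
      rw [← Real.exp_add, ← Real.exp_add]; ring_nf
    linear_combination (2 * A) * e
  refine (ENNReal.tsum_le_tsum each).trans ?_
  rw [← ENNReal.ofReal_tsum_of_nonneg (fun n => by positivity) (hS.mul_left _), tsum_mul_left]

/-! ### Exponential moments of the regeneration time -/

theorem onFinite_andThen {S T : Path d → Path d → Option (ℕ × ℕ)} (l : ℝ) (p : Path d × Path d) :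
    onFinite (weight l) (andThen S T p.1 p.2) = onFinite (fun st => weight l st *
      onFinite (weight l) (T (shiftPair st.1 st.2 p).1 (shiftPair st.1 st.2 p).2)) (S p.1 p.2) := by
  rcases h : S p.1 p.2 with _ | st
  · rw [andThen_of_none h]; rfl
  · rw [andThen_of_some h, onFinite_some]
    simp only [shiftPair, Prod.map]
    rcases h' : T (shift st.1 p.1) (shift st.2 p.2) with _ | ab
    · simp
    · simp [weight_add]

theorem lintegral_onFinite_andThen {S T : Path d → Path d → Option (ℕ × ℕ)} (hS : IsJointStop S)
    (hT : IsJointStop T) (l : ℝ) (ω ω' : Env d) (x y : Lattice d) :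
    ∫⁻ p, onFinite (weight l) (andThen S T p.1 p.2) ∂(quenchedPair ω ω' x y) =
      ∫⁻ p, onFinite (fun st => weight l st * ∫⁻ r, onFinite (weight l) (T r.1 r.2)
        ∂(quenchedPair ω ω' (p.1 st.1) (p.2 st.2))) (S p.1 p.2) ∂(quenchedPair ω ω' x y) := by
  simp_rw [onFinite_andThen]
  exact lintegral_stop ω ω' x y hS (weight l) (F := fun r => onFinite (weight l) (T r.1 r.2))
    (hT.measurable_comp _)

theorem onFinite_mono {f g : ℕ × ℕ → ℝ≥0∞} {o : Option (ℕ × ℕ)} (h : ∀ st, o = some st → f st ≤ g st) :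
    onFinite f o ≤ onFinite g o := by
  rcases o with _ | st
  · exact le_rfl
  · exact h st rfl

theorem onFinite_mul_const (f : ℕ × ℕ → ℝ≥0∞) (a : ℝ≥0∞) (o : Option (ℕ × ℕ)) :
    onFinite (fun st => f st * a) o = onFinite f o * a := by
  rcases o with _ | st <;> simp

theorem retryTime_ne_none_subset (u : Lattice d) :
    {p : Path d × Path d | retryTime u p.1 p.2 ≠ none} ⊆ (noBacktrack u)ᶜ := by
  rintro p hp ⟨h1, h2⟩
  exact hp (andThen_of_none (exceedTime_eq_none h1 h2))

/-- The strong Markov property at the exceedance time. The walks are then at different levels, and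
the search for a fresh level costs an exponential of the difference; its rate is chosen at most `a`,
so that the exceedance moment, which contains this difference, absorbs it. -/
theorem exists_lintegral_retryTime_le_moment (P : StepConstants) :
    ∃ l A : ℝ, 0 < l ∧ 0 ≤ A ∧ ∀ (u : Lattice d) (ω ω' : Env d), StepBounds u P ω →
      StepBounds u P ω' → ∀ x y, x ⬝ᵥ u = y ⬝ᵥ u →
      ∫⁻ p, onFinite (weight l) (retryTime u p.1 p.2) ∂(quenchedPair ω ω' x y) ≤
        ENNReal.ofReal A := by
  obtain ⟨a, A, ha, hA, H⟩ := exists_lintegral_exceedTime_le (d := d) P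
  have hb : 0 < min P.b₀ a := lt_min P.b₀_pos ha
  obtain ⟨l, A', hl, hA', H'⟩ := exists_lintegral_freshTime_le (d := d) P hb (min_le_left _ _)
  refine ⟨min l a, A * A', lt_min hl ha, by positivity, ?_⟩
  intro u ω ω' hω hω' x y hxy
  rw [retryTime, lintegral_onFinite_andThen (isJointStop_exceedTime u) (isJointStop_freshTime u),
    ENNReal.ofReal_mul hA]
  refine le_trans (lintegral_mono fun p => ?_) ((lintegral_mul_const' (ENNReal.ofReal A') _
    ENNReal.ofReal_ne_top).trans_le (mul_le_mul_left (H u ω ω' hω hω' x y hxy) _))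
  rw [← onFinite_mul_const]
  refine onFinite_mono fun st _ => ?_
  have h1 : ∫⁻ r, onFinite (weight (min l a)) (freshTime u r.1 r.2)
      ∂(quenchedPair ω ω' (p.1 st.1) (p.2 st.2)) ≤ ENNReal.ofReal (A' * Real.exp (min P.b₀ a *
        |((p.1 st.1 ⬝ᵥ u : ℤ) : ℝ) - (p.2 st.2 ⬝ᵥ u : ℤ)|)) :=
    (lintegral_mono fun r => (onFinite_weight_le_cost _ _).trans
      (cost_mono_left (min_le_left _ _) _)).trans (H' u ω ω' hω hω' _ _)
  refine (mul_le_mul_right h1 _).trans ?_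
  rw [weight, ← ENNReal.ofReal_mul (Real.exp_pos _).le, ← ENNReal.ofReal_mul (Real.exp_pos _).le]
  refine ENNReal.ofReal_le_ofReal ?_
  rw [mul_left_comm, ← Real.exp_add, mul_comm]
  refine mul_le_mul_of_nonneg_right (Real.exp_le_exp.2 ?_) hA'
  have h2 : min l a ≤ a := min_le_right _ _
  have h3 : min P.b₀ a ≤ a := min_le_right _ _
  rw [mul_add]
  push_cast
  exact add_le_add (mul_le_mul_of_nonneg_right h2 (by positivity))
    (mul_le_mul_of_nonneg_right h3 (abs_nonneg _))

/-- Convexity of the exponential. It interpolates between the probability of a further retry, which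
is less than one, and an exponential moment that is only finite. -/
theorem weight_smul_le {θ : ℝ} (h0 : 0 ≤ θ) (h1 : θ ≤ 1) (l : ℝ) (st : ℕ × ℕ) :
    weight (θ * l) st ≤ 1 + ENNReal.ofReal θ * weight l st := by
  unfold weight
  rw [← ENNReal.ofReal_one, ← ENNReal.ofReal_mul h0, ← ENNReal.ofReal_add zero_le_one (by positivity)]
  refine ENNReal.ofReal_le_ofReal ?_
  have h := convexOn_exp.2 (Set.mem_univ 0) (Set.mem_univ (l * ((st.1 + st.2 : ℕ) : ℝ)))
    (sub_nonneg.2 h1) h0 (by ring)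
  simp only [smul_eq_mul, mul_zero, zero_add, Real.exp_zero, mul_one] at h
  rw [mul_assoc]
  linarith

/-- The retries are transient: the exponential moment on the event of another retry is less than
one. -/
theorem exists_lintegral_retryTime_le (P : StepConstants) :
    ∃ l r : ℝ, 0 < l ∧ 0 ≤ r ∧ r < 1 ∧ ∀ (u : Lattice d) (ω ω' : Env d), StepBounds u P ω →
      StepBounds u P ω' → ∀ x y, x ⬝ᵥ u = y ⬝ᵥ u →
      ∫⁻ p, onFinite (weight l) (retryTime u p.1 p.2) ∂(quenchedPair ω ω' x y) ≤
        ENNReal.ofReal r := by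
  obtain ⟨l, A, hl, hA, H⟩ := exists_lintegral_retryTime_le_moment (d := d) P
  set η := (1 - Real.exp (-P.b₀)) ^ 2 with hη
  have he : Real.exp (-P.b₀) < 1 := 
    (Real.exp_lt_exp.2 (neg_lt_zero.2 P.b₀_pos)).trans_eq Real.exp_zero
  have he0 := Real.exp_pos (-P.b₀)
  have hη0 : 0 < η := by have : 0 < 1 - Real.exp (-P.b₀) := by linarith
                         positivity
  have hη1 : η ≤ 1 := pow_le_one₀ (by linarith) (by linarith)
  -- This gives `θ * A ≤ η / 2`, and the moment at the reduced rate is at most `(1 - η) + η / 2`.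
  set θ := min 1 (η / (2 * (A + 1))) with hθ
  have hθ0 : 0 < θ := by positivity
  have hθ1 : θ ≤ 1 := min_le_left _ _
  have hθA : θ * A ≤ η / 2 := by
    have h1 : θ ≤ η / (2 * (A + 1)) := min_le_right _ _
    rw [le_div_iff₀ (by positivity)] at h1
    nlinarith
  refine ⟨θ * l, 1 - η / 2, by positivity, by linarith, by linarith, ?_⟩
  intro u ω ω' hω hω' x y hxy
  set fin : Set (Path d × Path d) := {p | retryTime u p.1 p.2 ≠ none} with hfin
  have mfin : MeasurableSet fin := (isJointStop_retryTime u).measurableSet {o | o ≠ none}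
  have h1 : quenchedPair ω ω' x y fin ≤ ENNReal.ofReal (1 - η) := by
    refine (measure_mono (retryTime_ne_none_subset u)).trans ?_
    rw [prob_compl_eq_one_sub (measurableSet_noBacktrack u), ENNReal.ofReal_sub _ hη0.le,
      ENNReal.ofReal_one]
    exact tsub_le_tsub_left (hω.le_measure_noBacktrack_pair hω' x y) _
  have pw : ∀ p : Path d × Path d, onFinite (weight (θ * l)) (retryTime u p.1 p.2) ≤
      fin.indicator 1 p + ENNReal.ofReal θ * onFinite (weight l) (retryTime u p.1 p.2) := by
    intro p
    rcases h : retryTime u p.1 p.2 with _ | st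
    · simp
    · have hp : p ∈ fin := by rw [hfin, Set.mem_ofPred_eq, h]; simp
      rw [Set.indicator_of_mem hp]
      exact weight_smul_le hθ0.le hθ1 l st
  refine (lintegral_mono pw).trans ?_
  rw [lintegral_add_left (measurable_one.indicator mfin), lintegral_indicator_one mfin,
    lintegral_const_mul' _ _ ENNReal.ofReal_ne_top]
  refine (add_le_add h1 (mul_le_mul_right (H u ω ω' hω hω' x y hxy) _)).trans ?_
  rw [← ENNReal.ofReal_mul hθ0.le, ← ENNReal.ofReal_add (by linarith) (by positivity)]
  exact ENNReal.ofReal_le_ofReal (by linarith)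

theorem lintegral_retryTimeIter_le {u : Lattice d} {ω ω' : Env d} {l : ℝ} {r : ℝ≥0∞}
    (h : ∀ x y, x ⬝ᵥ u = y ⬝ᵥ u →
      ∫⁻ p, onFinite (weight l) (retryTime u p.1 p.2) ∂(quenchedPair ω ω' x y) ≤ r)
    {x y : Lattice d} (hxy : x ⬝ᵥ u = y ⬝ᵥ u) (k : ℕ) :
    ∫⁻ p, onFinite (weight l) (retryTimeIter u k p.1 p.2) ∂(quenchedPair ω ω' x y) ≤ r ^ k := by
  induction k with
  | zero => simp [retryTimeIter, weight]
  | succ k ih =>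
    rw [retryTimeIter, lintegral_onFinite_andThen (isJointStop_retryTimeIter u k)
      (isJointStop_retryTime u), pow_succ]
    refine le_trans (lintegral_mono_ae (g := fun p =>
      onFinite (weight l) (retryTimeIter u k p.1 p.2) * r) ?_) ?_
    · filter_upwards [quenchedPair_start ω ω' x y] with p hp
      rw [← onFinite_mul_const]
      refine onFinite_mono fun st hst => mul_le_mul_right (h _ _ ?_) _
      exact retryTimeIter_level (by rw [hp.1, hp.2, hxy]) hst
    · rw [lintegral_mul_const _ ((isJointStop_retryTimeIter u k).measurable_comp _)]
      gcongr

/-- The last retry time is not a stopping time, but the individual retry times are, and summing over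
all of them dominates it. If there are infinitely many retries, each term is at least one and the
sum diverges, in accordance with the infinite cost. -/
theorem cost_lastRetryTime_le {u : Lattice d} {l : ℝ} (hl : 0 ≤ l) (p : Path d × Path d) :
    cost l (lastRetryTime u p.1 p.2) ≤
      ∑' k, onFinite (weight l) (retryTimeIter u k p.1 p.2) := by
  rcases h : lastRetryTime u p.1 p.2 with _ | st
  · have h1 : ∀ k, 1 ≤ onFinite (weight l) (retryTimeIter u k p.1 p.2) := by
      intro k
      obtain ⟨st, hst⟩ := exists_retryTimeIter_of_lastRetryTime_none h k
      rw [hst]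
      exact one_le_weight hl st
    have h2 : ∑' _ : ℕ, (1 : ℝ≥0∞) = ⊤ := ENNReal.tsum_const_eq_top_of_ne_zero one_ne_zero
    rw [cost_none, ← h2]
    exact ENNReal.tsum_le_tsum h1
  · obtain ⟨k, hk, -⟩ := lastRetryTime_eq_some.1 h
    refine le_trans (le_of_eq ?_) (ENNReal.le_tsum k)
    rw [hk]
    rfl

theorem ae_freshTime_ne_none {u : Lattice d} {P : StepConstants} {ω ω' : Env d}
    (hω : StepBounds u P ω) (hω' : StepBounds u P ω') (x y : Lattice d) :
    ∀ᵐ p ∂(quenchedPair ω ω' x y), freshTime u p.1 p.2 ≠ none := by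
  obtain ⟨l, A, hl, hA, H⟩ := exists_lintegral_freshTime_le (d := d) P P.b₀_pos le_rfl
  have h := ae_lt_top (μ := quenchedPair ω ω' x y)
    ((isJointStop_freshTime u).measurable_comp (cost l))
    ((H u ω ω' hω hω' x y).trans_lt ENNReal.ofReal_lt_top).ne
  filter_upwards [h] with p hp hn
  rw [hn] at hp
  exact lt_irrefl _ hp

/-- The strong Markov property at the first fresh time, where the walks are at a common level. From
such a level the retries contribute at most the geometric series `(1 - r)⁻¹`. -/
theorem exists_lintegral_regenTime_le (P : StepConstants) :
    ∃ l A : ℝ, 0 < l ∧ 0 ≤ A ∧ ∀ (u : Lattice d) (ω ω' : Env d), StepBounds u P ω →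
      StepBounds u P ω' → ∀ x y, x ⬝ᵥ u = y ⬝ᵥ u →
      ∫⁻ p, cost l (regenTime u p.1 p.2) ∂(quenchedPair ω ω' x y) ≤ ENNReal.ofReal A := by
  obtain ⟨l₁, r, hl₁, hr0, hr1, H₁⟩ := exists_lintegral_retryTime_le (d := d) P
  obtain ⟨l₂, A, hl₂, hA, H₂⟩ := exists_lintegral_freshTime_le (d := d) P P.b₀_pos le_rfl
  set l := min l₁ l₂ with hl
  have hl0 : 0 < l := lt_min hl₁ hl₂
  have hr2 : 0 < 1 - r := by linarith
  refine ⟨l, A * (1 - r)⁻¹, hl0, by positivity, ?_⟩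
  intro u ω ω' hω hω' x y hxy
  have hretry : ∀ x y, x ⬝ᵥ u = y ⬝ᵥ u →
      ∫⁻ p, onFinite (weight l) (retryTime u p.1 p.2) ∂(quenchedPair ω ω' x y) ≤
        ENNReal.ofReal r := fun x y h =>
    (lintegral_mono fun p => onFinite_mono fun st _ => weight_mono_left (min_le_left _ _) st).trans
      (H₁ u ω ω' hω hω' x y h)
  set G : Path d × Path d → ℝ≥0∞ := fun p =>
    ∑' k, onFinite (weight l) (retryTimeIter u k p.1 p.2) with hG
  have mG : Measurable G :=
    Measurable.tsum fun k => (isJointStop_retryTimeIter u k).measurable_comp _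
  have hGint : ∀ x y, x ⬝ᵥ u = y ⬝ᵥ u →
      ∫⁻ p, G p ∂(quenchedPair ω ω' x y) ≤ ENNReal.ofReal (1 - r)⁻¹ := by
    intro x y h
    rw [hG, lintegral_tsum fun k => ((isJointStop_retryTimeIter u k).measurable_comp _).aemeasurable]
    refine (ENNReal.tsum_le_tsum fun k => lintegral_retryTimeIter_le hretry h k).trans ?_
    rw [ENNReal.tsum_geometric, ENNReal.ofReal_inv_of_pos hr2, ENNReal.ofReal_sub _ hr0,
      ENNReal.ofReal_one]
  have pw : ∀ᵐ p ∂(quenchedPair ω ω' x y), cost l (regenTime u p.1 p.2) ≤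
      onFinite (fun st => weight l st * G (shiftPair st.1 st.2 p)) (freshTime u p.1 p.2) := by
    filter_upwards [ae_freshTime_ne_none hω hω' x y] with p hp
    obtain ⟨st, hst⟩ := Option.ne_none_iff_exists'.1 hp
    rw [hst, onFinite_some, regenTime, andThen_of_some hst]
    refine le_trans ?_ (mul_le_mul_right (cost_lastRetryTime_le hl0.le _) _)
    simp only [shiftPair, Prod.map]
    rcases lastRetryTime u (shift st.1 p.1) (shift st.2 p.2) with _ | ab
    · rw [cost_none, ENNReal.mul_top]
      · exact le_top
      · exact (zero_lt_one.trans_le (one_le_weight hl0.le st)).ne'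
    · rw [Option.map_some, cost_some, cost_some, weight_add]
  refine (lintegral_mono_ae pw).trans ?_
  rw [lintegral_stop ω ω' x y (isJointStop_freshTime u) (weight l) mG]
  have pw2 : ∀ p : Path d × Path d, onFinite (fun st => weight l st *
      ∫⁻ r, G r ∂(quenchedPair ω ω' (p.1 st.1) (p.2 st.2))) (freshTime u p.1 p.2) ≤
      cost l₂ (freshTime u p.1 p.2) * ENNReal.ofReal (1 - r)⁻¹ := by
    intro p
    refine le_trans (onFinite_mono (g := fun st => weight l st * ENNReal.ofReal (1 - r)⁻¹)
      fun st hst => mul_le_mul_right (hGint _ _ (freshTime_level hst)) _) ?_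
    rw [onFinite_mul_const]
    exact mul_le_mul_left ((onFinite_weight_le_cost _ _).trans
      (cost_mono_left (min_le_right _ _) _)) _
  refine (lintegral_mono pw2).trans ?_
  rw [lintegral_mul_const' _ _ ENNReal.ofReal_ne_top, ENNReal.ofReal_mul hA]
  gcongr
  refine (H₂ u ω ω' hω hω' x y).trans (le_of_eq ?_)
  rw [hxy]
  simp

/-! ### The exponential tail of the regeneration time. -/

/-- The pairs of paths with a common regeneration by time `n`. -/
def regenBefore (u : Lattice d) (n : ℕ) : Set (Path d × Path d) :=
  {p | ∃ s t, regenTime u p.1 p.2 = some (s, t) ∧ s ≤ n ∧ t ≤ n}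

theorem measurableSet_regenBefore (u : Lattice d) (n : ℕ) : MeasurableSet (regenBefore u n) := by
  simp only [regenBefore, Set.ofPred_exists, Set.ofPred_and]
  exact MeasurableSet.iUnion fun s => MeasurableSet.iUnion fun t =>
    (measurableSet_regenTime_eq_some u s t).inter ((MeasurableSet.const _).inter (MeasurableSet.const _))

theorem exists_measure_regenBefore_compl_le (P : StepConstants) :
    ∃ l A : ℝ, 0 < l ∧ 0 ≤ A ∧ ∀ (u : Lattice d) (ω ω' : Env d), StepBounds u P ω →
      StepBounds u P ω' → ∀ x y, x ⬝ᵥ u = y ⬝ᵥ u → ∀ n : ℕ,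
      quenchedPair ω ω' x y (regenBefore u n)ᶜ ≤ ENNReal.ofReal (A * Real.exp (-l * n)) := by
  obtain ⟨l, A, hl, hA, H⟩ := exists_lintegral_regenTime_le (d := d) P
  refine ⟨l, A, hl, hA, ?_⟩
  intro u ω ω' hω hω' x y hxy n
  have hm : Measurable fun p : Path d × Path d => cost l (regenTime u p.1 p.2) :=
    (measurable_from_top (f := cost l)).comp
      (measurable_of_measurableSet_some fun st => measurableSet_regenTime_eq_some u st.1 st.2)
  have h1 := mul_meas_ge_le_lintegral (μ := quenchedPair ω ω' x y) hm
    (ENNReal.ofReal (Real.exp (l * n)))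
  have hsub : (regenBefore u n)ᶜ ⊆
      {p | ENNReal.ofReal (Real.exp (l * n)) ≤ cost l (regenTime u p.1 p.2)} := by
    intro p hp
    rw [Set.mem_ofPred_eq]
    rcases h : regenTime u p.1 p.2 with _ | ⟨s, t⟩
    · exact le_top
    · have : n ≤ s + t := by
        by_contra hlt
        exact hp ⟨s, t, h, by omega, by omega⟩
      rw [cost_some, weight]
      gcongr
  have h2 : quenchedPair ω ω' x y (regenBefore u n)ᶜ ≤
      ENNReal.ofReal (Real.exp (-l * n)) * (ENNReal.ofReal (Real.exp (l * n)) *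
        quenchedPair ω ω' x y (regenBefore u n)ᶜ) := by
    rw [← mul_assoc, ← ENNReal.ofReal_mul (Real.exp_pos _).le, ← Real.exp_add, neg_mul,
      neg_add_cancel, Real.exp_zero, ENNReal.ofReal_one, one_mul]
  refine h2.trans ?_
  rw [mul_comm A, ENNReal.ofReal_mul (Real.exp_pos _).le]
  gcongr
  refine le_trans ?_ (h1.trans (H u ω ω' hω hω' x y hxy))
  gcongr

/-! ### The retries never get stuck -/

theorem exceedTime_ne_none {u : Lattice d} {v B : ℝ} {N : ℕ} {p : Path d × Path d} (hv : 0 < v)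
    (h1 : LinearGrowth u v B N p.1) (h2 : LinearGrowth u v B N p.2) (h : p ∉ noBacktrack u) :
    exceedTime u p.1 p.2 ≠ none := by
  have hex : ∀ {w : Path d}, LinearGrowth u v B N w → ∀ ℓ : ℤ,
      ∃ s, ℓ < w s ⬝ᵥ u ∧ ∀ i < s, w i ⬝ᵥ u ≤ ℓ := by
    intro w hw ℓ
    classical
    have hn : ∃ n, ℓ < w n ⬝ᵥ u := by
      obtain ⟨n, hn⟩ := exists_nat_ge (((ℓ : ℝ) - (w 0 ⬝ᵥ u : ℤ)) / v)
      refine ⟨max n N, ?_⟩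
      have h3 := hw.1 (max n N) (le_max_right _ _)
      have h4 : (n : ℝ) ≤ (max n N : ℕ) := by exact_mod_cast le_max_left n N
      rw [div_le_iff₀ hv] at hn
      have h5 : (ℓ : ℝ) < (w (max n N) ⬝ᵥ u : ℤ) := by nlinarith
      exact_mod_cast h5
    exact ⟨Nat.find hn, Nat.find_spec hn, fun i hi => not_lt.1 (Nat.find_min hn hi)⟩
  have hr : min (backtrackTime u p.1) (backtrackTime u p.2) ≠ ⊤ := by
    intro htop
    rw [min_eq_top] at htop
    exact h htop
  obtain ⟨r, hr⟩ := ENat.ne_top_iff_exists.1 hr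
  obtain ⟨s, hs⟩ := hex h1 (max (runMax u r p.1) (runMax u r p.2))
  obtain ⟨t, ht⟩ := hex h2 (max (runMax u r p.1) (runMax u r p.2))
  rw [exceedTime_eq_some.2 ⟨r, hr.symm, hs, ht⟩]
  simp

/-- A retry could be stuck because the level is never exceeded, or because no fresh level follows.
Linear growth from some random time on excludes the former, and the strong Markov property at the
exceedance time excludes the latter. -/
theorem measure_stuckRetry {u : Lattice d} {P : StepConstants} {ω ω' : Env d}
    (hω : StepBounds u P ω) (hω' : StepBounds u P ω') (x y : Lattice d) :
    quenchedPair ω ω' x y (stuckRetry u) = 0 := by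
  obtain ⟨v, B, a, A, hv, hB, ha, hA, H⟩ := exists_measure_not_linearGrowth_le (d := d) P
  have h1 : ∀ᵐ p ∂(quenchedPair ω ω' x y),
      ∃ N, LinearGrowth u v B N p.1 ∧ LinearGrowth u v B N p.2 := by
    rw [ae_iff]
    have hle : ∀ N : ℕ, quenchedPair ω ω' x y
        {p | ¬ ∃ N, LinearGrowth u v B N p.1 ∧ LinearGrowth u v B N p.2} ≤
        ENNReal.ofReal (2 * A * Real.exp (-a * N)) := by
      intro N
      refine le_trans (measure_mono ?_)
        (measure_pair_not_linearGrowth_le (by linarith) (H u ω hω x N) (H u ω' hω' y N))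
      exact fun p hp hN => hp ⟨N, hN⟩
    have hlim : Filter.Tendsto (fun N : ℕ => ENNReal.ofReal (2 * A * Real.exp (-a * N))) Filter.atTop
        (nhds 0) := by
      have := ENNReal.tendsto_ofReal
        ((summable_exp_neg_mul ha).tendsto_atTop_zero.const_mul (2 * A))
      simpa using this
    exact le_antisymm (ge_of_tendsto' hlim hle) zero_le
  have h2 : ∀ᵐ p ∂(quenchedPair ω ω' x y), ∀ st, exceedTime u p.1 p.2 = some st →
      freshTime u (shift st.1 p.1) (shift st.2 p.2) ≠ none := by
    set F : Path d × Path d → ℝ≥0∞ :=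
      {p : Path d × Path d | freshTime u p.1 p.2 = none}.indicator 1 with hF
    have mset : MeasurableSet {p : Path d × Path d | freshTime u p.1 p.2 = none} :=
      (isJointStop_freshTime u).measurableSet {none}
    have mF : Measurable F := measurable_one.indicator mset
    have hF0 : ∀ x y, ∫⁻ p, F p ∂(quenchedPair ω ω' x y) = 0 := by
      intro x y
      rw [hF, lintegral_indicator_one mset]
      have := ae_freshTime_ne_none hω hω' x y
      rw [ae_iff] at this
      simpa using this
    have h3 := lintegral_stop ω ω' x y (isJointStop_exceedTime u) (fun _ => 1) mF
    simp only [hF0, one_mul] at h3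
    have h4 : ∀ o : Option (ℕ × ℕ), onFinite (fun _ => (0 : ℝ≥0∞)) o = 0 := by
      intro o; rcases o with _ | st <;> rfl
    simp only [h4, lintegral_zero] at h3
    have meas : Measurable fun p : Path d × Path d =>
        onFinite (fun st => F (shiftPair st.1 st.2 p)) (exceedTime u p.1 p.2) := by
      have e : ∀ p : Path d × Path d,
          onFinite (fun st => F (shiftPair st.1 st.2 p)) (exceedTime u p.1 p.2) =
          ∑' st, ({p : Path d × Path d | exceedTime u p.1 p.2 = some st}.indicator
            (fun p => F (shiftPair st.1 st.2 p))) p := by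
        intro p
        rcases h : exceedTime u p.1 p.2 with _ | st
        · simp [Set.indicator, h]
        · rw [tsum_eq_single st]
          · simp [Set.indicator, h]
          · intro st' hst'
            simp [Set.indicator, h, hst'.symm]
      simp_rw [e]
      exact Measurable.tsum fun st => (mF.comp (measurable_shiftPair st.1 st.2)).indicator
        ((isJointStop_exceedTime u).measurableSet_some st)
    rw [lintegral_eq_zero_iff meas] at h3
    filter_upwards [h3] with p hp st hst hn
    rw [hst] at hp
    have : F (shiftPair st.1 st.2 p) = 0 := hp
    rw [hF, Set.indicator_of_mem (by exact hn)] at this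
    exact one_ne_zero this
  rw [measure_eq_zero_iff_ae_notMem]
  filter_upwards [h1, h2] with p ⟨N, hN1, hN2⟩ hp2 ⟨hb, hnone⟩
  obtain ⟨st, hst⟩ := Option.ne_none_iff_exists'.1 (exceedTime_ne_none hv hN1 hN2 hb)
  rw [retryTime, andThen_of_some hst] at hnone
  exact hp2 st hst (Option.map_eq_none_iff.1 hnone)

/-- Stated for deterministic shifts because the regeneration time is not a stopping time. Since
there are only countably many pairs `(s, t)`, the null sets can be united, which covers the random
time. -/
theorem measure_shiftPair_stuckRetry {u : Lattice d} {P : StepConstants} {ω ω' : Env d}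
    (hω : StepBounds u P ω) (hω' : StepBounds u P ω') (x y : Lattice d) (s t : ℕ) :
    quenchedPair ω ω' x y (shiftPair s t ⁻¹' stuckRetry u) = 0 := by
  have hdet : DeterminedBy (d := d) s t Set.univ := fun _ _ _ _ _ => trivial
  have h := setLIntegral_shiftPair ω ω' x y hdet
    (measurable_one.indicator (measurableSet_stuckRetry u))
  simp only [lintegral_indicator_one (measurableSet_stuckRetry u), measure_stuckRetry hω hω',
    Measure.restrict_univ, lintegral_zero] at h
  rw [← h, ← lintegral_indicator_one
    ((measurableSet_stuckRetry u).preimage (measurable_shiftPair s t))]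
  rfl

/-! ### Averaged laws -/

theorem measurable_quenchedPair (x y : Lattice d) :
    Measurable fun e : Env d × Env d => quenchedPair e.1 e.2 x y := by
  let κ₁ : Kernel (Env d × Env d) (Path d) :=
    ⟨fun e => quenched e.1 x, (measurable_quenched x).comp measurable_fst⟩
  let κ₂ : Kernel (Env d × Env d) (Path d) :=
    ⟨fun e => quenched e.2 y, (measurable_quenched y).comp measurable_snd⟩
  have : IsMarkovKernel κ₁ := ⟨fun e => inferInstanceAs (IsProbabilityMeasure (quenched e.1 x))⟩
  have : IsMarkovKernel κ₂ := ⟨fun e => inferInstanceAs (IsProbabilityMeasure (quenched e.2 y))⟩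
  have h : (fun e : Env d × Env d => quenchedPair e.1 e.2 x y) = fun e => (κ₁ ×ₖ κ₂) e := by
    funext e
    rw [Kernel.prod_apply]
    rfl
  rw [h]
  exact (κ₁ ×ₖ κ₂).measurable

theorem measurable_quenchedPair_diag (x y : Lattice d) :
    Measurable fun ω : Env d => quenchedPair ω ω x y :=
  (measurable_quenchedPair x y).comp (g := fun e : Env d × Env d => quenchedPair e.1 e.2 x y)
    (f := fun ω => (ω, ω)) (measurable_id.prodMk measurable_id)

theorem averagedPair_apply (m : Measure (PMF (Lattice d))) (x y : Lattice d) {E : Set (Path d × Path d)} (hE : MeasurableSet E) :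
    averagedPair m x y E = ∫⁻ ω, quenchedPair ω ω x y E ∂(envLaw m) :=
  Measure.bind_apply hE (measurable_quenchedPair_diag x y).aemeasurable

variable (m : Measure (PMF (Lattice d))) [IsProbabilityMeasure m]

instance : IsProbabilityMeasure (envLaw m) := by
  unfold envLaw; infer_instance

instance (x : Lattice d) : IsProbabilityMeasure (averaged m x) :=
  isProbabilityMeasure_bind (measurable_quenched x).aemeasurable (ae_of_all _ fun _ => inferInstance)

instance (x y : Lattice d) : IsProbabilityMeasure (averagedPair m x y) :=
  isProbabilityMeasure_bind (measurable_quenchedPair_diag x y).aemeasurable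
    (ae_of_all _ fun ω => inferInstanceAs (IsProbabilityMeasure (quenchedPair ω ω x y)))

/-- Writing the law in independent environments as a mixture of `quenchedPair` makes the same
quenched estimates available for it as for the common environment. -/
theorem averaged_prod_eq_bind (x y : Lattice d) : (averaged m x).prod (averaged m y) =
    ((envLaw m).prod (envLaw m)).bind fun e => quenchedPair e.1 e.2 x y := by
  refine Measure.prod_eq fun A B hA hB => ?_
  rw [Measure.bind_apply (hA.prod hB) (measurable_quenchedPair x y).aemeasurable]
  simp_rw [quenchedPair, Measure.prod_prod]
  rw [lintegral_prod_mul (f := fun ω => quenched ω x A) (g := fun ω => quenched ω y B)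
    ((Measure.measurable_coe hA).comp (measurable_quenched x)).aemeasurable
    ((Measure.measurable_coe hB).comp (measurable_quenched y)).aemeasurable, averaged, averaged,
    Measure.bind_apply hA (measurable_quenched x).aemeasurable,
    Measure.bind_apply hB (measurable_quenched y).aemeasurable]

variable {m}

theorem averagedPair_le {p : Env d → Prop} (hp : ∀ᵐ ω ∂(envLaw m), p ω) {x y : Lattice d}
    {E : Set (Path d × Path d)} (hE : MeasurableSet E) {ε : ℝ≥0∞}
    (h : ∀ ω ω', p ω → p ω' → quenchedPair ω ω' x y E ≤ ε) : averagedPair m x y E ≤ ε := by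
  rw [averagedPair_apply m x y hE]
  calc ∫⁻ ω, quenchedPair ω ω x y E ∂(envLaw m) ≤ ∫⁻ _, ε ∂(envLaw m) :=
        lintegral_mono_ae (hp.mono fun ω hω => h ω ω hω hω)
    _ = ε := by simp

theorem averaged_prod_le {p : Env d → Prop} (hp : ∀ᵐ ω ∂(envLaw m), p ω) {x y : Lattice d}
    {E : Set (Path d × Path d)} (hE : MeasurableSet E) {ε : ℝ≥0∞}
    (h : ∀ ω ω', p ω → p ω' → quenchedPair ω ω' x y E ≤ ε) :
    (averaged m x).prod (averaged m y) E ≤ ε := by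
  rw [averaged_prod_eq_bind, Measure.bind_apply hE (measurable_quenchedPair x y).aemeasurable]
  have h1 : ∀ᵐ e ∂((envLaw m).prod (envLaw m)), p e.1 :=
    Measure.quasiMeasurePreserving_fst.ae hp
  have h2 : ∀ᵐ e ∂((envLaw m).prod (envLaw m)), p e.2 :=
    Measure.quasiMeasurePreserving_snd.ae hp
  calc ∫⁻ e, quenchedPair e.1 e.2 x y E ∂((envLaw m).prod (envLaw m))
      ≤ ∫⁻ _, ε ∂((envLaw m).prod (envLaw m)) := by
        refine lintegral_mono_ae ?_
        filter_upwards [h1, h2] with e he1 he2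
        exact h _ _ he1 he2
    _ = ε := by simp

/-- The part of the path probability that depends on the sites of `S` only. -/
theorem measurable_stepProd (p : Path d) (n : ℕ) (c : ℝ≥0∞) (S : Finset (Lattice d)) :
    Measurable fun v : S → PMF (Lattice d) => c * ∏ i ∈ Finset.range n,
      if h : p i ∈ S then v ⟨p i, h⟩ (p (i + 1) - p i) else 1 := by
  refine Measurable.const_mul (Finset.measurable_prod _ fun i _ => ?_) c
  split_ifs with h
  · have h1 : Measurable (fun q : PMF (Lattice d) => (fun z => q z)) := comap_measurable _
    exact (measurable_pi_apply (p (i + 1) - p i)).comp (h1.comp (measurable_pi_apply _))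
  · exact measurable_const

/-- The two quenched cylinder probabilities are functions of the environment at disjoint finite sets
of sites, hence independent, and the mean of their product factorizes. -/
theorem averagedPair_eq_of_disjoint (x y : Lattice d) (p p' : Path d) (n : ℕ)
    (h : ∀ i < n, ∀ j < n, p i ≠ p' j) :
    averagedPair m x y (cyl p n ×ˢ cyl p' n) =
      ((averaged m x).prod (averaged m y)) (cyl p n ×ˢ cyl p' n) := by
  classical
  set S := (Finset.range n).image p with hS
  set T := (Finset.range n).image p' with hT
  have hST : Disjoint S T := by
    refine Finset.disjoint_left.2 fun z hz hz' => ?_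
    obtain ⟨i, hi, rfl⟩ := Finset.mem_image.1 hz
    obtain ⟨j, hj, hij⟩ := Finset.mem_image.1 hz'
    exact h i (Finset.mem_range.1 hi) j (Finset.mem_range.1 hj) hij.symm
  have hind : IndepFun (fun (ω : Env d) (i : S) => ω i) (fun ω (i : T) => ω i) (envLaw m) :=
    (iIndepFun_infinitePi (P := fun _ : Lattice d => m) (X := fun _ ω => ω)
      fun _ => measurable_id).indepFun_finset S T hST fun i => measurable_pi_apply i
  have rep : ∀ (q : Path d) (z : Lattice d) (R : Finset (Lattice d)), (∀ i < n, q i ∈ R) →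
      ∀ ω : Env d, quenched ω z (cyl q n) = (if q 0 = z then 1 else 0) * ∏ i ∈ Finset.range n,
        if h : q i ∈ R then (fun i : R => ω i) ⟨q i, h⟩ (q (i + 1) - q i) else 1 := by
    intro q z R hR ω
    rw [quenched_cyl]
    congr 1
    refine Finset.prod_congr rfl fun i hi => ?_
    rw [dif_pos (hR i (Finset.mem_range.1 hi))]
  have r1 := rep p x S fun i hi => Finset.mem_image_of_mem p (Finset.mem_range.2 hi)
  have r2 := rep p' y T fun i hi => Finset.mem_image_of_mem p' (Finset.mem_range.2 hi)
  have hind' := hind.comp (measurable_stepProd p n (if p 0 = x then 1 else 0) S)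
    (measurable_stepProd p' n (if p' 0 = y then 1 else 0) T)
  have meas : ∀ (q : Path d) (z : Lattice d), Measurable fun ω : Env d => quenched ω z (cyl q n) :=
    fun q z => (Measure.measurable_coe (measurableSet_cyl q n)).comp (measurable_quenched z)
  have hind'' : IndepFun (fun ω : Env d => quenched ω x (cyl p n))
      (fun ω => quenched ω y (cyl p' n)) (envLaw m) := by
    convert hind' using 1
    · funext ω; exact r1 ω
    · funext ω; exact r2 ω
  rw [averagedPair_apply m x y ((measurableSet_cyl p n).prod (measurableSet_cyl p' n)),
    Measure.prod_prod, averaged, averaged,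
    Measure.bind_apply (measurableSet_cyl p n) (measurable_quenched x).aemeasurable,
    Measure.bind_apply (measurableSet_cyl p' n) (measurable_quenched y).aemeasurable]
  simp_rw [quenchedPair, Measure.prod_prod]
  exact lintegral_mul_eq_lintegral_mul_lintegral_of_indepFun (meas p x) (meas p' y) hind''

/-- The pairs of paths whose ranges up to time `n` intersect. -/
def rangesMeet (n : ℕ) : Set (Path d × Path d) := {p | ∃ i ≤ n, ∃ j ≤ n, p.1 i = p.2 j}

theorem determinedBy_rangesMeet (n : ℕ) : DeterminedBy n n (rangesMeet (d := d) n) := by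
  rintro p q h h' ⟨i, hi, j, hj, hij⟩
  exact ⟨i, hi, j, hj, by rw [← h i hi, ← h' j hj, hij]⟩

/-- Two walks with disjoint ranges do not feel that they share the environment. -/
theorem averagedPair_eq_of_determinedBy (x y : Lattice d) {n : ℕ} {A : Set (Path d × Path d)}
    (hA : DeterminedBy n n A) (hmeet : Disjoint A (rangesMeet n)) :
    averagedPair m x y A = ((averaged m x).prod (averaged m y)) A := by
  have e : ∀ μ : Measure (Path d × Path d), μ A = ∑' a, μ (A ∩ box n n a) := by
    intro μ
    conv_lhs => rw [eq_iUnion_inter_box n n A]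
    refine measure_iUnion ?_ fun a => hA.measurableSet.inter (measurableSet_box n n a)
    intro a b hab
    exact (pairwise_disjoint_box n n hab).mono Set.inter_subset_right Set.inter_subset_right
  rw [e, e]
  refine tsum_congr fun a => ?_
  rcases hA.inter_box a with h | h
  · rw [h.2]
    refine averagedPair_eq_of_disjoint x y _ _ n fun i hi j hj hij => ?_
    exact Set.disjoint_left.1 hmeet h.1 ⟨i, hi.le, j, hj.le, hij⟩
  · rw [h.2, measure_empty, measure_empty]

/-! ### The ranges are unlikely to meet -/

/-- By the triangle inequality, `exp (s * |w i - x|)` grows in mean by at most a factor `exp (s *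
M)` per step. Chebyshev's inequality at each time and a union bound over the `n + 1` times give the
estimate. -/
theorem StepBounds.measure_far_le {u : Lattice d} {P : StepConstants} {ω : Env d}
    (hω : StepBounds u P ω) (x : Lattice d) (n : ℕ) (R : ℝ) :
    quenched ω x {w | ∃ i ≤ n, R ≤ eNorm (w i - x)} ≤
      ENNReal.ofReal ((n + 1) * Real.exp (P.s * (P.M * n - R))) := by
  have hs := P.s_pos
  have hM := P.M_pos
  have hh : ∀ y, ∑' z, ω y z * ENNReal.ofReal (Real.exp (P.s * (eNorm (y + z - x) - R))) ≤
      ENNReal.ofReal (Real.exp (P.s * P.M)) *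
        ENNReal.ofReal (Real.exp (P.s * (eNorm (y - x) - R))) := by
    intro y
    refine le_trans (ENNReal.tsum_le_tsum (g := fun z => (ω y z *
      ENNReal.ofReal (Real.exp (P.s * eNorm z))) *
        ENNReal.ofReal (Real.exp (P.s * (eNorm (y - x) - R)))) fun z => ?_) ?_
    · rw [mul_assoc, ← ENNReal.ofReal_mul (Real.exp_pos _).le, ← Real.exp_add]
      refine mul_le_mul_right (ENNReal.ofReal_le_ofReal (Real.exp_le_exp.2 ?_)) _
      have h := eNorm_add_le (y - x) z
      rw [show y - x + z = y + z - x by abel] at h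
      nlinarith
    · rw [ENNReal.tsum_mul_right]
      exact mul_le_mul_left (hω.range y) _
  have each : ∀ i ≤ n, quenched ω x {w | R ≤ eNorm (w i - x)} ≤
      ENNReal.ofReal (Real.exp (P.s * (P.M * n - R))) := by
    intro i hi
    refine (measure_mono fun w hw => ?_).trans ((measure_walk_ge_le ω hh i x).trans ?_)
    · rw [Set.mem_ofPred_eq] at hw ⊢
      rw [ENNReal.one_le_ofReal]
      exact Real.one_le_exp (mul_nonneg hs.le (by linarith))
    · rw [← ENNReal.ofReal_pow (Real.exp_pos _).le, ← Real.exp_nat_mul,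
        ← ENNReal.ofReal_mul (Real.exp_pos _).le, ← Real.exp_add, sub_self, eNorm_zero]
      refine ENNReal.ofReal_le_ofReal (Real.exp_le_exp.2 ?_)
      have hi' : (i : ℝ) ≤ n := by exact_mod_cast hi
      have := mul_le_mul_of_nonneg_left hi' (mul_pos hs hM).le
      nlinarith
  have cover : {w : Path d | ∃ i ≤ n, R ≤ eNorm (w i - x)} =
      ⋃ i ∈ Finset.range (n + 1), {w : Path d | R ≤ eNorm (w i - x)} := by
    ext w
    simp
  rw [cover]
  refine (measure_biUnion_finset_le _ _).trans ?_
  refine (Finset.sum_le_sum fun i hi => each i (by have := Finset.mem_range.1 hi; omega)).trans ?_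
  rw [Finset.sum_const, Finset.card_range, nsmul_eq_mul, ENNReal.ofReal_mul (by positivity)]
  gcongr
  rw [← Nat.cast_add_one, ENNReal.ofReal_natCast]

/-- If the walks started at `0` and `x` visit a common site, one of them has travelled at least half
the distance between the starting points. -/
theorem measure_rangesMeet_le {u : Lattice d} {P : StepConstants} {ω ω' : Env d}
    (hω : StepBounds u P ω) (hω' : StepBounds u P ω') (x : Lattice d) (n : ℕ) :
    quenchedPair ω ω' 0 x (rangesMeet n) ≤
      ENNReal.ofReal (2 * (n + 1) * Real.exp (P.s * (P.M * n - eNorm x / 2))) := by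
  have cover : rangesMeet (d := d) n ⊆
      ({w | ∃ i ≤ n, eNorm x / 2 ≤ eNorm (w i - 0)} ×ˢ Set.univ) ∪
      (Set.univ ×ˢ {w | ∃ i ≤ n, eNorm x / 2 ≤ eNorm (w i - x)}) := by
    rintro p ⟨i, hi, j, hj, hij⟩
    have h := eNorm_add_le (p.1 i - 0) (-(p.2 j - x))
    rw [eNorm_neg, show p.1 i - 0 + -(p.2 j - x) = x by rw [hij]; abel] at h
    rcases le_total (eNorm x / 2) (eNorm (p.1 i - 0)) with h1 | h1
    · exact Or.inl ⟨⟨i, hi, h1⟩, trivial⟩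
    · exact Or.inr ⟨trivial, ⟨j, hj, by linarith⟩⟩
  refine (measure_mono cover).trans ((measure_union_le _ _).trans ?_)
  rw [quenchedPair, Measure.prod_prod, Measure.prod_prod, measure_univ, measure_univ, mul_one,
    one_mul, show 2 * ((n : ℝ) + 1) * Real.exp (P.s * (P.M * n - eNorm x / 2)) =
      (n + 1) * Real.exp (P.s * (P.M * n - eNorm x / 2)) +
      (n + 1) * Real.exp (P.s * (P.M * n - eNorm x / 2)) by ring,
    ENNReal.ofReal_add (by positivity) (by positivity)]
  exact add_le_add (hω.measure_far_le 0 n _) (hω'.measure_far_le x n _)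

/-! ### Regeneration seen from the frozen paths -/

/-- The event that neither walk backtracks and that the walks differ by `y` at the regeneration. -/
def regenEvent (u y : Lattice d) : Set (Path d × Path d) := noBacktrack u ∩ regenDiffEvent u y

theorem disjoint_regenDiffEvent (u : Lattice d) {y z : Lattice d} (h : y ≠ z) :
    Disjoint (regenDiffEvent u y) (regenDiffEvent u z) := by
  refine Set.disjoint_left.2 ?_
  rintro p ⟨s, t, h1, rfl⟩ ⟨s', t', h2, rfl⟩
  rw [h1] at h2
  obtain ⟨rfl, rfl⟩ : s = s' ∧ t = t' := by simpa using h2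
  exact h rfl

/-- The version of `regenEvent` for the paths that are frozen at time `n`, on the event that their
ranges are disjoint. -/
def frozenEvent (u : Lattice d) (n : ℕ) (y : Lattice d) : Set (Path d × Path d) :=
  {p | (freeze n p.1, freeze n p.2) ∈ regenEvent u y ∧ p ∉ rangesMeet n}

theorem determinedBy_frozenEvent (u : Lattice d) (n : ℕ) (y : Lattice d) :
    DeterminedBy n n (frozenEvent u n y) := by
  rintro p q h h' ⟨h1, h2⟩
  have e1 : freeze n p.1 = freeze n q.1 := funext fun i => h _ (min_le_right _ _)
  have e2 : freeze n p.2 = freeze n q.2 := funext fun i => h' _ (min_le_right _ _)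
  refine ⟨by rw [← e1, ← e2]; exact h1, fun hq => h2 ?_⟩
  exact determinedBy_rangesMeet n q p (fun i hi => (h i hi).symm) (fun i hi => (h' i hi).symm) hq

/-- The exceptional event: no regeneration by time `n`, or some retry gets stuck. -/
def exceptional (u : Lattice d) (n : ℕ) : Set (Path d × Path d) :=
  (regenBefore u n)ᶜ ∪ ⋃ st : ℕ × ℕ, shiftPair st.1 st.2 ⁻¹' stuckRetry u

theorem measurableSet_exceptional (u : Lattice d) (n : ℕ) : MeasurableSet (exceptional u n) :=
  (measurableSet_regenBefore u n).compl.union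
    (MeasurableSet.iUnion fun st => (measurableSet_stuckRetry u).preimage
      (measurable_shiftPair st.1 st.2))

/-- This replaces an event about the infinite future by one determined by time `n`, to which the
comparison of common and independent environments applies. -/
theorem freeze_mem_regenEvent_iff {u : Lattice d} {n : ℕ} {p : Path d × Path d}
    (h : p ∉ exceptional u n) (y : Lattice d) :
    (freeze n p.1, freeze n p.2) ∈ regenEvent u y ↔ p ∈ regenEvent u y := by
  rw [exceptional, Set.mem_union, not_or, Set.mem_compl_iff, not_not, Set.mem_iUnion,
    not_exists] at h
  obtain ⟨⟨s, t, hst, hs, ht⟩, hstuck⟩ := h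
  obtain ⟨h1, h2⟩ := freeze_regeneration hst hs ht (hstuck (s, t))
  refine and_congr h2 ?_
  simp only [regenDiffEvent, Set.mem_ofPred_eq, h1, hst]
  refine exists_congr fun a => exists_congr fun b => and_congr_right fun hab => ?_
  obtain ⟨rfl, rfl⟩ : s = a ∧ t = b := by simpa using hab
  rw [freeze_of_le _ hs, freeze_of_le _ ht]

theorem exists_mem_regenDiffEvent {u : Lattice d} {p : Path d × Path d}
    (h0 : ∃ st, regenTime u p.1 p.2 = some st) : ∃ y : LevelZero u, p ∈ regenDiffEvent u y := by
  obtain ⟨⟨s, t⟩, hst⟩ := h0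
  refine ⟨⟨p.2 t - p.1 s, ?_⟩, s, t, hst, rfl⟩
  rw [sub_dotProduct, regenTime_level hst, sub_self]

/-! ### Comparison of two laws -/

/-- Two laws that agree on the frozen events assign almost the same conditional probabilities to
the regeneration events. -/
theorem one_sub_tsum_min_le {u : Lattice d} {n : ℕ} {μ ν : Measure (Path d × Path d)}
    [IsProbabilityMeasure μ] [IsProbabilityMeasure ν] {η ε : ℝ≥0∞} (hη : η ≠ 0)
    (hμ : η ≤ μ (noBacktrack u)) (hν : η ≤ ν (noBacktrack u))
    (hμe : μ (exceptional u n) ≤ ε) (hνe : ν (exceptional u n) ≤ ε)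
    (hμm : μ (rangesMeet n) ≤ ε) (hνm : ν (rangesMeet n) ≤ ε)
    (hagree : ∀ y : LevelZero u, μ (frozenEvent u n y) = ν (frozenEvent u n y)) :
    1 - ∑' y : LevelZero u, min (cond μ (noBacktrack u) (regenDiffEvent u y))
      (cond ν (noBacktrack u) (regenDiffEvent u y)) ≤ 4 * ε / η := by
  have mfro : ∀ y, MeasurableSet (frozenEvent u n y) := fun y =>
    (determinedBy_frozenEvent u n y).measurableSet
  have dfro : Pairwise (Function.onFun Disjoint fun y : LevelZero u => frozenEvent u n y) := by
    intro y z hyz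
    refine Set.disjoint_left.2 fun p hp hq => ?_
    exact Set.disjoint_left.1 (disjoint_regenDiffEvent u (fun h => hyz (Subtype.ext h)))
      hp.1.2 hq.1.2
  have upper : ∀ (τ : Measure (Path d × Path d)) (y : LevelZero u), τ (frozenEvent u n y) ≤
      τ (regenEvent u y) + τ (frozenEvent u n y ∩ exceptional u n) := by
    intro τ y
    refine (measure_mono fun p hp => ?_).trans (measure_union_le _ _)
    by_cases he : p ∈ exceptional u n
    · exact Or.inr ⟨hp, he⟩
    · exact Or.inl ((freeze_mem_regenEvent_iff he y).1 hp.1)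
  have errsum : ∀ τ : Measure (Path d × Path d),
      ∑' y : LevelZero u, τ (frozenEvent u n y ∩ exceptional u n) ≤ τ (exceptional u n) := by
    intro τ
    rw [← measure_iUnion]
    · exact measure_mono (Set.iUnion_subset fun y => Set.inter_subset_right)
    · intro y z hyz
      exact (dfro hyz).mono Set.inter_subset_left Set.inter_subset_left
    · exact fun y => (mfro y).inter (measurableSet_exceptional u n)
  -- Off the two error events, a pair without backtracking has regenerated with some difference in
  -- `𝕍_d` and thus belongs to one of the frozen events.
  have lower : ∀ τ : Measure (Path d × Path d), τ (noBacktrack u) ≤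
      ∑' y : LevelZero u, τ (frozenEvent u n y) + τ (exceptional u n) + τ (rangesMeet n) := by
    intro τ
    have hsub : noBacktrack u ⊆
        ((⋃ y : LevelZero u, frozenEvent u n y) ∪ exceptional u n) ∪ rangesMeet n := by
      intro p hp
      by_cases hm : p ∈ rangesMeet n
      · exact Or.inr hm
      by_cases he : p ∈ exceptional u n
      · exact Or.inl (Or.inr he)
      refine Or.inl (Or.inl ?_)
      have hreg : p ∈ regenBefore u n := by
        by_contra h
        exact he (Or.inl h)
      obtain ⟨s, t, hst, -, -⟩ := hreg
      obtain ⟨y, hy⟩ := exists_mem_regenDiffEvent ⟨_, hst⟩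
      exact Set.mem_iUnion.2 ⟨y, (freeze_mem_regenEvent_iff he y).2 ⟨hp, hy⟩, hm⟩
    refine (measure_mono hsub).trans ((measure_union_le _ _).trans ?_)
    gcongr
    refine (measure_union_le _ _).trans ?_
    gcongr
    exact measure_iUnion_le _
  -- The two laws may have different normalizations. Using the larger one for both preserves the
  -- inequality between the minimum of the unnormalized probabilities and that of the conditional
  -- ones.
  set Z := max (μ (noBacktrack u)) (ν (noBacktrack u)) with hZ
  have hηZ : η ≤ Z := hμ.trans (le_max_left _ _)
  have hZ0 : Z ≠ 0 := fun h => hη (le_antisymm (h ▸ hηZ) zero_le)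
  have hZt : Z ≠ ⊤ := ne_top_of_le_ne_top ENNReal.one_ne_top (max_le prob_le_one prob_le_one)
  set S := ∑' y : LevelZero u, min (cond μ (noBacktrack u) (regenDiffEvent u y))
      (cond ν (noBacktrack u) (regenDiffEvent u y)) with hS
  have hmin : ∀ y : LevelZero u, min (μ (regenEvent u y)) (ν (regenEvent u y)) ≤
      Z * min (cond μ (noBacktrack u) (regenDiffEvent u y))
        (cond ν (noBacktrack u) (regenDiffEvent u y)) := by
    intro y
    have aux : ∀ τ : Measure (Path d × Path d), η ≤ τ (noBacktrack u) → τ (noBacktrack u) ≤ Z →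
        τ (regenEvent u y) ≤ Z * cond τ (noBacktrack u) (regenDiffEvent u y) := by
      intro τ h1 h2
      rw [cond_apply (measurableSet_noBacktrack u)]
      change τ (noBacktrack u ∩ _) ≤ _
      have h3 : τ (noBacktrack u) ≠ 0 := fun h => hη (le_antisymm (h ▸ h1) zero_le)
      have h4 : τ (noBacktrack u) ≠ ⊤ := ne_top_of_le_ne_top hZt h2
      rw [← mul_assoc]
      refine le_mul_of_one_le_left zero_le ?_
      rw [← ENNReal.mul_inv_cancel h3 h4]
      gcongr
    rw [mul_min]
    exact min_le_min (aux μ hμ (le_max_left _ _)) (aux ν hν (le_max_right _ _))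
  -- The frozen events have the same probability under both laws, so each is bounded through `μ` and
  -- through `ν`, hence by the minimum of the two regeneration probabilities plus errors.
  have hc : ∑' y : LevelZero u, μ (frozenEvent u n y) ≤ Z * S + (ε + ε) := by
    have h1 : ∀ y : LevelZero u, μ (frozenEvent u n y) ≤
        min (μ (regenEvent u y)) (ν (regenEvent u y)) +
          (μ (frozenEvent u n y ∩ exceptional u n) + ν (frozenEvent u n y ∩ exceptional u n)) := by
      intro y
      rcases min_cases (μ (regenEvent u y)) (ν (regenEvent u y)) with ⟨h, -⟩ | ⟨h, -⟩
      · rw [h, ← add_assoc]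
        exact (upper μ y).trans le_self_add
      · rw [h, hagree y, add_comm (μ _), ← add_assoc]
        exact (upper ν y).trans le_self_add
    refine (ENNReal.tsum_le_tsum h1).trans ?_
    rw [ENNReal.tsum_add, ENNReal.tsum_add, hS, ← ENNReal.tsum_mul_left]
    exact add_le_add (ENNReal.tsum_le_tsum hmin)
      (add_le_add ((errsum μ).trans hμe) ((errsum ν).trans hνe))
  -- Two errors come from comparing frozen and true events under both laws, one from the exceptional
  -- event and one from the meeting of the ranges.
  have hZle : Z ≤ Z * S + 4 * ε := by
    have e4 : Z * S + 4 * ε = Z * S + (ε + ε) + ε + ε := by ring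
    rw [e4]
    refine max_le ((lower μ).trans (add_le_add (add_le_add hc hμe) hμm)) ((lower ν).trans ?_)
    refine add_le_add (add_le_add ?_ hνe) hνm
    simp_rw [← hagree]
    exact hc
  rw [tsub_le_iff_right]
  calc (1 : ℝ≥0∞) = Z / Z := (ENNReal.div_self hZ0 hZt).symm
    _ ≤ (Z * S + 4 * ε) / Z := ENNReal.div_le_div_right hZle _
    _ = S + 4 * ε / Z := by
        rw [ENNReal.add_div, mul_comm, ENNReal.mul_div_cancel_right hZ0 hZt]
    _ ≤ 4 * ε / η + S := by
        rw [add_comm]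
        gcongr

/-! ### Maximal couplings -/

theorem ennreal_tsum_sub {α : Type*} {f g : α → ℝ≥0∞} (hg : ∑' a, g a ≠ ⊤) (hle : ∀ a, g a ≤ f a) :
    ∑' a, (f a - g a) = ∑' a, f a - ∑' a, g a := by
  refine ENNReal.eq_sub_of_add_eq hg ?_
  rw [← ENNReal.tsum_add]
  exact tsum_congr fun a => tsub_add_cancel_of_le (hle a)

/-- The common part `min (f a) (g a)` is placed on the diagonal, and the two excesses, both of total
mass `D`, are coupled independently with the normalization `1 / D`. -/
theorem exists_coupling {α : Type*} [MeasurableSpace α] [Countable α] [MeasurableSingletonClass α]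
    {f g : α → ℝ≥0∞} (hf : ∑' a, f a = 1) (hg : ∑' a, g a = 1) :
    ∃ μ : Measure (α × α), IsProbabilityMeasure μ ∧ (∀ a, μ {p | p.1 = a} = f a) ∧
      (∀ a, μ {p | p.2 = a} = g a) ∧ μ {p | p.1 ≠ p.2} ≤ 1 - ∑' a, min (f a) (g a) := by
  classical
  set s := ∑' a, min (f a) (g a) with hs
  have hs1 : s ≤ 1 := hf ▸ ENNReal.tsum_le_tsum fun a => min_le_left _ _
  have hst : s ≠ ⊤ := ne_top_of_le_ne_top ENNReal.one_ne_top hs1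
  set D := 1 - s with hD
  have hDt : D ≠ ⊤ := ne_top_of_le_ne_top ENNReal.one_ne_top tsub_le_self
  set F : α → ℝ≥0∞ := fun a => f a - min (f a) (g a) with hF
  set G : α → ℝ≥0∞ := fun a => g a - min (f a) (g a) with hG
  have sF : ∑' a, F a = D := by
    rw [hF, ennreal_tsum_sub hst fun a => min_le_left _ _, hf]
  have sG : ∑' a, G a = D := by
    rw [hG, ennreal_tsum_sub hst fun a => min_le_right _ _, hg]
  -- If `D = 0`, the quotient `D / D` is zero, but then the excesses vanish as well.
  have hFD : ∀ a, F a * (D / D) = F a := by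
    intro a
    by_cases h : D = 0
    · have : F a = 0 := by rw [h, ENNReal.tsum_eq_zero] at sF; exact sF a
      rw [this, zero_mul]
    · rw [ENNReal.div_self h hDt, mul_one]
  have hGD : ∀ a, G a * (D / D) = G a := by
    intro a
    by_cases h : D = 0
    · have : G a = 0 := by rw [h, ENNReal.tsum_eq_zero] at sG; exact sG a
      rw [this, zero_mul]
    · rw [ENNReal.div_self h hDt, mul_one]
  set κ : α × α → ℝ≥0∞ := fun p =>
    (if p.1 = p.2 then min (f p.1) (g p.1) else 0) + F p.1 * G p.2 / D with hκ
  have row : ∀ a, ∑' b, κ (a, b) = f a := by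
    intro a
    simp only [hκ]
    rw [ENNReal.tsum_add, show ∑' b, F a * G b / D = F a * (D / D) by
      simp_rw [mul_div_assoc, div_eq_mul_inv]
      rw [ENNReal.tsum_mul_left, ENNReal.tsum_mul_right, sG], hFD]
    rw [tsum_eq_single a fun b hb => if_neg (Ne.symm hb), if_pos rfl]
    exact add_tsub_cancel_of_le (min_le_left _ _)
  have col : ∀ b, ∑' a, κ (a, b) = g b := by
    intro b
    simp only [hκ]
    rw [ENNReal.tsum_add, show ∑' a, F a * G b / D = G b * (D / D) by
      simp_rw [mul_comm (F _), mul_div_assoc, div_eq_mul_inv]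
      rw [ENNReal.tsum_mul_left, ENNReal.tsum_mul_right, sF], hGD]
    rw [tsum_eq_single b fun a ha => if_neg ha, if_pos rfl]
    exact add_tsub_cancel_of_le (min_le_right _ _)
  have tot : ∑' p, κ p = 1 := by
    rw [ENNReal.tsum_prod', ← hf]
    exact tsum_congr row
  set p : PMF (α × α) := ⟨κ, tot ▸ ENNReal.summable.hasSum⟩ with hp
  have app : ∀ S : Set (α × α), p.toMeasure S = ∑' q, S.indicator κ q := fun S =>
    PMF.toMeasure_apply p S.to_countable.measurableSet
  refine ⟨p.toMeasure, inferInstance, fun a => ?_, fun b => ?_, ?_⟩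
  · rw [app, ENNReal.tsum_prod', tsum_eq_single a]
    · rw [← row a]
      exact tsum_congr fun b => Set.indicator_of_mem (by rfl) _
    · intro c hc
      exact ENNReal.tsum_eq_zero.2 fun b =>
        Set.indicator_of_notMem (s := {p : α × α | p.1 = a}) hc _
  · rw [app, ENNReal.tsum_prod', ENNReal.tsum_comm, tsum_eq_single b]
    · rw [← col b]
      exact tsum_congr fun a => Set.indicator_of_mem (by rfl) _
    · intro c hc
      exact ENNReal.tsum_eq_zero.2 fun a =>
        Set.indicator_of_notMem (s := {p : α × α | p.2 = b}) hc _
  · rw [app]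
    calc ∑' q, {p : α × α | p.1 ≠ p.2}.indicator κ q ≤ ∑' q : α × α, F q.1 * G q.2 / D := by
          refine ENNReal.tsum_le_tsum fun q => ?_
          by_cases hq : q.1 = q.2
          · rw [Set.indicator_of_notMem (by simpa using hq)]
            exact zero_le
          · rw [Set.indicator_of_mem (by exact hq)]
            simp [hκ, hq]
      _ = ∑' a, F a * (D / D) := by
          rw [ENNReal.tsum_prod']
          refine tsum_congr fun a => ?_
          simp_rw [mul_div_assoc, div_eq_mul_inv]
          rw [ENNReal.tsum_mul_left, ENNReal.tsum_mul_right, sG]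
      _ = D := by simp_rw [hFD]; exact sF

end RWRE

namespace RWRE

variable {d : ℕ}

/-! ### Laws of two walks in good environments -/

/-- `τ` inherits the bounds on the probabilities of events that hold for all pairs of walks from
`x` and `y` in environments subject to `StepBounds u P`. -/
structure InheritsBounds (u : Lattice d) (P : StepConstants) (x y : Lattice d)
    (τ : Measure (Path d × Path d)) : Prop where
  measure_le : ∀ (E : Set (Path d × Path d)) (ε : ℝ≥0∞), MeasurableSet E →
    (∀ ω ω', StepBounds u P ω → StepBounds u P ω' → quenchedPair ω ω' x y E ≤ ε) → τ E ≤ ε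

section

variable {u : Lattice d} {P : StepConstants} {x y : Lattice d} {τ : Measure (Path d × Path d)}

/-- Only upper bounds are inherited, so the lower bound is transferred through the complement. -/
theorem InheritsBounds.le_measure_noBacktrack [IsProbabilityMeasure τ]
    (h : InheritsBounds u P x y τ) :
    ENNReal.ofReal ((1 - Real.exp (-P.b₀)) ^ 2) ≤ τ (noBacktrack u) := by
  have hb : Real.exp (-P.b₀) ≤ 1 := Real.exp_le_one_iff.2 (by linarith [P.b₀_pos])
  have h1 : ENNReal.ofReal ((1 - Real.exp (-P.b₀)) ^ 2) ≤ 1 := by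
    rw [ENNReal.ofReal_le_one]
    exact pow_le_one₀ (by linarith) (by linarith [Real.exp_pos (-P.b₀)])
  have h2 := h.measure_le (noBacktrack u)ᶜ (1 - ENNReal.ofReal ((1 - Real.exp (-P.b₀)) ^ 2))
    (measurableSet_noBacktrack u).compl fun ω ω' hω hω' => by
      rw [prob_compl_eq_one_sub (measurableSet_noBacktrack u)]
      exact tsub_le_tsub_left (hω.le_measure_noBacktrack_pair hω' x y) _
  rw [prob_compl_eq_one_sub (measurableSet_noBacktrack u)] at h2
  rw [← ENNReal.sub_sub_cancel ENNReal.one_ne_top h1,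
    ← ENNReal.sub_sub_cancel ENNReal.one_ne_top (prob_le_one (μ := τ) (s := noBacktrack u))]
  exact tsub_le_tsub_left h2 _

theorem InheritsBounds.measure_exceptional_le (h : InheritsBounds u P x y τ) {l A : ℝ} (n : ℕ)
    (hA : ∀ ω ω', StepBounds u P ω → StepBounds u P ω' →
      quenchedPair ω ω' x y (regenBefore u n)ᶜ ≤ ENNReal.ofReal (A * Real.exp (-l * n))) :
    τ (exceptional u n) ≤ ENNReal.ofReal (A * Real.exp (-l * n)) := by
  refine h.measure_le _ _ (measurableSet_exceptional u n) fun ω ω' hω hω' => ?_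
  refine (measure_union_le _ _).trans ?_
  have hz : quenchedPair ω ω' x y (⋃ st : ℕ × ℕ, shiftPair st.1 st.2 ⁻¹' stuckRetry u) = 0 :=
    measure_iUnion_null_iff.2 fun st => measure_shiftPair_stuckRetry hω hω' x y st.1 st.2
  exact (add_le_add (hA ω ω' hω hω') hz.le).trans (add_zero _).le

/-- Letting `n → ∞` in the tail bound shows that a regeneration occurs almost surely; conditioning
is absolutely continuous, so the disjoint difference events exhaust the conditional law. -/
theorem InheritsBounds.tsum_cond_regenDiffEvent [IsProbabilityMeasure τ]
    (h : InheritsBounds u P x y τ) {l A : ℝ} (hl : 0 < l)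
    (hA : ∀ ω ω', StepBounds u P ω → StepBounds u P ω' → ∀ n : ℕ,
      quenchedPair ω ω' x y (regenBefore u n)ᶜ ≤ ENNReal.ofReal (A * Real.exp (-l * n))) :
    ∑' z : LevelZero u, cond τ (noBacktrack u) (regenDiffEvent u z) = 1 := by
  have hb : Real.exp (-P.b₀) < 1 := Real.exp_lt_one_iff.2 (by linarith [P.b₀_pos])
  have hNB : τ (noBacktrack u) ≠ 0 := by
    refine ((ENNReal.ofReal_pos.2 ?_).trans_le h.le_measure_noBacktrack).ne'
    exact pow_pos (by linarith) 2
  have hcond : IsProbabilityMeasure (cond τ (noBacktrack u)) := cond_isProbabilityMeasure hNB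
  rw [← measure_iUnion (fun a b hab => disjoint_regenDiffEvent u fun e => hab (Subtype.ext e))
    fun z => measurableSet_regenDiffEvent u z]
  refine (prob_compl_eq_zero_iff (MeasurableSet.iUnion fun z : LevelZero u =>
    measurableSet_regenDiffEvent u z)).1 (cond_absolutelyContinuous ?_)
  have hle : ∀ n : ℕ, τ (⋃ z : LevelZero u, regenDiffEvent u z)ᶜ ≤
      ENNReal.ofReal (A * Real.exp (-l * n)) := by
    intro n
    refine (measure_mono (Set.compl_subset_compl.2 ?_)).trans
      (h.measure_le (regenBefore u n)ᶜ _ (measurableSet_regenBefore u n).compl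
        fun ω ω' hω hω' => hA ω ω' hω hω' n)
    rintro p ⟨s, t, hst, -, -⟩
    obtain ⟨z, hz⟩ := exists_mem_regenDiffEvent ⟨_, hst⟩
    exact Set.mem_iUnion.2 ⟨z, hz⟩
  have hlim : Filter.Tendsto (fun n : ℕ => ENNReal.ofReal (A * Real.exp (-l * n))) Filter.atTop
      (nhds 0) := by
    rw [← ENNReal.ofReal_zero, ← mul_zero A]
    refine ENNReal.tendsto_ofReal (Filter.Tendsto.const_mul A (Real.tendsto_exp_atBot.comp ?_))
    exact (tendsto_natCast_atTop_atTop).const_mul_atTop_of_neg (by linarith)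
  exact le_antisymm (ge_of_tendsto' hlim hle) zero_le

end

theorem inheritsBounds_averagedPair {m : Measure (PMF (Lattice d))} [IsProbabilityMeasure m]
    {u : Lattice d} {P : StepConstants} (hP : ∀ᵐ ω ∂(envLaw m), StepBounds u P ω)
    (x y : Lattice d) : InheritsBounds u P x y (averagedPair m x y) :=
  ⟨fun _ _ hE h => averagedPair_le hP hE h⟩

theorem inheritsBounds_averaged_prod {m : Measure (PMF (Lattice d))} [IsProbabilityMeasure m]
    {u : Lattice d} {P : StepConstants} (hP : ∀ᵐ ω ∂(envLaw m), StepBounds u P ω)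
    (x y : Lattice d) : InheritsBounds u P x y ((averaged m x).prod (averaged m y)) :=
  ⟨fun _ _ hE h => averaged_prod_le hP hE h⟩

/-! ### Comparison of the two transition probabilities -/

theorem averagedPair_frozenEvent {m : Measure (PMF (Lattice d))} [IsProbabilityMeasure m]
    (x y u z : Lattice d) (n : ℕ) : averagedPair m x y (frozenEvent u n z) =
      ((averaged m x).prod (averaged m y)) (frozenEvent u n z) :=
  averagedPair_eq_of_determinedBy x y (determinedBy_frozenEvent u n z)
    (Set.disjoint_left.2 fun _ hp => hp.2)

theorem StepConstants.exists_time_scale (P : StepConstants) {l A : ℝ} (hl : 0 < l) (hA : 0 ≤ A) :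
    ∃ B α : ℝ, 0 < B ∧ 0 < α ∧ ∀ r : ℝ, 0 ≤ r → ∃ n : ℕ,
      A * Real.exp (-l * n) ≤ B * Real.exp (-α * r) ∧
      2 * ((n : ℝ) + 1) * Real.exp (P.s * (P.M * n - r / 2)) ≤ B * Real.exp (-α * r) := by
  have hs := P.s_pos
  have hM := P.M_pos
  have hsM : 0 < P.s * P.M := mul_pos hs hM
  -- With `n ≤ θ * r` and `n + 1 ≤ exp n`, the growth `(s * M + 1) * n` uses up at most half of the
  -- gain `s * r / 2`.
  obtain ⟨θ, hθ0, hθs⟩ : ∃ θ : ℝ, 0 < θ ∧ (P.s * P.M + 1) * θ = P.s / 4 :=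
    ⟨P.s / (4 * (P.s * P.M + 1)), by positivity, by field_simp⟩
  -- The factor `exp l` pays for rounding `θ * r` down to an integer, and the summand `2` is the
  -- prefactor of the meeting bound.
  refine ⟨A * Real.exp l + 2, min (l * θ) (P.s / 4), by positivity,
    lt_min (by positivity) (by positivity), fun r hr => ⟨⌊θ * r⌋₊, ?_, ?_⟩⟩
  · have hn : θ * r ≤ (⌊θ * r⌋₊ : ℝ) + 1 := (Nat.lt_floor_add_one _).le
    generalize (⌊θ * r⌋₊ : ℝ) = n at hn
    have h1 : A * Real.exp (-l * n) ≤
        A * Real.exp l * Real.exp (-min (l * θ) (P.s / 4) * r) := by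
      rw [mul_assoc, ← Real.exp_add]
      refine mul_le_mul_of_nonneg_left (Real.exp_le_exp.2 ?_) hA
      have h2 : min (l * θ) (P.s / 4) * r ≤ l * θ * r :=
        mul_le_mul_of_nonneg_right (min_le_left _ _) hr
      nlinarith
    linarith [Real.exp_pos (-min (l * θ) (P.s / 4) * r)]
  · have hn : (⌊θ * r⌋₊ : ℝ) ≤ θ * r := Nat.floor_le (by positivity)
    generalize (⌊θ * r⌋₊ : ℝ) = n at hn
    have h1 : (n + 1) * Real.exp (P.s * (P.M * n - r / 2)) ≤
        Real.exp (-min (l * θ) (P.s / 4) * r) := by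
      refine (mul_le_mul_of_nonneg_right (Real.add_one_le_exp n) (Real.exp_pos _).le).trans ?_
      rw [← Real.exp_add]
      refine Real.exp_le_exp.2 ?_
      have h2 : min (l * θ) (P.s / 4) * r ≤ P.s / 4 * r :=
        mul_le_mul_of_nonneg_right (min_le_right _ _) hr
      have h3 : (P.s * P.M + 1) * n ≤ P.s / 4 * r := by
        rw [← hθs, mul_assoc]
        exact mul_le_mul_of_nonneg_left hn (by positivity)
      nlinarith
    have h4 : 0 ≤ A * Real.exp l * Real.exp (-min (l * θ) (P.s / 4) * r) := by positivity
    linarith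

theorem InheritsBounds.one_sub_tsum_min_le {u : Lattice d} {P : StepConstants} {x y : Lattice d}
    {μ ν : Measure (Path d × Path d)} [IsProbabilityMeasure μ] [IsProbabilityMeasure ν]
    (hμ : InheritsBounds u P x y μ) (hν : InheritsBounds u P x y ν) {n : ℕ} {ε : ℝ≥0∞}
    (hagree : ∀ z : LevelZero u, μ (frozenEvent u n z) = ν (frozenEvent u n z))
    (hexc : ∀ τ, InheritsBounds u P x y τ → τ (exceptional u n) ≤ ε)
    (hmeet : ∀ τ, InheritsBounds u P x y τ → τ (rangesMeet n) ≤ ε) :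
    1 - ∑' z : LevelZero u, min (cond μ (noBacktrack u) (regenDiffEvent u z))
      (cond ν (noBacktrack u) (regenDiffEvent u z)) ≤
        4 * ε / ENNReal.ofReal ((1 - Real.exp (-P.b₀)) ^ 2) := by
  have hb : Real.exp (-P.b₀) < 1 := Real.exp_lt_one_iff.2 (by linarith [P.b₀_pos])
  have hη : ENNReal.ofReal ((1 - Real.exp (-P.b₀)) ^ 2) ≠ 0 :=
    (ENNReal.ofReal_pos.2 (pow_pos (by linarith) 2)).ne'
  exact RWRE.one_sub_tsum_min_le hη hμ.le_measure_noBacktrack hν.le_measure_noBacktrack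
    (hexc μ hμ) (hexc ν hν) (hmeet μ hμ) (hmeet ν hν) hagree

theorem exists_tsum_q_and_tsum_min_le {m : Measure (PMF (Lattice d))} [IsProbabilityMeasure m]
    {u : Lattice d} {P : StepConstants} (hP : ∀ᵐ ω ∂(envLaw m), StepBounds u P ω) :
    ∃ C α : ℝ, 0 < C ∧ 0 < α ∧ ∀ x : LevelZero u,
      ∑' y, q m u x y = 1 ∧ ∑' y, qBar m u x y = 1 ∧
      1 - ∑' y, min (q m u x y) (qBar m u x y) ≤
        ENNReal.ofReal (C * Real.exp (-α * eNorm (x : Lattice d))) := by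
  obtain ⟨l, A, hl, hA0, hA⟩ := exists_measure_regenBefore_compl_le P
  obtain ⟨B, α, hB, hα, hscale⟩ := P.exists_time_scale hl hA0
  have hb : Real.exp (-P.b₀) < 1 := Real.exp_lt_one_iff.2 (by linarith [P.b₀_pos])
  have hη0 : 0 < (1 - Real.exp (-P.b₀)) ^ 2 := pow_pos (by linarith) 2
  refine ⟨4 * B / (1 - Real.exp (-P.b₀)) ^ 2, α, by positivity, hα, fun x => ?_⟩
  have hx : (0 : Lattice d) ⬝ᵥ u = (x : Lattice d) ⬝ᵥ u := by rw [zero_dotProduct, x.2]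
  have h1 := inheritsBounds_averagedPair hP 0 x
  have h2 := inheritsBounds_averaged_prod hP 0 x
  have hA' := fun ω ω' hω hω' => hA u ω ω' hω hω' 0 x hx
  refine ⟨h1.tsum_cond_regenDiffEvent hl hA', h2.tsum_cond_regenDiffEvent hl hA', ?_⟩
  obtain ⟨n, e1, e2⟩ := hscale (eNorm (x : Lattice d)) (norm_nonneg _)
  have meet : ∀ τ, InheritsBounds u P 0 x τ → τ (rangesMeet n) ≤
      ENNReal.ofReal (B * Real.exp (-α * eNorm (x : Lattice d))) := fun τ hτ =>
    hτ.measure_le _ _ (determinedBy_rangesMeet n).measurableSet fun ω ω' hω hω' =>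
      (measure_rangesMeet_le hω hω' x n).trans (ENNReal.ofReal_le_ofReal e2)
  have exc : ∀ τ, InheritsBounds u P 0 x τ → τ (exceptional u n) ≤
      ENNReal.ofReal (B * Real.exp (-α * eNorm (x : Lattice d))) := fun τ hτ =>
    (hτ.measure_exceptional_le n fun ω ω' hω hω' => hA' ω ω' hω hω' n).trans
      (ENNReal.ofReal_le_ofReal e1)
  refine (h1.one_sub_tsum_min_le h2 (fun z =>
    averagedPair_frozenEvent (d := d) (m := m) 0 (x : Lattice d) u (z : Lattice d) n)
    exc meet).trans (le_of_eq ?_)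
  rw [show (4 : ℝ≥0∞) = ENNReal.ofReal 4 by simp, ← ENNReal.ofReal_mul (by norm_num),
    ← ENNReal.ofReal_div_of_pos hη0]
  congr 1
  ring

end RWRE

/-! ### The coupled kernel. -/

/-- `𝒦 (x, x')` is the joint law of `(Y_1, Ȳ_1)` given `(Y_0, Ȳ_0) = (x, x')`. -/
theorem proposition7p7 (d : ℕ) (m : Measure (PMF (RWRE.Lattice d))) [IsProbabilityMeasure m]
    (u : RWRE.Lattice d) (hu : u ≠ 0) (hN : RWRE.NonNestling m u) (hM : RWRE.ExpMoment m)
    (hR : RWRE.UnitLevelSteps m u) :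
    ∃ C α₁ : ℝ, 0 < C ∧ 0 < α₁ ∧
      ∃ 𝒦 : Kernel (RWRE.LevelZero u × RWRE.LevelZero u) (RWRE.LevelZero u × RWRE.LevelZero u),
        IsMarkovKernel 𝒦 ∧
        (∀ x x' y, 𝒦 (x, x') {p | p.1 = y} = RWRE.q m u x y) ∧
        (∀ x x' y, 𝒦 (x, x') {p | p.2 = y} = RWRE.qBar m u x' y) ∧
        ∀ x, 𝒦 (x, x) {p | p.1 ≠ p.2}
          ≤ ENNReal.ofReal (C * Real.exp (-α₁ * RWRE.eNorm (x : RWRE.Lattice d))) := by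
  obtain ⟨P, hP⟩ := RWRE.exists_stepBounds hN hM hR
  obtain ⟨C, α, hC, hα, h⟩ := RWRE.exists_tsum_q_and_tsum_min_le hP
  -- The couplings for different starting points are chosen independently of each other; only on the
  -- diagonal is the total deficit known to be small.
  choose κ hprob hfst hsnd hne using fun z : RWRE.LevelZero u × RWRE.LevelZero u =>
    RWRE.exists_coupling (h z.1).1 (h z.2).2.1
  refine ⟨C, α, hC, hα, Kernel.ofFunOfCountable κ, ⟨hprob⟩, fun x x' y => hfst (x, x') y,
    fun x x' y => hsnd (x, x') y, fun x => ?_⟩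
  exact (hne (x, x)).trans (h x).2.2
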